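/- Let $G=(V,E)$ be a finite simple undirected graph with $n$ vertices and $m$ edges, with positive edge capacities $c:E\to\mathbb{R}_{>0}$, and let $k\in\mathbb{N}$. A $k$-cut is a set of edges $C\subseteq E$ whose removal leaves at least $k$ connected components; its cost is $\sum_{e\in C}c_e$. A vector $x:E\to\mathbb{R}$ is feasible for the linear program (C) if $x_e\ge 0$ for all $e\in E$ and $$\sum_{e\in F}x_e\;\ge\;|F|+k-n\qquad\text{for all forests } F\subseteq E ;$$ its cost is $\sum_{e\in E}c_ex_e$. There is a deterministic algorithm (a fixed program on a real RAM with unit-cost operations, whose integer operations are addition, subtraction, comparison and indexing, and whose real operations are the four arithmetic operations and comparison, without rounding) which, given $n$, $m$, $k$, a list of the edges of $G$, the capacities $c$ and any feasible solution $x$ of (C), computes a $k$-cut $C$ with $$\sum_{e\in C}c_e\;\le\;2\Bigl(1-\frac1n\Bigr)\sum_{e\in E}c_ex_e$$ in $O(m\log n)$ time; that is, there is an absolute constant $A$ such that the number of steps is at most $A\,(m\log n+1)$ on every such input. -/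

import Mathlib

/-! ## Fractional and integral `k`-cuts of a finite simple graph -/

namespace KCut

/-- A set of edges of `G` that contains no cycle. -/
def IsForest {V : Type*} (G : SimpleGraph V) (F : Finset G.edgeSet) : Prop :=
  (SimpleGraph.fromEdgeSet ((fun e : G.edgeSet => (e : Sym2 V)) '' (F : Set G.edgeSet))).IsAcyclic

/-- Feasibility for the knapsack-covering relaxation of `k`-cut:
`x ≥ 0` and `∑_{e ∈ F} x_e ≥ |F| + k - n` for all forests `F` of `G`. -/
def IsFeasible {n : ℕ} (G : SimpleGraph (Fin n)) (k : ℕ) (x : G.edgeSet → ℝ) : Prop :=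
  (∀ e, 0 ≤ x e) ∧
    ∀ F : Finset G.edgeSet, IsForest G F → (F.card : ℝ) + (k : ℝ) - (n : ℝ) ≤ ∑ e ∈ F, x e

/-- A set of edges whose removal leaves at least `k` connected components. -/
def IsKCut {n : ℕ} (G : SimpleGraph (Fin n)) (k : ℕ) (C : Finset G.edgeSet) : Prop :=
  k ≤ Nat.card
    (G.deleteEdges ((fun e : G.edgeSet => (e : Sym2 (Fin n))) '' (C : Set G.edgeSet))).ConnectedComponent

end KCut

/-! ## A real RAM with a step count

A machine with random access to integer cells and to real cells. Integers can be added,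
subtracted and compared, and serve as addresses; reals can be added, subtracted, multiplied,
divided and compared. An integer can be converted to a real but not conversely (there is no
rounding), and programs contain no constants but natural numbers. Programs are finite texts of a
structured language, and every evaluation of an operation, memory access, test or assignment takes
one step. -/

namespace RealRAM

/-- The memory: cell number `i` of the integer array number `a` is `nat a i`, and cell number `i`
of the real array number `a` is `real a i`. A program mentions only finitely many arrays. -/
@[ext]
structure State where
  nat : ℕ → ℕ → ℕ
  real : ℕ → ℕ → ℝ

/-- Integer expressions; `get a i` reads cell `i` of the integer array `a`. -/
inductive NExp where
  | lit (c : ℕ)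
  | get (a : ℕ) (i : NExp)
  | add (e f : NExp)
  | sub (e f : NExp)

/-- Real expressions; `get a i` reads cell `i` of the real array `a`. -/
inductive RExp where
  | ofNat (e : NExp)
  | get (a : ℕ) (i : NExp)
  | add (e f : RExp)
  | sub (e f : RExp)
  | mul (e f : RExp)
  | div (e f : RExp)

/-- Tests. -/
inductive BExp where
  | natLe (e f : NExp)
  | realLe (e f : RExp)
  | not (b : BExp)
  | and (b d : BExp)

/-- Programs; `setNat a i e` and `setReal a i e` store the value of `e` in cell `i` of the
array `a`. -/
inductive Prog where
  | skip
  | setNat (a : ℕ) (i e : NExp)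
  | setReal (a : ℕ) (i : NExp) (e : RExp)
  | seq (p q : Prog)
  | ite (b : BExp) (p q : Prog)
  | loop (b : BExp) (p : Prog)

def NExp.eval (s : State) : NExp → ℕ
  | lit c => c
  | get a i => s.nat a (i.eval s)
  | add e f => e.eval s + f.eval s
  | sub e f => e.eval s - f.eval s

noncomputable def RExp.eval (s : State) : RExp → ℝ
  | ofNat e => (e.eval s : ℝ)
  | get a i => s.real a (i.eval s)
  | add e f => e.eval s + f.eval s
  | sub e f => e.eval s - f.eval s
  | mul e f => e.eval s * f.eval s
  | div e f => e.eval s / f.eval s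

def BExp.eval (s : State) : BExp → Prop
  | natLe e f => e.eval s ≤ f.eval s
  | realLe e f => e.eval s ≤ f.eval s
  | not b => ¬ b.eval s
  | and b d => b.eval s ∧ d.eval s

/-- The number of steps for the evaluation of an expression. -/
def NExp.cost : NExp → ℕ
  | lit _ => 1
  | get _ i => i.cost + 1
  | add e f => e.cost + f.cost + 1
  | sub e f => e.cost + f.cost + 1

/-- The number of steps for the evaluation of an expression. -/
def RExp.cost : RExp → ℕ
  | ofNat e => e.cost + 1
  | get _ i => i.cost + 1
  | add e f => e.cost + f.cost + 1
  | sub e f => e.cost + f.cost + 1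
  | mul e f => e.cost + f.cost + 1
  | div e f => e.cost + f.cost + 1

/-- The number of steps for the evaluation of a test. -/
def BExp.cost : BExp → ℕ
  | natLe e f => e.cost + f.cost + 1
  | realLe e f => e.cost + f.cost + 1
  | not b => b.cost + 1
  | and b d => b.cost + d.cost + 1

def State.setNat (s : State) (a i v : ℕ) : State :=
  { s with nat := Function.update s.nat a (Function.update (s.nat a) i v) }

noncomputable def State.setReal (s : State) (a i : ℕ) (v : ℝ) : State :=
  { s with real := Function.update s.real a (Function.update (s.real a) i v) }

/-- `Run p s s' t`: started in memory `s`, the program `p` halts after exactly `t` steps with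
memory `s'`. -/
inductive Run : Prog → State → State → ℕ → Prop
  | skip (s : State) : Run Prog.skip s s 1
  | setNat (s : State) (a : ℕ) (i e : NExp) :
      Run (Prog.setNat a i e) s (s.setNat a (i.eval s) (e.eval s)) (i.cost + e.cost + 1)
  | setReal (s : State) (a : ℕ) (i : NExp) (e : RExp) :
      Run (Prog.setReal a i e) s (s.setReal a (i.eval s) (e.eval s)) (i.cost + e.cost + 1)
  | seq {p q : Prog} {s s₁ s₂ : State} {t₁ t₂ : ℕ} (h₁ : Run p s s₁ t₁) (h₂ : Run q s₁ s₂ t₂) :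
      Run (Prog.seq p q) s s₂ (t₁ + t₂)
  | iteTrue {b : BExp} {p q : Prog} {s s₁ : State} {t : ℕ} (hb : b.eval s) (h : Run p s s₁ t) :
      Run (Prog.ite b p q) s s₁ (b.cost + 1 + t)
  | iteFalse {b : BExp} {p q : Prog} {s s₁ : State} {t : ℕ} (hb : ¬ b.eval s) (h : Run q s s₁ t) :
      Run (Prog.ite b p q) s s₁ (b.cost + 1 + t)
  | loopTrue {b : BExp} {p : Prog} {s s₁ s₂ : State} {t₁ t₂ : ℕ} (hb : b.eval s)
      (h₁ : Run p s s₁ t₁) (h₂ : Run (Prog.loop b p) s₁ s₂ t₂) :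
      Run (Prog.loop b p) s s₂ (b.cost + 1 + t₁ + t₂)
  | loopFalse {b : BExp} {p : Prog} {s : State} (hb : ¬ b.eval s) :
      Run (Prog.loop b p) s s (b.cost + 1)

end RealRAM

namespace KCut

/-- A finite list as the contents of an array, followed by zeros. -/
def toArray {α : Type*} [Zero α] {m : ℕ} (f : Fin m → α) : ℕ → α :=
  fun i => if h : i < m then f ⟨i, h⟩ else 0

/-- The initial memory for a graph with `n` vertices and `m` edges given as a list. Integer array
`0` holds `n, m, k`; the `i`-th edge joins the vertices in cell `i` of the integer arrays `1` and
`2`, and has its capacity in cell `i` of the real array `0` and its fractional value in cell `i`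
of the real array `1`. Everything else is zero. -/
noncomputable def inputState {n m : ℕ} (k : ℕ) (u v : Fin m → Fin n) (c x : Fin m → ℝ) :
    RealRAM.State where
  nat := fun a =>
    if a = 0 then toArray ![n, m, k]
    else if a = 1 then toArray (fun i => (u i : ℕ))
    else if a = 2 then toArray (fun i => (v i : ℕ))
    else fun _ => 0
  real := fun a =>
    if a = 0 then toArray c
    else if a = 1 then toArray x
    else fun _ => 0

/-- The set of edges that a final memory describes: the `i`-th edge belongs to it iff cell `i`
of the integer array `3` holds the value `1`. -/
def Outputs {n m : ℕ} {G : SimpleGraph (Fin n)} (ε : Fin m ≃ G.edgeSet) (s : RealRAM.State)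
    (C : Finset G.edgeSet) : Prop :=
  ∀ i : Fin m, ε i ∈ C ↔ s.nat 3 i = 1

end KCut

/-!
Sort the edges by `x` and run Kruskal's algorithm in this order; let `f` be the number of edges of
the Kruskal forest. Each of its `f` mergers chooses a vertex set to cut around, out of the two
classes that it unites and the candidates that earlier mergers set aside for these classes: with
the cheapest candidate of each class at hand, it chooses the cheaper one and sets the other aside
for the union. Going back in time, the indicator vectors of the chosen sets and of the final
classes generate those of all classes, hence span `ℝⁿ`; being `n` vectors, they are linearly
independent. So if the `p = f + k - n` cheapest chosen cuts are removed, the functions constant on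
the components contain `p + (n - f) = k` independent vectors: there are at least `k` components.

Let `W j` be the weight of the cut chosen at merger `j`, and `t j` the value of `x` on its edge,
truncated to at most `1`. The cuts chosen from merger `j` on, together with the best candidate of
any one class, weigh no more than the cuts around all classes just before merger `j`; averaging
over the classes, they weigh at most `2 (1 - 1/n)` times the edges between different classes.
Such edges have `x e ≥ t j`, so summing over `j` by parts gives
`∑ j, t j * W j ≤ 2 (1 - 1/n) * ∑ e, c e * x e`. Feasibility for the edges of the Kruskal forest
with `x e < 1` says that `∑ j, t j ≥ p`, and as `0 ≤ t j ≤ 1`, the `p` smallest of the `W j` add up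
to at most `∑ j, t j * W j`.

Sorting by a tournament and union by rank keep the running time within `O(m log n)`.
-/

namespace RealRAM

instance (c : ℕ) : OfNat NExp c := ⟨.lit c⟩
instance : Add NExp := ⟨.add⟩
instance : Sub NExp := ⟨.sub⟩
instance : Add RExp := ⟨.add⟩
instance : Sub RExp := ⟨.sub⟩

@[simp] theorem NExp.eval_ofNat (s : State) (c : ℕ) :
    NExp.eval s (no_index (OfNat.ofNat c)) = c := rfl

@[simp] theorem NExp.eval_add (s : State) (e f : NExp) :
    (e + f).eval s = e.eval s + f.eval s := rfl

@[simp] theorem NExp.eval_sub (s : State) (e f : NExp) :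
    (e - f).eval s = e.eval s - f.eval s := rfl

@[simp] theorem RExp.eval_add (s : State) (e f : RExp) :
    (e + f).eval s = e.eval s + f.eval s := rfl

@[simp] theorem RExp.eval_sub (s : State) (e f : RExp) :
    (e - f).eval s = e.eval s - f.eval s := rfl

attribute [simp] NExp.eval RExp.eval BExp.eval

@[simp] theorem State.setNat_nat (s : State) (a i v a' : ℕ) :
    (s.setNat a i v).nat a' = if a' = a then Function.update (s.nat a) i v else s.nat a' := by
  simp only [State.setNat, Function.update_apply]

@[simp] theorem State.setNat_real (s : State) (a i v : ℕ) : (s.setNat a i v).real = s.real := rfl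

@[simp] theorem State.setReal_real (s : State) (a i : ℕ) (v : ℝ) (a' : ℕ) :
    (s.setReal a i v).real a' = if a' = a then Function.update (s.real a) i v else s.real a' := by
  simp only [State.setReal, Function.update_apply]

@[simp] theorem State.setReal_nat (s : State) (a i : ℕ) (v : ℝ) : (s.setReal a i v).nat = s.nat :=
  rfl

/-- The integer variable kept in cell `0` of the array `a`. -/
abbrev NExp.var (a : ℕ) : NExp := .get a 0

namespace Prog

local notation:60 p:61 " ;; " q:60 => Prog.seq p q

/-- Assignment to the integer variable kept in cell `0` of the array `a`. -/
abbrev setVar (a : ℕ) (e : NExp) : Prog := .setNat a 0 e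

/-- The counting loop that executes `p` for `i = 0, …, N - 1`, where the counter is the variable
`i`. -/
abbrev forTo (i : ℕ) (N : NExp) (p : Prog) : Prog :=
  setVar i 0 ;; loop (.not (.natLe N (.var i))) (p ;; setVar i (.var i + 1))

/-- The state reached by a program without loops (loops are skipped). -/
@[simp]
noncomputable def exec : Prog → State → State
  | skip, s => s
  | setNat a i e, s => s.setNat a (i.eval s) (e.eval s)
  | setReal a i e, s => s.setReal a (i.eval s) (e.eval s)
  | seq p q, s => q.exec (p.exec s)
  | ite b p q, s => open Classical in if b.eval s then p.exec s else q.exec s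
  | loop _ _, s => s

/-- Absence of loops; the running time of such a program is bounded by its text. -/
def LoopFree : Prog → Bool
  | seq p q => p.LoopFree && q.LoopFree
  | ite _ p q => p.LoopFree && q.LoopFree
  | loop _ _ => false
  | _ => true

/-- An upper bound for the running time of a program without loops. -/
def maxCost : Prog → ℕ
  | skip => 1
  | setNat _ i e => i.cost + e.cost + 1
  | setReal _ i e => i.cost + e.cost + 1
  | seq p q => p.maxCost + q.maxCost
  | ite b p q => b.cost + 1 + (p.maxCost + q.maxCost)
  | loop _ _ => 0

/-- The integer arrays that a program may modify. -/
def writesNat : Prog → List ℕ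
  | setNat a _ _ => [a]
  | seq p q => p.writesNat ++ q.writesNat
  | ite _ p q => p.writesNat ++ q.writesNat
  | loop _ p => p.writesNat
  | _ => []

/-- The real arrays that a program may modify. -/
def writesReal : Prog → List ℕ
  | setReal a _ _ => [a]
  | seq p q => p.writesReal ++ q.writesReal
  | ite _ p q => p.writesReal ++ q.writesReal
  | loop _ p => p.writesReal
  | _ => []

/-- The memory `s'` agrees with `s` on all arrays that the text of `p` never modifies. -/
structure Frame (p : Prog) (s s' : State) : Prop where
  nat : ∀ a, a ∉ p.writesNat → s'.nat a = s.nat a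
  real : ∀ a, a ∉ p.writesReal → s'.real a = s.real a

theorem Frame.nat_eq {p : Prog} {s s' : State} (h : p.Frame s s') (a : ℕ)
    (ha : p.writesNat.contains a = false := by rfl) : s'.nat a = s.nat a :=
  h.nat a (by simpa using ha)

theorem Frame.real_eq {p : Prog} {s s' : State} (h : p.Frame s s') (a : ℕ)
    (ha : p.writesReal.contains a = false := by rfl) : s'.real a = s.real a :=
  h.real a (by simpa using ha)

end Prog

theorem Run.frame {p : Prog} {s s' : State} {t : ℕ} (h : Run p s s' t) : p.Frame s s' := by
  refine ⟨fun a ha => ?_, fun a ha => ?_⟩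
  · induction h <;> simp_all [Prog.writesNat]
  · induction h <;> simp_all [Prog.writesReal]

theorem Run.of_loopFree {p : Prog} (hp : p.LoopFree) (s : State) :
    ∃ t ≤ p.maxCost, Run p s (p.exec s) t := by
  induction p generalizing s with
  | skip => exact ⟨_, le_rfl, .skip s⟩
  | setNat a i e => exact ⟨_, le_rfl, .setNat s a i e⟩
  | setReal a i e => exact ⟨_, le_rfl, .setReal s a i e⟩
  | seq p q ihp ihq =>
    rw [Prog.LoopFree, Bool.and_eq_true] at hp
    obtain ⟨t, ht, h⟩ := ihp hp.1 s
    obtain ⟨t', ht', h'⟩ := ihq hp.2 (p.exec s)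
    exact ⟨_, Nat.add_le_add ht ht', h.seq h'⟩
  | ite b p q ihp ihq =>
    rw [Prog.LoopFree, Bool.and_eq_true] at hp
    by_cases hb : b.eval s
    · obtain ⟨t, ht, h⟩ := ihp hp.1 s
      refine ⟨_, ?_, by simpa only [Prog.exec, if_pos hb] using Run.iteTrue (q := q) hb h⟩
      simp only [Prog.maxCost]; omega
    · obtain ⟨t, ht, h⟩ := ihq hp.2 s
      refine ⟨_, ?_, by simpa only [Prog.exec, if_neg hb] using Run.iteFalse (p := p) hb h⟩
      simp only [Prog.maxCost]; omega
  | loop b p _ => simp [Prog.LoopFree] at hp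

/-- Started in `s`, the program `p` halts within `t` steps in a state with property `Q`. -/
def Halts (p : Prog) (s : State) (t : ℕ) (Q : State → Prop) : Prop :=
  ∃ s' T, Run p s s' T ∧ T ≤ t ∧ Q s'

section Halts

variable {p q : Prog} {b : BExp} {s : State} {t t' c B : ℕ} {Q Q' : State → Prop}
  {I : ℕ → State → Prop}

theorem Halts.mono (h : Halts p s t Q) (ht : t ≤ t') (hQ : ∀ s', Q s' → Q' s') :
    Halts p s t' Q' := by
  obtain ⟨s', T, hr, hT, hq⟩ := h
  exact ⟨s', T, hr, hT.trans ht, hQ s' hq⟩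

theorem Halts.frame (h : Halts p s t Q) : Halts p s t (fun s' => Q s' ∧ p.Frame s s') := by
  obtain ⟨s', T, hr, hT, hq⟩ := h
  exact ⟨s', T, hr, hT, hq, hr.frame⟩

theorem Halts.seq (h : Halts p s t Q) (h' : ∀ s', p.Frame s s' → Q s' → Halts q s' t' Q') :
    Halts (p.seq q) s (t + t') Q' := by
  obtain ⟨s', T, hr, hT, hq⟩ := h
  obtain ⟨s'', T', hr', hT', hq'⟩ := h' s' hr.frame hq
  exact ⟨s'', T + T', hr.seq hr', Nat.add_le_add hT hT', hq'⟩

theorem Halts.of_loopFree (hp : p.LoopFree) (hc : p.maxCost.ble c) (h : Q (p.exec s)) :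
    Halts p s c Q := by
  obtain ⟨t, ht, hr⟩ := Run.of_loopFree hp s
  exact ⟨_, t, hr, ht.trans (Nat.le_of_ble_eq_true hc), h⟩

theorem Halts.setNat {a : ℕ} {i e : NExp} (hc : i.cost + e.cost + 1 ≤ c)
    (h : Q (s.setNat a (i.eval s) (e.eval s))) : Halts (.setNat a i e) s c Q :=
  ⟨_, _, .setNat s a i e, hc, h⟩

theorem Halts.loop (hbound : ∀ t s, I t s → b.eval s → t < B)
    (hstep : ∀ t s, I t s → b.eval s → Halts p s c (I (t + 1))) (h0 : I 0 s) :
    Halts (.loop b p) s ((B + 1) * (b.cost + 1 + c)) (fun s' => ¬ b.eval s' ∧ ∃ t, I t s') := by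
  suffices H : ∀ d t s, B - t = d → I t s →
      Halts (.loop b p) s ((d + 1) * (b.cost + 1 + c)) (fun s' => ¬ b.eval s' ∧ ∃ t, I t s') from
    H B 0 s rfl h0
  intro d
  induction d with
  | zero =>
    intro t s hd hI
    have hb : ¬ b.eval s := fun hb => by have := hbound t s hI hb; omega
    exact ⟨s, _, .loopFalse hb, by omega, hb, t, hI⟩
  | succ d ih =>
    intro t s hd hI
    by_cases hb : b.eval s
    · obtain ⟨s', T, hr, hT, hI'⟩ := hstep t s hI hb
      obtain ⟨s'', T', hr', hT', hq⟩ := ih (t + 1) s' (by omega) hI'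
      exact ⟨s'', _, .loopTrue hb hr hr', by rw [Nat.add_one_mul (d + 1)]; omega, hq⟩
    · exact ⟨s, _, .loopFalse hb, by rw [Nat.add_one_mul (d + 1)]; omega, hb, t, hI⟩

theorem Halts.forTo {i : ℕ} {N : NExp}
    (hN : ∀ s', (Prog.forTo i N p).Frame s s' → N.eval s' = B) (hi : p.writesNat.contains i = false)
    (h0 : I 0 (s.setNat i 0 0))
    (hstep : ∀ t s', t < B → (Prog.forTo i N p).Frame s s' → s'.nat i 0 = t → I t s' →
      Halts p s' c (fun s'' => I (t + 1) (s''.setNat i 0 (t + 1)))) :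
    Halts (.forTo i N p) s ((B + 1) * (c + N.cost + 14)) (I B) := by
  let J (t : ℕ) (s' : State) : Prop :=
    t ≤ B ∧ (Prog.forTo i N p).Frame s s' ∧ s'.nat i 0 = t ∧ I t s'
  have hloop : Halts (.loop (.not (.natLe N (.var i))) (p.seq (.setVar i (.var i + 1))))
      (s.setNat i 0 0)
      ((B + 1) * (c + N.cost + 11)) (fun s' => I B s') := by
    refine (Halts.loop (I := J) (B := B) (c := c + 6) ?_ ?_ ?_).mono (Nat.mul_le_mul_left _ ?_) ?_
    · rintro t s' ⟨-, hf, ht, -⟩ hb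
      simpa [hN s' hf, ht] using hb
    · rintro t s' ⟨-, hf, ht, hI⟩ hb
      have htB : t < B := by simpa [hN s' hf, ht] using hb
      refine (hstep t s' htB hf ht hI).seq fun s'' hf' hI' => Halts.setNat (c := 6) le_rfl ?_
      have hi' : s''.nat i 0 = t := by rw [hf'.nat_eq i hi, ht]
      refine ⟨htB, ⟨fun a ha => ?_, fun a ha => ?_⟩, by simp [hi'], by simpa [hi'] using hI'⟩
      · have hai : a ≠ i := by rintro rfl; simp [Prog.writesNat] at ha
        simp only [Prog.writesNat, List.mem_append, List.mem_singleton, not_or] at ha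
        simp [hai, hf'.nat a ha.2.1, hf.nat a (by simp [Prog.writesNat, ha])]
      · simp only [Prog.writesReal, List.mem_append, List.not_mem_nil, or_false, false_or] at ha
        simp [hf'.real a ha, hf.real a (by simp [Prog.writesReal, ha])]
    · refine ⟨Nat.zero_le _, ⟨fun a ha => ?_, fun a _ => rfl⟩, by simp, h0⟩
      have hai : a ≠ i := by rintro rfl; simp [Prog.writesNat] at ha
      simp [hai]
    · simp only [BExp.cost, NExp.cost]; omega
    · rintro s' ⟨hb, t, htB, hf, ht, hI⟩
      obtain rfl : t = B := by
        simp only [BExp.eval, hN s' hf, NExp.eval, ht] at hb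
        omega
      exact hI
  refine ((Halts.setNat (Q := fun s' => s' = s.setNat i 0 0) (c := 3) le_rfl rfl).seq
    fun s' _ hs' => hs' ▸ hloop).mono ?_ fun _ h => h
  nlinarith

end Halts

end RealRAM

namespace KCut

open RealRAM Finset

local notation:60 p:61 " ;; " q:60 => Prog.seq p q

/-! ### Mergers of classes -/

section Mergers

/-- The representative of `v` after the first `j` mergers, the `i`-th of which merges the class of
`a i` into the class of `b i`. -/
def rep (a b : ℕ → ℕ) : ℕ → ℕ → ℕ
  | 0, v => v
  | j + 1, v => if rep a b j v = a j then b j else rep a b j v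

/-- The class of the representative `r` after the first `j` mergers. -/
def cls (N : ℕ) (a b : ℕ → ℕ) (j r : ℕ) : Finset ℕ := {v ∈ range N | rep a b j v = r}

/-- The representatives after the first `j` mergers. -/
def reps (N : ℕ) (a b : ℕ → ℕ) (j : ℕ) : Finset ℕ := {v ∈ range N | rep a b j v = v}

/-- Every one of the first `f` mergers joins two different classes of `0, …, N - 1`, given by
their representatives. -/
structure IsMergeSeq (N f : ℕ) (a b : ℕ → ℕ) : Prop where
  ne : ∀ j < f, a j ≠ b j
  rep_a : ∀ j < f, rep a b j (a j) = a j
  rep_b : ∀ j < f, rep a b j (b j) = b j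
  a_lt : ∀ j < f, a j < N
  b_lt : ∀ j < f, b j < N

variable {N f i j l r u v x y : ℕ} {a b a' b' link rank : ℕ → ℕ}

theorem rep_congr (ha : ∀ i < j, a i = a' i) (hb : ∀ i < j, b i = b' i) (v : ℕ) :
    rep a b j v = rep a' b' j v := by
  induction j with
  | zero => rfl
  | succ j ih =>
    simp only [rep]
    rw [ih (fun i hi => ha i (by omega)) (fun i hi => hb i (by omega)), ha j (by omega),
      hb j (by omega)]

@[simp] theorem rep_update_self (x y v : ℕ) :
    rep (Function.update a f x) (Function.update b f y) f v = rep a b f v :=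
  rep_congr (fun _ hi => Function.update_of_ne hi.ne _ _)
    (fun _ hi => Function.update_of_ne hi.ne _ _) v

theorem rep_eq_self (hv : ∀ i < j, a i ≠ v) : rep a b j v = v := by
  induction j with
  | zero => rfl
  | succ j ih => rw [rep, ih fun i hi => hv i (by omega), if_neg (hv j (by omega)).symm]

theorem mem_cls : v ∈ cls N a b j r ↔ v < N ∧ rep a b j v = r := by simp [cls]

theorem mem_reps : v ∈ reps N a b j ↔ v < N ∧ rep a b j v = v := by simp [reps]

theorem card_cls_le : #(cls N a b j r) ≤ N := by
  simpa [cls] using card_filter_le (range N) fun v => rep a b j v = r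

theorem cls_subset_cls_succ :
    cls N a b j (rep a b j v) ⊆ cls N a b (j + 1) (rep a b (j + 1) v) := by
  intro w hw
  rw [mem_cls] at hw ⊢
  simp only [rep, hw.2, hw.1, true_and]

theorem isMergeSeq_congr (ha : ∀ i < f, a i = a' i) (hb : ∀ i < f, b i = b' i)
    (h : IsMergeSeq N f a b) : IsMergeSeq N f a' b' where
  ne j hj := by rw [← ha j hj, ← hb j hj]; exact h.ne j hj
  rep_a j hj := by
    rw [← ha j hj, ← rep_congr (fun i hi => ha i (by omega)) fun i hi => hb i (by omega)]
    exact h.rep_a j hj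
  rep_b j hj := by
    rw [← hb j hj, ← rep_congr (fun i hi => ha i (by omega)) fun i hi => hb i (by omega)]
    exact h.rep_b j hj
  a_lt j hj := by rw [← ha j hj]; exact h.a_lt j hj
  b_lt j hj := by rw [← hb j hj]; exact h.b_lt j hj

namespace IsMergeSeq

theorem snoc (h : IsMergeSeq N f a b) (hxy : x ≠ y) (hx : rep a b f x = x)
    (hy : rep a b f y = y) (hxN : x < N) (hyN : y < N) :
    IsMergeSeq N (f + 1) (Function.update a f x) (Function.update b f y) := by
  have h' : IsMergeSeq N f (Function.update a f x) (Function.update b f y) :=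
    isMergeSeq_congr (fun i hi => (Function.update_of_ne hi.ne _ _).symm)
      (fun i hi => (Function.update_of_ne hi.ne _ _).symm) h
  constructor <;> intro j hj <;> rcases Nat.lt_succ_iff_lt_or_eq.1 hj with hj | rfl
  exacts [h'.ne j hj, by simpa using hxy, h'.rep_a j hj, by simpa using hx, h'.rep_b j hj,
    by simpa using hy, h'.a_lt j hj, by simpa using hxN, h'.b_lt j hj, by simpa using hyN]

variable (h : IsMergeSeq N f a b)
include h

theorem rep_rep_self (hj : j ≤ f) (v : ℕ) : rep a b j (rep a b j v) = rep a b j v := by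
  induction j with
  | zero => rfl
  | succ j ih =>
    have ih := ih (by omega)
    have hb := h.rep_b j (by omega)
    have hab := h.ne j (by omega)
    simp only [rep]
    split_ifs <;> simp_all

theorem rep_rep (hij : i ≤ j) (hj : j ≤ f) (v : ℕ) : rep a b j (rep a b i v) = rep a b j v := by
  induction j, hij using Nat.le_induction with
  | base => exact h.rep_rep_self hj v
  | succ j _ ih => simp only [rep, ih (by omega)]

theorem rep_lt (hj : j ≤ f) (hv : v < N) : rep a b j v < N := by
  induction j with
  | zero => exact hv
  | succ j ih =>
    rw [rep]
    split_ifs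
    · exact h.b_lt j (by omega)
    · exact ih (by omega)

theorem rep_mem_reps (hj : j ≤ f) (hv : v < N) : rep a b j v ∈ reps N a b j :=
  mem_reps.2 ⟨h.rep_lt hj hv, h.rep_rep_self hj v⟩

theorem rep_eq_of_le (hij : i ≤ j) (hj : j ≤ f) (he : rep a b i u = rep a b i v) :
    rep a b j u = rep a b j v := by
  rw [← h.rep_rep hij hj u, he, h.rep_rep hij hj]

theorem rep_eq_self_of_le (hij : i ≤ j) (hj : j ≤ f) (he : rep a b j v = v) :
    rep a b i v = v := by
  induction j, hij using Nat.le_induction with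
  | base => exact he
  | succ j _ ih =>
    apply ih (by omega)
    rw [rep] at he
    split_ifs at he with hv
    · exact he ▸ h.rep_b j (by omega)
    · exact he

theorem rep_ne_a (hij : i < j) (hj : j ≤ f) (v : ℕ) : rep a b j v ≠ a i := by
  intro he
  have hrep : rep a b j (a i) = a i := by rw [← he, h.rep_rep_self hj]
  have hrep' := h.rep_eq_self_of_le (Nat.succ_le_of_lt hij) hj hrep
  rw [rep, if_pos (h.rep_a i (by omega))] at hrep'
  exact h.ne i (by omega) hrep'.symm

theorem rep_succ_a (hj : j < f) : rep a b (j + 1) (a j) = b j := by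
  rw [rep, if_pos (h.rep_a j hj)]

theorem rep_succ_b (hj : j < f) : rep a b (j + 1) (b j) = b j := by
  simp [rep, h.rep_b j hj]

theorem a_mem_reps (hj : j < f) : a j ∈ reps N a b j := mem_reps.2 ⟨h.a_lt j hj, h.rep_a j hj⟩

theorem b_mem_reps (hj : j < f) : b j ∈ reps N a b j := mem_reps.2 ⟨h.b_lt j hj, h.rep_b j hj⟩

theorem reps_succ (hj : j < f) : reps N a b (j + 1) = (reps N a b j).erase (a j) := by
  ext v
  simp only [mem_erase, mem_reps]
  constructor
  · rintro ⟨hv, he⟩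
    exact ⟨fun hva => h.rep_ne_a (Nat.lt_succ_self j) hj v (he.trans hva), hv,
      h.rep_eq_self_of_le (Nat.le_succ j) hj he⟩
  · rintro ⟨hne, hv, he⟩
    exact ⟨hv, by simp [rep, he, hne]⟩

theorem b_mem_reps_succ (hj : j < f) : b j ∈ reps N a b (j + 1) :=
  mem_reps.2 ⟨h.b_lt j hj, h.rep_succ_b hj⟩

theorem card_reps_add (hj : j ≤ f) : #(reps N a b j) + j = N := by
  induction j with
  | zero => simp [reps, rep]
  | succ j ih =>
    have ha := h.a_mem_reps hj
    rw [h.reps_succ hj, ← add_assoc, add_right_comm, card_erase_add_one ha, ih (by omega)]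

theorem lt_of_pos (hN : 0 < N) : f < N := by
  have hcard := h.card_reps_add le_rfl
  have : 0 < #(reps N a b f) := card_pos.2 ⟨_, h.rep_mem_reps le_rfl hN⟩
  omega

theorem le : f ≤ N := by
  have hcard := h.card_reps_add le_rfl
  omega

theorem cls_succ_b (hj : j < f) :
    cls N a b (j + 1) (b j) = cls N a b j (a j) ∪ cls N a b j (b j) := by
  ext v
  have := h.ne j hj
  simp only [mem_union, mem_cls, rep]
  grind

theorem disjoint_cls (hj : j < f) : Disjoint (cls N a b j (a j)) (cls N a b j (b j)) :=
  disjoint_left.2 fun _ hva hvb => h.ne j hj ((mem_cls.1 hva).2.symm.trans (mem_cls.1 hvb).2)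

end IsMergeSeq

/-- The array `link` describes the merge forest: it holds `j + 1` for the vertex `a j` that ceased
to be a representative in the `j`-th merger, and `0` for representatives. -/
def IsLink (f : ℕ) (a link : ℕ → ℕ) : Prop := ∀ v j, link v = j + 1 ↔ j < f ∧ a j = v

theorem IsLink.rep_eq_self (h : IsLink f a link) (hj : j ≤ f) (hv : link v = 0 ∨ j < link v) :
    rep a b j v = v :=
  KCut.rep_eq_self fun i hi ha => by
    have := (h v i).2 ⟨by omega, ha⟩
    omega

theorem IsLink.snoc (h : IsLink f a link) (hx : link x = 0) :
    IsLink (f + 1) (Function.update a f x) (Function.update link x (f + 1)) := by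
  intro v j
  have hv := h v j
  simp only [Function.update_apply]
  grind

/-- Ranks as in union by rank: they increase along the links, and the class of a vertex of rank
`ρ` has at least `2 ^ ρ` elements. -/
structure IsRanked (N f : ℕ) (a b rank : ℕ → ℕ) : Prop where
  lt : ∀ j < f, rank (a j) < rank (b j)
  card : ∀ v < N, 2 ^ rank v ≤ #(cls N a b f (rep a b f v))

theorem IsRanked.rank_le (h : IsRanked N f a b rank) (hl : N ≤ 2 ^ l) (hv : v < N) :
    rank v ≤ l :=
  (Nat.pow_le_pow_iff_right one_lt_two).1 ((h.card v hv).trans (card_cls_le.trans hl))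

theorem two_pow_max_le {ρ σ : ℕ} (h : ρ ≤ σ) : 2 ^ max σ (ρ + 1) ≤ 2 ^ ρ + 2 ^ σ := by
  rcases h.lt_or_eq with h | rfl
  · rw [max_eq_left h]; exact Nat.le_add_left _ _
  · rw [max_eq_right (Nat.le_succ ρ), pow_succ]; omega

theorem IsRanked.snoc (h : IsRanked N f a b rank) (hm : IsMergeSeq N f a b) (hxy : x ≠ y)
    (hx : rep a b f x = x) (hy : rep a b f y = y) (hxN : x < N) (hyN : y < N)
    (hle : rank x ≤ rank y) :
    IsRanked N (f + 1) (Function.update a f x) (Function.update b f y)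
      (Function.update rank y (max (rank y) (rank x + 1))) := by
  have hm' := hm.snoc hxy hx hy hxN hyN
  constructor
  · intro j hj
    rcases Nat.lt_succ_iff_lt_or_eq.1 hj with hj | rfl
    · have hlt := h.lt j hj
      have hay : a j ≠ y := fun he => hm.rep_ne_a hj le_rfl y (hy.trans he.symm)
      simp only [Function.update_apply, hj.ne, if_false, hay]
      split_ifs with hby
      · exact hby ▸ hlt.trans_le (le_max_left _ _)
      · exact hlt
    · simp only [Function.update_self, Function.update_apply, hxy, if_false]
      omega
  · intro v hv
    have hcls (r : ℕ) :
        cls N (Function.update a f x) (Function.update b f y) f r = cls N a b f r := by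
      simp only [cls, rep_update_self]
    by_cases hvy : v = y
    · subst v
      have hrep := hm'.rep_succ_b f.lt_succ_self
      have hunion := hm'.cls_succ_b f.lt_succ_self
      have hdisj := hm'.disjoint_cls f.lt_succ_self
      simp only [Function.update_self, hcls] at hrep hunion hdisj
      rw [hrep, hunion, card_union_of_disjoint hdisj, Function.update_self]
      have hcx := h.card x hxN
      have hcy := h.card y hyN
      rw [hx] at hcx
      rw [hy] at hcy
      exact (two_pow_max_le hle).trans (Nat.add_le_add hcx hcy)
    · have hsub := cls_subset_cls_succ (N := N) (a := Function.update a f x)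
        (b := Function.update b f y) (j := f) (v := v)
      rw [hcls, rep_update_self] at hsub
      rw [Function.update_of_ne hvy]
      exact (h.card v hv).trans (card_le_card hsub)

/-- The first `t` edges, the `i`-th of which joins `U i` and `V i`, are processed by Kruskal's
algorithm: the `j`-th merger is caused by the accepted edge `acc j`, and every edge is spanned by
those accepted up to it. -/
structure IsKruskal (N t : ℕ) (U V : ℕ → ℕ) (f : ℕ) (acc a b : ℕ → ℕ) : Prop where
  merge : IsMergeSeq N f a b
  acc_lt : ∀ j < f, acc j < t
  acc_lt_acc : ∀ i j, i < j → j < f → acc i < acc j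
  ends : ∀ j < f, s(rep a b j (U (acc j)), rep a b j (V (acc j))) = s(a j, b j)
  span : ∀ i < t, ∃ j ≤ f, rep a b j (U i) = rep a b j (V i) ∧ ∀ j' < j, acc j' ≤ i

namespace IsKruskal

variable {t : ℕ} {U V acc : ℕ → ℕ}

theorem zero (U V acc a b : ℕ → ℕ) : IsKruskal N 0 U V 0 acc a b := by
  refine ⟨⟨?_, ?_, ?_, ?_, ?_⟩, ?_, ?_, ?_, ?_⟩ <;> intros <;> omega

theorem reject (h : IsKruskal N t U V f acc a b) (ht : rep a b f (U t) = rep a b f (V t)) :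
    IsKruskal N (t + 1) U V f acc a b where
  merge := h.merge
  acc_lt j hj := (h.acc_lt j hj).trans t.lt_succ_self
  acc_lt_acc := h.acc_lt_acc
  ends := h.ends
  span i hi := by
    rcases Nat.lt_succ_iff_lt_or_eq.1 hi with hi | rfl
    · exact h.span i hi
    · exact ⟨f, le_rfl, ht, fun j' hj' => (h.acc_lt j' hj').le⟩

theorem accept (h : IsKruskal N t U V f acc a b)
    (hm : IsMergeSeq N (f + 1) (Function.update a f x) (Function.update b f y))
    (ht : s(rep a b f (U t), rep a b f (V t)) = s(x, y)) :
    IsKruskal N (t + 1) U V (f + 1) (Function.update acc f t) (Function.update a f x)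
      (Function.update b f y) := by
  have hrep {j : ℕ} (hj : j ≤ f) (v : ℕ) :
      rep (Function.update a f x) (Function.update b f y) j v = rep a b j v :=
    rep_congr (fun i hi => Function.update_of_ne (by omega) _ _)
      (fun i hi => Function.update_of_ne (by omega) _ _) v
  have hacc {j : ℕ} (hj : j < f) : Function.update acc f t j = acc j :=
    Function.update_of_ne hj.ne _ _
  refine ⟨hm, fun j hj => ?_, fun i j hij hj => ?_, fun j hj => ?_, fun i hi => ?_⟩
  · rcases Nat.lt_succ_iff_lt_or_eq.1 hj with hj | rfl
    · exact hacc hj ▸ (h.acc_lt j hj).trans t.lt_succ_self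
    · simp
  · rw [hacc (by omega)]
    rcases Nat.lt_succ_iff_lt_or_eq.1 hj with hj | rfl
    · exact hacc hj ▸ h.acc_lt_acc i j hij hj
    · simpa using h.acc_lt i hij
  · rcases Nat.lt_succ_iff_lt_or_eq.1 hj with hj | rfl
    · simpa only [hrep hj.le, hacc hj, Function.update_of_ne hj.ne] using h.ends j hj
    · simpa using ht
  · rcases Nat.lt_succ_iff_lt_or_eq.1 hi with hi | rfl
    · obtain ⟨j, hj, he, hle⟩ := h.span i hi
      exact ⟨j, by omega, by rwa [hrep hj, hrep hj], fun j' hj' => by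
        rw [hacc (by omega)]; exact hle j' hj'⟩
    · refine ⟨f + 1, le_rfl, ?_, fun j' hj' => ?_⟩
      · have hne := hm.ne f (by omega)
        simp only [rep, rep_update_self, Function.update_self] at hne ⊢
        grind
      · rcases Nat.lt_succ_iff_lt_or_eq.1 hj' with hj' | rfl
        · exact hacc hj' ▸ (h.acc_lt j' hj').le
        · simp

end IsKruskal

end Mergers

/-! ### Sorting -/

section Tournament

variable {M N f i j t l e p x y : ℕ} {W : ℕ → ℝ} {T L σ : ℕ → ℕ}

/-- The key of a player in a tournament: player `i` is represented by `i + 1` and has the key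
`W i`, and `0` stands for the absence of a player. -/
def key (W : ℕ → ℝ) : ℕ → WithTop ℝ
  | 0 => ⊤
  | i + 1 => W i

/-- The one of two players with the smaller key. -/
noncomputable def better (W : ℕ → ℝ) (x y : ℕ) : ℕ := if key W x ≤ key W y then x else y

theorem better_eq_or (W : ℕ → ℝ) (x y : ℕ) : better W x y = x ∨ better W x y = y :=
  ite_eq_or_eq _ _ _

theorem key_better (W : ℕ → ℝ) (x y : ℕ) : key W (better W x y) = min (key W x) (key W y) := by
  rw [better, min_def, apply_ite (key W)]

/-- A tournament tree in the layout of a binary heap: the leaves `M, …, 2 * M - 1` hold the players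
`L 0, …, L (M - 1)`, and every inner node holds the better one of its two children. -/
structure IsTournament (M : ℕ) (W : ℕ → ℝ) (T L : ℕ → ℕ) : Prop where
  leaf : ∀ i < M, T (M + i) = L i
  node : ∀ p, 1 ≤ p → p < M → T p = better W (T (2 * p)) (T (2 * p + 1))

/-- A tournament tree whose proper ancestors of the node `p` are possibly outdated. -/
structure IsTournamentBut (M : ℕ) (W : ℕ → ℝ) (T L : ℕ → ℕ) (p : ℕ) : Prop where
  leaf : ∀ i < M, T (M + i) = L i
  node : ∀ q, 1 ≤ q → q < M →
    T q = better W (T (2 * q)) (T (2 * q + 1)) ∨ ∃ t, 1 ≤ t ∧ p / 2 ^ t = q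

theorem IsTournament.key_root_le (h : IsTournament M W T L) (hp : 1 ≤ p) (hpM : p < 2 * M) :
    key W (T 1) ≤ key W (T p) := by
  induction p using Nat.strong_induction_on with
  | _ p ih =>
    rcases hp.eq_or_lt with rfl | hp1
    · exact le_rfl
    · have hnode := h.node (p / 2) (by omega) (by omega)
      refine (ih (p / 2) (by omega) (by omega) (by omega)).trans ?_
      rw [hnode, key_better]
      rcases Nat.even_or_odd' p with ⟨q, hq | hq⟩
      · exact (min_le_left _ _).trans_eq (by congr; omega)
      · exact (min_le_right _ _).trans_eq (by congr; omega)

theorem IsTournament.exists_eq_leaf (h : IsTournament M W T L) (hp : 1 ≤ p) (hpM : p < 2 * M) :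
    ∃ i < M, T p = L i := by
  induction hd : 2 * M - p using Nat.strong_induction_on generalizing p with
  | _ d ih =>
    rcases le_or_gt M p with hMp | hpM'
    · obtain ⟨i, rfl⟩ := Nat.exists_eq_add_of_le hMp
      exact ⟨i, by omega, h.leaf i (by omega)⟩
    · rw [h.node p hp hpM']
      rcases better_eq_or W (T (2 * p)) (T (2 * p + 1)) with he | he <;> rw [he]
      · exact ih _ (by omega) (by omega) (by omega) rfl
      · exact ih _ (by omega) (by omega) (by omega) rfl

theorem IsTournament.update_leaf (h : IsTournament M W T L) (e x : ℕ) :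
    IsTournamentBut M W (Function.update T (M + e) x) (Function.update L e x) (M + e) := by
  refine ⟨fun i hi => ?_, fun q hq hqM => ?_⟩
  · simp [Function.update_apply, h.leaf i hi]
  · by_cases hparent : (M + e) / 2 = q
    · exact Or.inr ⟨1, le_rfl, by simpa using hparent⟩
    · left
      rw [Function.update_of_ne (by omega), Function.update_of_ne (by omega),
        Function.update_of_ne (by omega), h.node q hq hqM]

theorem IsTournamentBut.update_parent (h : IsTournamentBut M W T L p) (hpM : p < 2 * M) :
    IsTournamentBut M W (Function.update T (p / 2)
      (better W (T (2 * (p / 2))) (T (2 * (p / 2) + 1)))) L (p / 2) := by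
  refine ⟨fun i hi => ?_, fun q hq hqM => ?_⟩
  · rw [Function.update_of_ne (by omega), h.leaf i hi]
  · by_cases hqp : q = p / 2
    · left
      rw [hqp, Function.update_self, Function.update_of_ne (by omega),
        Function.update_of_ne (by omega)]
    · by_cases hqpp : p / 2 / 2 = q
      · exact Or.inr ⟨1, le_rfl, by simpa using hqpp⟩
      · rcases h.node q hq hqM with hnode | ⟨t, ht, hq⟩
        · left
          rw [Function.update_of_ne hqp, Function.update_of_ne (by omega),
            Function.update_of_ne (by omega), hnode]
        · obtain ⟨t, rfl⟩ := Nat.exists_eq_add_of_le' ht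
          rw [pow_succ', ← Nat.div_div_eq_div_mul] at hq
          refine Or.inr ⟨t, Nat.pos_of_ne_zero ?_, hq⟩
          rintro rfl
          exact hqp (by simpa using hq.symm)

theorem IsTournamentBut.isTournament (h : IsTournamentBut M W T L p) (hp : p < 2) :
    IsTournament M W T L := by
  refine ⟨h.leaf, fun q hq hqM => (h.node q hq hqM).resolve_right ?_⟩
  rintro ⟨t, ht, hpq⟩
  have : p / 2 ^ t = 0 := Nat.div_eq_of_lt (hp.trans_le (Nat.le_self_pow (by omega) 2))
  omega

/-- The first `t` entries of an enumeration of `0, …, M - 1` in the order of the keys `W`. -/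
structure IsSorted (M : ℕ) (W : ℕ → ℝ) (t : ℕ) (σ : ℕ → ℕ) : Prop where
  lt : ∀ i < t, σ i < M
  inj : ∀ i < t, ∀ j < t, σ i = σ j → i = j
  mono : ∀ i j, i ≤ j → j < t → W (σ i) ≤ W (σ j)
  le_rest : ∀ i < t, ∀ e < M, (∀ j < t, σ j ≠ e) → W (σ i) ≤ W e

theorem IsSorted.snoc (h : IsSorted M W t σ) (he : e < M) (hnew : ∀ j < t, σ j ≠ e)
    (hmin : ∀ e' < M, (∀ j < t, σ j ≠ e') → W e ≤ W e') :
    IsSorted M W (t + 1) (Function.update σ t e) := by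
  have hσ {j : ℕ} (hj : j < t) : Function.update σ t e j = σ j := Function.update_of_ne hj.ne _ _
  have hsplit {j : ℕ} (hj : j < t + 1) : j < t ∨ j = t := Nat.lt_succ_iff_lt_or_eq.1 hj
  refine ⟨fun i hi => ?_, fun i hi j hj hij => ?_, fun i j hij hj => ?_,
    fun i hi e' he' hrest => ?_⟩
  · rcases hsplit hi with hi | rfl
    · exact hσ hi ▸ h.lt i hi
    · simpa using he
  · rcases hsplit hi with hi | rfl <;> rcases hsplit hj with hj | rfl
    · exact h.inj i hi j hj (by rwa [hσ hi, hσ hj] at hij)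
    · exact absurd (by simpa [hσ hi] using hij) (hnew i hi)
    · exact absurd (by simpa [hσ hj] using hij.symm) (hnew j hj)
    · rfl
  · rcases hsplit hj with hj | rfl
    · rw [hσ hj, hσ (by omega)]
      exact h.mono i j hij hj
    · rcases hij.lt_or_eq with hij | rfl
      · rw [hσ hij, Function.update_self]
        exact h.le_rest i hij e he hnew
      · exact le_rfl
  · have hrest' : ∀ j < t, σ j ≠ e' := fun j hj => hσ hj ▸ hrest j (by omega)
    rcases hsplit hi with hi | rfl
    · exact hσ hi ▸ h.le_rest i hi e' he' hrest'
    · simpa using hmin e' he' hrest'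

/-- The players that remain in the tournament after the extraction of `σ 0, …, σ (t - 1)`. -/
def remaining (σ : ℕ → ℕ) (t i : ℕ) : ℕ := if i ∈ (range t).image σ then 0 else i + 1

theorem remaining_update (σ : ℕ → ℕ) (t e : ℕ) :
    remaining (Function.update σ t e) (t + 1) = Function.update (remaining σ t) e 0 := by
  have himage : (range (t + 1)).image (Function.update σ t e) = insert e ((range t).image σ) := by
    rw [range_add_one, image_insert, Function.update_self]
    congr 1
    exact image_congr fun j hj => Function.update_of_ne (mem_range.1 hj).ne _ _
  ext i
  simp only [remaining, himage, mem_insert, Function.update_apply]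
  split_ifs <;> simp_all

theorem IsTournament.root_remaining (h : IsTournament M W T (remaining σ t)) (htM : t < M) :
    ∃ e < M, (∀ j < t, σ j ≠ e) ∧ T 1 = e + 1 ∧
      ∀ e' < M, (∀ j < t, σ j ≠ e') → W e ≤ W e' := by
  have hrem {e : ℕ} (he : ∀ j < t, σ j ≠ e) : remaining σ t e = e + 1 := by
    simpa [remaining] using he
  have hroot {e : ℕ} (heM : e < M) (he : ∀ j < t, σ j ≠ e) : key W (T 1) ≤ W e := by
    have := h.key_root_le (p := M + e) (by omega) (by omega)
    rwa [h.leaf e heM, hrem he] at this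
  obtain ⟨i, hiM, hi⟩ : ∃ i ∈ range M, i ∉ (range t).image σ :=
    exists_mem_notMem_of_card_lt_card (card_image_le.trans_lt (by simpa using htM))
  have hi : ∀ j < t, σ j ≠ i := by simpa using hi
  obtain ⟨e, heM, he⟩ := h.exists_eq_leaf le_rfl (by omega)
  by_cases hgone : e ∈ (range t).image σ
  · have := hroot (mem_range.1 hiM) hi
    rw [he, remaining, if_pos hgone] at this
    exact absurd this (WithTop.not_top_le_coe _)
  · have hgone : ∀ j < t, σ j ≠ e := by simpa using hgone
    rw [hrem hgone] at he
    refine ⟨e, heM, hgone, he, fun e' he'M he' => ?_⟩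
    simpa [he, key] using hroot he'M he'

end Tournament

/-! ### Sorting on the machine -/

section SortProg

/- Names like these stand for array numbers. Integer and real arrays are numbered separately, so
equal numbers clash only within one kind; an integer variable is entry `0` of its array. -/
abbrev tree : ℕ := 4
abbrev half : ℕ := 5
abbrev order : ℕ := 6
abbrev node : ℕ := 7
abbrev player : ℕ := 8
abbrev count : ℕ := 9
abbrev round : ℕ := 10

variable {M l t : ℕ} {T L : ℕ → ℕ} {s : State} {W : ℕ}

/-- The test whether the player `x` is the better one of `x` and `y` for the keys in the real array
`W`. -/
def keyLe (W : ℕ) (x y : NExp) : BExp :=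
  .not (.and (.not (.natLe y 0)) (.not (.and (.not (.natLe x 0))
    (.realLe (.get W (x - 1)) (.get W (y - 1))))))

@[simp] theorem keyLe_eval (W : ℕ) (x y : NExp) (s : State) :
    (keyLe W x y).eval s ↔ key (s.real W) (x.eval s) ≤ key (s.real W) (y.eval s) := by
  rcases hx : x.eval s with _ | i <;> rcases hy : y.eval s with _ | j <;>
    simp [keyLe, key, hx, hy]

/-- Plays the game at the inner node `node` of the tournament tree. -/
def playGame (W : ℕ) : Prog :=
  .ite (keyLe W (.get tree (.var node + .var node)) (.get tree (.var node + .var node + 1)))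
    (.setNat tree (.var node) (.get tree (.var node + .var node)))
    (.setNat tree (.var node) (.get tree (.var node + .var node + 1)))

/-- Replays the games on the path from the node `node` to the root. -/
def replayPath (W : ℕ) : Prog :=
  .loop (.natLe 2 (.var node)) (.setVar node (.get half (.var node)) ;; playGame W)

/-- Enters `x` at the leaf number `player`. -/
def enterLeaf (W : ℕ) (x : NExp) : Prog :=
  .setVar node (.var count + .var player) ;; .setNat tree (.var node) x ;; replayPath W

/-- Clears the tournament tree and tabulates the halves of its indices. -/
def clearTree : Prog :=
  .forTo round (.var count)
    (.setNat half (.var round + .var round) (.var round) ;;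
      .setNat half (.var round + .var round + 1) (.var round) ;;
      .setNat tree (.var round + .var round) 0 ;; .setNat tree (.var round + .var round + 1) 0)

/-- Enters all players into the tournament. -/
def enterAll (W : ℕ) : Prog :=
  .forTo round (.var count) (.setVar player (.var round) ;; enterLeaf W (.var round + 1))

/-- Extracts the players in the order of their keys. -/
def extractAll (W : ℕ) : Prog :=
  .forTo round (.var count)
    ((.setVar player (.get tree 1 - 1) ;; .setNat order (.var round) (.var player)) ;;
      enterLeaf W 0)

/-- Sorts the first `count` cells of the real array `W`: their indices are written to `order`. -/
def sortBy (W : ℕ) : Prog := clearTree ;; enterAll W ;; extractAll W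

theorem playGame_exec (W : ℕ) (s : State) :
    (playGame W).exec s = s.setNat tree (s.nat node 0)
      (better (s.real W) (s.nat tree (2 * s.nat node 0)) (s.nat tree (2 * s.nat node 0 + 1))) := by
  simp only [playGame, Prog.exec, keyLe_eval, better, NExp.eval, two_mul]
  split_ifs <;> rfl

theorem halts_clearTree (hM : s.nat count 0 = M) :
    Halts clearTree s ((M + 1) * 100) (fun s' =>
      (∀ q < 2 * M, s'.nat half q = q / 2) ∧ ∀ q < 2 * M, s'.nat tree q = 0) := by
  refine (Halts.forTo (B := M) (c := 50) (I := fun t s' =>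
    (∀ q < 2 * t, s'.nat half q = q / 2) ∧ ∀ q < 2 * t, s'.nat tree q = 0)
    (fun s' hf => ?_) (by rfl) (by simp) fun t s' _ _ hround _ => ?_).mono
    (Nat.mul_le_mul_left _ (Nat.le_of_ble_eq_true rfl)) fun _ h => h
  · exact (congrFun (hf.nat_eq count) 0).trans hM
  · refine Halts.of_loopFree rfl rfl ?_
    simp +decide only [Prog.exec, NExp.eval, State.setNat_nat, hround, if_true, if_false,
      Function.update_apply]
    grind

theorem halts_replayPath (hl : 2 * M ≤ 2 ^ l) (hhalf : ∀ q < 2 * M, s.nat half q = q / 2)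
    (hnode : 1 ≤ s.nat node 0) (hnode' : s.nat node 0 < 2 * M)
    (hT : IsTournamentBut M (s.real W) (s.nat tree) L (s.nat node 0)) :
    Halts (replayPath W) s ((l + 1) * 100)
      (fun s' => IsTournament M (s.real W) (s'.nat tree) L) := by
  refine (Halts.loop (B := l) (c := 90) (I := fun t s' => (s'.nat half = s.nat half ∧
    s'.real = s.real) ∧ 1 ≤ s'.nat node 0 ∧ s'.nat node 0 * 2 ^ t < 2 * M ∧
    IsTournamentBut M (s.real W) (s'.nat tree) L (s'.nat node 0)) ?_ ?_ ?_).mono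
    (Nat.mul_le_mul_left _ (Nat.le_of_ble_eq_true rfl)) ?_
  · rintro t s' ⟨-, hge, hlt, -⟩ -
    exact (Nat.pow_lt_pow_iff_right one_lt_two).1 (by nlinarith [Nat.one_le_two_pow (n := t)])
  · rintro t s' ⟨⟨hh, hr⟩, -, hlt, hT⟩ (hb : 2 ≤ s'.nat node 0)
    have hpow := Nat.one_le_two_pow (n := t)
    have hp : s'.nat node 0 < 2 * M := by nlinarith
    refine Halts.of_loopFree rfl rfl ?_
    simp +decide only [Prog.exec, playGame_exec, NExp.eval, State.setNat_nat, State.setNat_real,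
      Function.update_self, if_true, if_false, hh, hr, hhalf _ hp, true_and]
    refine ⟨by omega, ?_, hT.update_parent hp⟩
    rw [pow_succ', ← mul_assoc]
    exact (Nat.mul_le_mul_right _ (Nat.div_mul_le_self _ 2)).trans_lt hlt
  · exact ⟨⟨rfl, rfl⟩, hnode, by simpa using hnode', hT⟩
  · rintro s' ⟨hb, t, -, -, -, hT⟩
    exact hT.isTournament (not_le.1 hb)

/-- The tournament tree is that of the players `L`, and the halves of its indices are tabulated. -/
structure HasTournament (M W : ℕ) (L : ℕ → ℕ) (s : State) : Prop where
  half_eq : ∀ q < 2 * M, s.nat half q = q / 2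
  isTournament : IsTournament M (s.real W) (s.nat tree) L

theorem halts_enterLeaf {x : NExp} {v : ℕ} (hl : 2 * M ≤ 2 ^ l) (hM : s.nat count 0 = M)
    (hx : ∀ i, x.eval (s.setNat node 0 i) = v) (hplayer : s.nat player 0 < M)
    (h : HasTournament M W L s) :
    Halts (enterLeaf W x) s ((l + 1) * 100 + x.cost + 20)
      (HasTournament M W (Function.update L (s.nat player 0) v)) := by
  have hset : Halts (.setVar node (.var count + .var player)) s 10
      (fun s' => s' = s.setNat node 0 (M + s.nat player 0)) :=
    Halts.setNat (Nat.le_of_ble_eq_true rfl) (by rw [← hM]; rfl)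
  refine (hset.seq (t' := (l + 1) * 100 + x.cost + 10) fun s₁ _ hs₁ => ?_).mono (by omega)
    fun _ h => h
  have hsetx : Halts (.setNat tree (.var node) x) s₁ (x.cost + 10)
      (fun s' => s' = s₁.setNat tree (M + s.nat player 0) v) :=
    Halts.setNat (by simp only [NExp.cost]; omega) (by subst hs₁; simp [hx])
  refine (hsetx.seq fun s₂ _ hs₂ => (halts_replayPath (W := W) hl
    (L := Function.update L (s.nat player 0) v) ?_ ?_ ?_ ?_).frame.mono le_rfl ?_).mono (by omega)
    fun _ h => h
  all_goals subst hs₂ hs₁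
  · exact h.half_eq
  · simp +decide; omega
  · simp +decide; omega
  · simpa +decide using h.isTournament.update_leaf (s.nat player 0) v
  · rintro s' ⟨hT, hf⟩
    refine ⟨fun q hq => ?_, ?_⟩
    · exact (congrFun (hf.nat_eq half) q).trans (h.half_eq q hq)
    · rwa [hf.real_eq W]

theorem HasTournament.congr {s' : State} (h : HasTournament M W L s)
    (hhalf : s'.nat half = s.nat half) (htree : s'.nat tree = s.nat tree)
    (hW : s'.real W = s.real W) : HasTournament M W L s' :=
  ⟨hhalf ▸ h.half_eq, htree ▸ hW ▸ h.isTournament⟩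

theorem halts_enterAll (hl : 2 * M ≤ 2 ^ l) (hM : s.nat count 0 = M)
    (h : HasTournament M W (fun _ => 0) s) :
    Halts (enterAll W) s ((M + 1) * ((l + 1) * 200)) (HasTournament M W (remaining id 0)) := by
  refine (Halts.forTo (B := M) (c := (l + 1) * 100 + 50)
    (I := fun t => HasTournament M W fun i => if i < t then i + 1 else 0)
    (fun s' hf => ?_) (by rfl) ?_ fun t s' ht hf hround h => ?_).mono
    (Nat.mul_le_mul_left _ ?_) fun s' h => ?_
  · exact (congrFun (hf.nat_eq count) 0).trans hM
  · simp only [not_lt_zero, if_false]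
    exact h.congr rfl rfl rfl
  · have hset : Halts (.setVar player (.var round)) s' 10 (fun s'' => s'' = s'.setNat player 0 t) :=
      Halts.setNat (Nat.le_of_ble_eq_true rfl) (by rw [← hround]; rfl)
    refine (hset.seq (t' := (l + 1) * 100 + 30) fun s₁ hf₁ hs₁ => ?_).mono (by omega) fun _ h => h
    have hcount : s₁.nat count 0 = M := by rw [hf₁.nat_eq count, hf.nat_eq count, hM]
    have hplayer : s₁.nat player 0 = t := by rw [hs₁]; rfl
    refine (halts_enterLeaf (v := t + 1) hl hcount (fun i => ?_) (hplayer ▸ ht)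
      (h.congr (hf₁.nat_eq _) (hf₁.nat_eq _) (hf₁.real_eq _))).mono ?_ fun s'' h => ?_
    · simp +decide [hs₁, hround]
    · simp only [NExp.cost]; omega
    · have hL : Function.update (fun i => if i < t then i + 1 else 0) (s₁.nat player 0) (t + 1) =
          fun i => if i < t + 1 then i + 1 else 0 := by
        ext i; grind
      exact (hL ▸ h).congr rfl rfl rfl
  · simp only [NExp.cost]; omega
  · refine ⟨h.half_eq, fun i hi => ?_, h.isTournament.node⟩
    simpa [remaining, hi] using h.isTournament.leaf i hi

theorem halts_extractAll (hl : 2 * M ≤ 2 ^ l) (hM : s.nat count 0 = M)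
    (h : HasTournament M W (remaining id 0) s) :
    Halts (extractAll W) s ((M + 1) * ((l + 1) * 200))
      (fun s' => IsSorted M (s.real W) M (s'.nat order)) := by
  refine (Halts.forTo (B := M) (c := (l + 1) * 100 + 50)
    (I := fun t s' => IsSorted M (s.real W) t (s'.nat order) ∧
      HasTournament M W (remaining (s'.nat order) t) s')
    (fun s' hf => ?_) (by rfl) ?_ fun t s' ht hf hround ⟨hσ, h⟩ => ?_).mono
    (Nat.mul_le_mul_left _ ?_) fun s' h => h.1
  · exact (congrFun (hf.nat_eq count) 0).trans hM
  · refine ⟨⟨?_, ?_, ?_, ?_⟩, h.congr rfl rfl rfl⟩ <;> simp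
  · have hW : s'.real W = s.real W := hf.real_eq W
    obtain ⟨e, heM, hnew, hroot, hmin⟩ := h.isTournament.root_remaining ht
    have hset : Halts (.setVar player (.get tree 1 - 1) ;; .setNat order (.var round) (.var player))
        s' 20 (fun s'' => s'' = (s'.setNat player 0 e).setNat order t e) := by
      refine Halts.of_loopFree rfl rfl ?_
      simp +decide [hroot, hround]
    refine (hset.seq (t' := (l + 1) * 100 + 30) fun s₁ hf₁ hs₁ => ?_).mono (by omega) fun _ h => h
    have hcount : s₁.nat count 0 = M := by rw [hf₁.nat_eq count, hf.nat_eq count, hM]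
    have hplayer : s₁.nat player 0 = e := by simp +decide [hs₁]
    have horder : s₁.nat order = Function.update (s'.nat order) t e := by simp +decide [hs₁]
    refine (halts_enterLeaf (v := 0) hl hcount (fun i => rfl) (hplayer ▸ heM)
      (h.congr (hf₁.nat_eq _) (hf₁.nat_eq _) (hf₁.real_eq _))).frame.mono ?_ fun s'' ⟨h, hf₂⟩ => ?_
    · simp only [NExp.cost]; omega
    · have horder' : (s''.setNat round 0 (t + 1)).nat order = Function.update (s'.nat order) t e :=
        (hf₂.nat_eq order).trans horder
      rw [hplayer, ← remaining_update] at h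
      rw [horder', ← hW]
      exact ⟨(hW ▸ hσ).snoc heM hnew hmin, h.congr rfl rfl rfl⟩
  · simp only [NExp.cost]; omega

theorem halts_sortBy (hl : 2 * M ≤ 2 ^ l) (hM : s.nat count 0 = M) :
    Halts (sortBy W) s ((M + 1) * ((l + 1) * 500))
      (fun s' => IsSorted M (s.real W) M (s'.nat order)) := by
  refine ((halts_clearTree hM).seq fun s₁ hf₁ ⟨hhalf, htree⟩ => ?_).mono
    (t := (M + 1) * 100 + ((M + 1) * ((l + 1) * 200) + (M + 1) * ((l + 1) * 200))) (by nlinarith)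
    fun _ h => h
  have hcount : s₁.nat count 0 = M := by rw [hf₁.nat_eq count, hM]
  have h : HasTournament M W (fun _ => 0) s₁ := by
    refine ⟨hhalf, fun i hi => htree _ (by omega), fun p hp hpM => ?_⟩
    rw [htree p (by omega), htree _ (by omega), htree _ (by omega), better, ite_self]
  refine (halts_enterAll hl hcount h).seq fun s₂ hf₂ h => ?_
  rw [← hf₁.real_eq W, ← hf₂.real_eq W]
  exact halts_extractAll hl (by rw [hf₂.nat_eq count, hcount]) h

end SortProg

/-! ### Kruskal's algorithm on the machine -/

section KruskalProg

abbrev endU : ℕ := 1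
abbrev endV : ℕ := 2
abbrev mergers : ℕ := 11
abbrev loser : ℕ := 12
abbrev winner : ℕ := 13
abbrev linkTo : ℕ := 14
abbrev rankOf : ℕ := 15
abbrev left : ℕ := 16
abbrev right : ℕ := 17

variable {N M f l t x y v : ℕ} {acc : ℕ → ℕ} {s s' : State}

/-- Moves the vertex in the variable `x` to the representative of its class. -/
def climb (x : ℕ) : Prog :=
  .loop (.natLe 1 (.get linkTo (.var x))) (.setVar x (.get winner (.get linkTo (.var x) - 1)))

/-- Merges the class of the representative in the variable `x` into that of the representative in
the variable `y`. -/
def merge (x y : ℕ) : Prog :=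
  .setNat loser (.var mergers) (.var x) ;; .setNat winner (.var mergers) (.var y) ;;
    .setNat linkTo (.var x) (.var mergers + 1) ;;
    -- truncated subtraction turns this sum into a maximum
    .setNat rankOf (.var y)
      (.get rankOf (.var y) + (.get rankOf (.var x) + 1 - .get rankOf (.var y))) ;;
    .setVar mergers (.var mergers + 1)

/-- Moves the ends of the edge of the current round to their representatives. -/
def findEnds : Prog :=
  (.setVar left (.get endU (.get order (.var round))) ;;
    .setVar right (.get endV (.get order (.var round)))) ;; climb left ;; climb right

/-- Merges the classes of `left` and `right`, if they are different, in the order of their ranks. -/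
def mergeEnds : Prog :=
  .ite (.and (.natLe (.var left) (.var right)) (.natLe (.var right) (.var left))) .skip
    (.ite (.natLe (.get rankOf (.var left)) (.get rankOf (.var right))) (merge left right)
      (merge right left))

/-- Kruskal's algorithm for the edges in the order `order`, with union by rank. -/
def kruskal : Prog := .forTo round (.var count) (findEnds ;; mergeEnds)

/-- The recorded mergers form the forest of the classes, which are united by rank. -/
structure HasForest (N : ℕ) (s : State) : Prop where
  merge : IsMergeSeq N (s.nat mergers 0) (s.nat loser) (s.nat winner)
  link : IsLink (s.nat mergers 0) (s.nat loser) (s.nat linkTo)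
  rank : IsRanked N (s.nat mergers 0) (s.nat loser) (s.nat winner) (s.nat rankOf)

theorem HasForest.congr (h : HasForest N s) (hf : s'.nat mergers = s.nat mergers)
    (ha : s'.nat loser = s.nat loser) (hb : s'.nat winner = s.nat winner)
    (hlink : s'.nat linkTo = s.nat linkTo) (hrank : s'.nat rankOf = s.nat rankOf) :
    HasForest N s' := by
  constructor
  · rw [hf, ha, hb]; exact h.merge
  · rw [hf, ha, hlink]; exact h.link
  · rw [hf, ha, hb, hrank]; exact h.rank

theorem HasForest.halts_climb (h : HasForest N s) (hl : N ≤ 2 ^ l) (hx : x ≠ linkTo)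
    (hx' : x ≠ winner) (hv : s.nat x 0 < N) :
    Halts (climb x) s ((l + 1) * 20) (fun s' =>
      s'.nat x 0 = rep (s.nat loser) (s.nat winner) (s.nat mergers 0) (s.nat x 0)) := by
  let root := rep (s.nat loser) (s.nat winner) (s.nat mergers 0)
  refine (Halts.loop (B := l) (c := 13) (I := fun t s' => s'.nat linkTo = s.nat linkTo ∧
    s'.nat winner = s.nat winner ∧ s'.nat x 0 < N ∧ t ≤ s.nat rankOf (s'.nat x 0) ∧
    root (s'.nat x 0) = root (s.nat x 0)) ?_ ?_ ⟨rfl, rfl, hv, Nat.zero_le _, rfl⟩).mono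
    (Nat.mul_le_mul_left _ (Nat.le_of_ble_eq_true rfl)) ?_
  · rintro t s' ⟨hlink, -, hlt, ht, -⟩ (hb : 1 ≤ s'.nat linkTo (s'.nat x 0))
    obtain ⟨j, hj⟩ := Nat.exists_eq_add_of_le' hb
    rw [hlink, h.link] at hj
    obtain ⟨hjf, ha⟩ := hj
    have := h.rank.lt j hjf
    have := h.rank.rank_le hl (h.merge.b_lt j hjf)
    rw [ha] at *
    omega
  · rintro t s' ⟨hlink, hwin, -, ht, hroot⟩ (hb : 1 ≤ s'.nat linkTo (s'.nat x 0))
    obtain ⟨j, hj⟩ := Nat.exists_eq_add_of_le' hb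
    obtain ⟨hjf, ha⟩ := (h.link _ _).1 (hlink ▸ hj)
    refine Halts.of_loopFree rfl rfl ?_
    have hval : (NExp.get winner (NExp.get linkTo (.var x) - 1)).eval s' = s.nat winner j := by
      simp [hj, hwin]
    simp only [Prog.exec, hval, NExp.eval_ofNat, State.setNat_nat, hx.symm, hx'.symm, if_false,
      if_true, Function.update_self]
    refine ⟨hlink, hwin, h.merge.b_lt j hjf, ?_, hroot ▸ ?_⟩
    · exact Nat.succ_le_of_lt ((ha ▸ ht).trans_lt (h.rank.lt j hjf))
    · exact h.merge.rep_eq_of_le hjf le_rfl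
        ((h.merge.rep_succ_b hjf).trans (ha ▸ h.merge.rep_succ_a hjf).symm)
  · rintro s' ⟨hb, t, hlink, -, -, -, hroot⟩
    have hzero : s.nat linkTo (s'.nat x 0) = 0 := by
      simpa [hlink] using hb
    exact (h.link.rep_eq_self le_rfl (Or.inl hzero)).symm.trans hroot

theorem HasForest.halts_findEnds (h : HasForest N s) (hl : N ≤ 2 ^ l)
    (hU : s.nat endU (s.nat order (s.nat round 0)) < N)
    (hV : s.nat endV (s.nat order (s.nat round 0)) < N) :
    Halts findEnds s ((l + 1) * 60) (fun s' =>
      s'.nat left 0 = rep (s.nat loser) (s.nat winner) (s.nat mergers 0)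
        (s.nat endU (s.nat order (s.nat round 0))) ∧
      s'.nat right 0 = rep (s.nat loser) (s.nat winner) (s.nat mergers 0)
        (s.nat endV (s.nat order (s.nat round 0)))) := by
  have hset : Halts (.setVar left (.get endU (.get order (.var round))) ;;
      .setVar right (.get endV (.get order (.var round)))) s 20 (fun s' =>
      s'.nat left 0 = s.nat endU (s.nat order (s.nat round 0)) ∧
      s'.nat right 0 = s.nat endV (s.nat order (s.nat round 0))) :=
    Halts.of_loopFree rfl rfl (by simp +decide)
  refine (hset.seq (t' := (l + 1) * 20 + (l + 1) * 20) fun s₁ hf₁ ⟨hleft, hright⟩ => ?_).mono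
    (by omega) fun _ h => h
  have h₁ : HasForest N s₁ :=
    h.congr (hf₁.nat_eq _) (hf₁.nat_eq _) (hf₁.nat_eq _) (hf₁.nat_eq _) (hf₁.nat_eq _)
  refine (h₁.halts_climb (x := left) hl (by decide) (by decide) (hleft ▸ hU)).seq
    fun s₂ hf₂ hleft₂ => ?_
  have h₂ : HasForest N s₂ :=
    h₁.congr (hf₂.nat_eq _) (hf₂.nat_eq _) (hf₂.nat_eq _) (hf₂.nat_eq _) (hf₂.nat_eq _)
  have hright₂ : s₂.nat right 0 = _ := (congrFun (hf₂.nat_eq right) 0).trans hright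
  refine (h₂.halts_climb (x := right) hl (by decide) (by decide) (hright₂ ▸ hV)).frame.mono le_rfl
    fun s₃ ⟨hright₃, hf₃⟩ => ?_
  simp only [hf₃.nat_eq left, hleft₂, hright₃, hf₂.nat_eq right, hleft, hright, hf₂.nat_eq loser,
    hf₁.nat_eq loser, hf₂.nat_eq winner, hf₁.nat_eq winner, hf₂.nat_eq mergers, hf₁.nat_eq mergers,
    and_self]

/-- The first `t` edges in the order `order` are processed by Kruskal's algorithm; `acc j` is the
position of the edge that caused the `j`-th merger. -/
structure HasKruskal (N t : ℕ) (acc : ℕ → ℕ) (s : State) : Prop extends HasForest N s where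
  kruskal : IsKruskal N t (fun i => s.nat endU (s.nat order i))
    (fun i => s.nat endV (s.nat order i)) (s.nat mergers 0) acc (s.nat loser) (s.nat winner)

theorem HasKruskal.zero (hf : s.nat mergers 0 = 0) (hlink : ∀ v, s.nat linkTo v = 0)
    (hrank : ∀ v, s.nat rankOf v = 0) : HasKruskal N 0 acc s := by
  refine ⟨⟨?_, ?_, ?_⟩, ?_⟩ <;> rw [hf]
  · exact (IsKruskal.zero (fun _ => 0) (fun _ => 0) acc _ _).merge
  · intro v j
    simp [hlink]
  · refine ⟨by simp, fun v hv => ?_⟩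
    rw [hrank, pow_zero, Nat.one_le_iff_ne_zero, ← pos_iff_ne_zero, card_pos]
    exact ⟨v, mem_cls.2 ⟨hv, rfl⟩⟩
  · exact IsKruskal.zero _ _ _ _ _

theorem HasKruskal.congr (h : HasKruskal N t acc s) (hs : ∀ a ∈ [endU, endV, order, mergers, loser,
    winner, linkTo, rankOf], s'.nat a = s.nat a) : HasKruskal N t acc s' := by
  simp only [List.forall_mem_cons] at hs
  obtain ⟨hU, hV, hσ, hf, ha, hb, hlink, hrank, -⟩ := hs
  refine ⟨h.toHasForest.congr hf ha hb hlink hrank, ?_⟩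
  rw [hU, hV, hσ, hf, ha, hb]
  exact h.kruskal

theorem HasForest.link_eq_zero (h : HasForest N s)
    (hv : rep (s.nat loser) (s.nat winner) (s.nat mergers 0) v = v) : s.nat linkTo v = 0 := by
  by_contra hne
  obtain ⟨j, hj⟩ := Nat.exists_eq_succ_of_ne_zero hne
  obtain ⟨hjf, ha⟩ := (h.link _ _).1 hj
  exact h.merge.rep_ne_a hjf le_rfl v (hv.trans ha.symm)

theorem HasKruskal.exec_merge (h : HasKruskal N t acc s)
    (hx : ∀ a ∈ [loser, winner, linkTo], x ≠ a)
    (hy : ∀ a ∈ [loser, winner, linkTo], y ≠ a)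
    (hxy : s.nat x 0 ≠ s.nat y 0) (hxN : s.nat x 0 < N) (hyN : s.nat y 0 < N)
    (hxr : rep (s.nat loser) (s.nat winner) (s.nat mergers 0) (s.nat x 0) = s.nat x 0)
    (hyr : rep (s.nat loser) (s.nat winner) (s.nat mergers 0) (s.nat y 0) = s.nat y 0)
    (hends : s(rep (s.nat loser) (s.nat winner) (s.nat mergers 0) (s.nat endU (s.nat order t)),
      rep (s.nat loser) (s.nat winner) (s.nat mergers 0) (s.nat endV (s.nat order t))) =
        s(s.nat x 0, s.nat y 0))
    (hrank : s.nat rankOf (s.nat x 0) ≤ s.nat rankOf (s.nat y 0)) :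
    HasKruskal N (t + 1) (Function.update acc (s.nat mergers 0) t) ((merge x y).exec s) := by
  simp only [List.forall_mem_cons] at hx hy
  obtain ⟨hxa, hxb, hxl, -⟩ := hx
  obtain ⟨hya, hyb, hyl, -⟩ := hy
  have hmax : s.nat rankOf (s.nat y 0) +
      (s.nat rankOf (s.nat x 0) + 1 - s.nat rankOf (s.nat y 0)) =
        max (s.nat rankOf (s.nat y 0)) (s.nat rankOf (s.nat x 0) + 1) := by omega
  have hm := h.merge.snoc hxy hxr hyr hxN hyN
  have hnat : ∀ a, ((merge x y).exec s).nat a =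
      if a = mergers then Function.update (s.nat mergers) 0 (s.nat mergers 0 + 1)
      else if a = rankOf then Function.update (s.nat rankOf) (s.nat y 0)
        (max (s.nat rankOf (s.nat y 0)) (s.nat rankOf (s.nat x 0) + 1))
      else if a = linkTo then
        Function.update (s.nat linkTo) (s.nat x 0) (s.nat mergers 0 + 1)
      else if a = winner then Function.update (s.nat winner) (s.nat mergers 0) (s.nat y 0)
      else if a = loser then Function.update (s.nat loser) (s.nat mergers 0) (s.nat x 0)
      else s.nat a := by
    intro a
    simp +decide [merge, hxa, hxb, hxl, hya, hyb, hyl, hmax]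
  refine ⟨⟨?_, ?_, ?_⟩, ?_⟩ <;> simp +decide only [hnat, if_true, if_false, Function.update_self]
  · exact hm
  · exact h.link.snoc (h.link_eq_zero hxr)
  · exact h.rank.snoc h.merge hxy hxr hyr hxN hyN hrank
  · exact h.kruskal.accept hm hends

theorem HasKruskal.halts_mergeEnds (h : HasKruskal N t acc s)
    (hU : s.nat endU (s.nat order t) < N) (hV : s.nat endV (s.nat order t) < N)
    (hleft : s.nat left 0 =
      rep (s.nat loser) (s.nat winner) (s.nat mergers 0) (s.nat endU (s.nat order t)))
    (hright : s.nat right 0 =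
      rep (s.nat loser) (s.nat winner) (s.nat mergers 0) (s.nat endV (s.nat order t))) :
    Halts mergeEnds s 150 (fun s' => ∃ acc, HasKruskal N (t + 1) acc s') := by
  have hlN := hleft ▸ h.merge.rep_lt le_rfl hU
  have hrN := hright ▸ h.merge.rep_lt le_rfl hV
  have hlr := hleft ▸ h.merge.rep_rep_self le_rfl (s.nat endU (s.nat order t))
  have hrr := hright ▸ h.merge.rep_rep_self le_rfl (s.nat endV (s.nat order t))
  refine Halts.of_loopFree rfl rfl ?_
  simp only [mergeEnds, Prog.exec]
  split_ifs with heq hle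
  · exact ⟨acc, h.toHasForest, h.kruskal.reject (hleft ▸ hright ▸ le_antisymm heq.1 heq.2)⟩
  · refine ⟨_, h.exec_merge (by decide) (by decide) ?_ hlN hrN hlr hrr ?_ hle⟩
    · exact fun he => heq ⟨he.le, he.ge⟩
    · rw [hleft, hright]
  · refine ⟨_, h.exec_merge (by decide) (by decide) ?_ hrN hlN hrr hlr ?_ (le_of_not_ge hle)⟩
    · exact fun he => heq ⟨he.ge, he.le⟩
    · rw [hleft, hright, Sym2.eq_swap]

theorem halts_kruskal (hl : 0 < M → N ≤ 2 ^ l) (hM : s.nat count 0 = M)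
    (hU : ∀ t < M, s.nat endU (s.nat order t) < N) (hV : ∀ t < M, s.nat endV (s.nat order t) < N)
    (h : HasKruskal N 0 acc s) :
    Halts kruskal s ((M + 1) * ((l + 1) * 300)) (fun s' => ∃ acc, HasKruskal N M acc s') := by
  refine (Halts.forTo (B := M) (c := (l + 1) * 60 + 150)
    (I := fun t s' => ∃ acc, HasKruskal N t acc s') (fun s' hf => ?_) (by rfl)
    ⟨acc, h.congr (by simp +decide)⟩ fun t s' ht hf hround ⟨acc, h⟩ => ?_).mono
      (Nat.mul_le_mul_left _ ?_) fun _ h => h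
  · exact (congrFun (hf.nat_eq count) 0).trans hM
  · have hU' : s'.nat endU (s'.nat order t) < N := by
      rw [hf.nat_eq endU, hf.nat_eq order]; exact hU t ht
    have hV' : s'.nat endV (s'.nat order t) < N := by
      rw [hf.nat_eq endV, hf.nat_eq order]; exact hV t ht
    refine (h.halts_findEnds (hl (Nat.zero_lt_of_lt ht)) (hround ▸ hU') (hround ▸ hV')).seq
      fun s₁ hf₁ hends => ?_
    have h₁ : HasKruskal N t acc s₁ :=
      h.congr fun a ha => hf₁.nat a (by revert ha a; decide)
    rw [hround, ← hf₁.nat_eq loser, ← hf₁.nat_eq winner, ← hf₁.nat_eq mergers,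
      ← hf₁.nat_eq endU, ← hf₁.nat_eq endV, ← hf₁.nat_eq order] at hends
    rw [← hf₁.nat_eq endU, ← hf₁.nat_eq order] at hU'
    rw [← hf₁.nat_eq endV, ← hf₁.nat_eq order] at hV'
    exact (h₁.halts_mergeEnds hU' hV' hends.1 hends.2).mono le_rfl fun s₂ ⟨acc, h₂⟩ =>
      ⟨acc, h₂.congr (by simp +decide)⟩
  · simp only [NExp.cost]; omega

end KruskalProg

/-! ### Weights of cuts and of mergers -/

section CutWeight

variable {m N f i j r : ℕ} {u v a b : ℕ → ℕ} {c : ℕ → ℝ}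

/-- The weight of the edges with exactly one end in the class of `r` after `j` mergers, where the
`i`-th of `m` edges joins `u i` and `v i` and has the weight `c i`. -/
def cutWeight (m : ℕ) (u v : ℕ → ℕ) (c : ℕ → ℝ) (a b : ℕ → ℕ) (j r : ℕ) : ℝ :=
  ∑ i ∈ range m, if (rep a b j (u i) = r ↔ rep a b j (v i) = r) then 0 else c i

/-- The `j`-th merger joins the classes of `x` and `y`. -/
def Joins (a b : ℕ → ℕ) (j x y : ℕ) : Prop :=
  rep a b j x ≠ rep a b j y ∧ rep a b (j + 1) x = rep a b (j + 1) y

instance (x y : ℕ) : Decidable (Joins a b j x y) := instDecidableAnd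

/-- The weight of the edges whose ends are joined by the `j`-th merger. -/
def joinWeight (m : ℕ) (u v : ℕ → ℕ) (c : ℕ → ℝ) (a b : ℕ → ℕ) (j : ℕ) : ℝ :=
  ∑ i ∈ range m, if Joins a b j (u i) (v i) then c i else 0

theorem IsMergeSeq.cutWeight_succ_b (h : IsMergeSeq N f a b) (hj : j < f) :
    cutWeight m u v c a b (j + 1) (b j) = cutWeight m u v c a b j (a j) +
      cutWeight m u v c a b j (b j) - (joinWeight m u v c a b j + joinWeight m u v c a b j) := by
  have hne := h.ne j hj
  simp only [cutWeight, joinWeight, Joins, ← sum_add_distrib, ← sum_sub_distrib]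
  refine sum_congr rfl fun i _ => ?_
  simp only [rep]
  grind

theorem cutWeight_succ_of_ne (hra : r ≠ a j) (hrb : r ≠ b j) :
    cutWeight m u v c a b (j + 1) r = cutWeight m u v c a b j r := by
  have hrep (w : ℕ) : rep a b (j + 1) w = r ↔ rep a b j w = r := by
    simp only [rep]
    grind
  simp only [cutWeight, hrep]

theorem IsMergeSeq.joins_unique (h : IsMergeSeq N f a b) (hi : i < f) (hj : j < f) {x y : ℕ}
    (hix : Joins a b i x y) (hjx : Joins a b j x y) : i = j := by
  rcases lt_trichotomy i j with hij | hij | hij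
  · exact absurd (h.rep_eq_of_le hij hj.le hix.2) hjx.1
  · exact hij
  · exact absurd (h.rep_eq_of_le hij hi.le hjx.2) hix.1

end CutWeight

section WeightProg

abbrev meeting : ℕ := 18
abbrev cap : ℕ := 0
abbrev weight : ℕ := 2
abbrev join : ℕ := 3

variable {N M l t x y u v : ℕ} {acc : ℕ → ℕ} {s s' : State}

/-- Moves the representative in the variable `x` along its next merger. -/
def climbOnce (x : ℕ) : Prog :=
  .setVar meeting (.get linkTo (.var x) - 1) ;; .setVar x (.get winner (.var meeting))

/-- Finds the merger that joins the classes of `left` and `right`, by always moving the one that is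
the first to lose its role as a representative. -/
def meetEnds : Prog :=
  .loop (.not (.and (.natLe (.var left) (.var right)) (.natLe (.var right) (.var left))))
    (.ite (.and (.natLe 1 (.get linkTo (.var left)))
        (.not (.and (.natLe 1 (.get linkTo (.var right)))
          (.natLe (.get linkTo (.var right)) (.get linkTo (.var left))))))
      (climbOnce left) (climbOnce right))

/-- Adds the capacity of the edge of the current round to the weights to which it contributes. -/
def addWeight : Prog :=
  .setReal join (.var meeting) (.get join (.var meeting) + .get cap (.var round)) ;;
    .setReal weight (.get endU (.var round))
      (.get weight (.get endU (.var round)) + .get cap (.var round)) ;;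
    .setReal weight (.get endV (.var round))
      (.get weight (.get endV (.var round)) + .get cap (.var round))

/-- Adds up the capacities of the edges at every vertex, and of those joined by every merger. -/
def addWeights : Prog :=
  .forTo round (.var count)
    ((.setVar left (.get endU (.var round)) ;; .setVar right (.get endV (.var round))) ;;
      meetEnds ;; addWeight)

/-- On their way to the merger that joins `u` and `v`, the variables `x` and `y` hold the
representatives of `u` and `v` at some time, and the last merger on the way is `meeting`. -/
def IsMeeting (u v x y : ℕ) (s : State) : Prop :=
  ∃ T ≤ s.nat mergers 0, s.nat x 0 = rep (s.nat loser) (s.nat winner) T u ∧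
    s.nat y 0 = rep (s.nat loser) (s.nat winner) T v ∧ (T = 0 ∨ s.nat meeting 0 + 1 = T ∧
      rep (s.nat loser) (s.nat winner) (s.nat meeting 0) u ≠
        rep (s.nat loser) (s.nat winner) (s.nat meeting 0) v)

theorem IsMeeting.symm (h : IsMeeting u v x y s) : IsMeeting v u y x s := by
  obtain ⟨T, hT, hx, hy, h⟩ := h
  exact ⟨T, hT, hy, hx, h.imp_right (And.imp_right Ne.symm)⟩

theorem HasForest.climbOnce_spec (hF : HasForest N s) (h : IsMeeting u v x y s)
    (hx : ∀ a ∈ [mergers, loser, winner, linkTo, meeting, y], x ≠ a) (hy : y ≠ meeting)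
    (hxy : s.nat x 0 ≠ s.nat y 0) (hlx : 1 ≤ s.nat linkTo (s.nat x 0))
    (hly : s.nat linkTo (s.nat y 0) = 0 ∨
      s.nat linkTo (s.nat x 0) < s.nat linkTo (s.nat y 0)) :
    IsMeeting u v x y ((climbOnce x).exec s) ∧
      s.nat rankOf (s.nat x 0) < s.nat rankOf (((climbOnce x).exec s).nat x 0) ∧
      ((climbOnce x).exec s).nat y 0 = s.nat y 0 := by
  obtain ⟨T, hT, hxT, hyT, -⟩ := h
  obtain ⟨j, hj⟩ := Nat.exists_eq_add_of_le' hlx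
  obtain ⟨hjf, ha⟩ := (hF.link _ _).1 hj
  have hTj : T ≤ j := by
    by_contra hTj
    exact hF.merge.rep_ne_a (not_le.1 hTj) hT u (hxT.symm.trans ha.symm)
  have hu : rep (s.nat loser) (s.nat winner) j u = s.nat x 0 := by
    rw [← hF.merge.rep_rep hTj hjf.le, ← hxT, ← ha, hF.merge.rep_a j hjf]
  have hv : rep (s.nat loser) (s.nat winner) j v = s.nat y 0 := by
    rw [← hF.merge.rep_rep hTj hjf.le, ← hyT, hF.link.rep_eq_self hjf.le (by omega)]
  simp only [List.forall_mem_cons] at hx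
  obtain ⟨hxf, hxa, hxb, -, hxm, hxy', -⟩ := hx
  have hnat : ∀ a, ((climbOnce x).exec s).nat a =
      if a = x then Function.update (s.nat x) 0 (s.nat winner j)
      else if a = meeting then Function.update (s.nat meeting) 0 j else s.nat a := by
    intro a
    simp +decide [climbOnce, hxm, hj]
  simp only [IsMeeting, hnat]
  simp +decide only [if_true, if_false, hxf.symm, hxa.symm, hxb.symm, hxm.symm, hxy'.symm, hy,
    Function.update_self, and_true]
  refine ⟨⟨j + 1, hjf, ?_, ?_, Or.inr ⟨rfl, by rwa [hu, hv]⟩⟩, ?_⟩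
  · rw [rep, hu, if_pos ha.symm]
  · rw [rep, hv, if_neg (by rw [ha]; exact hxy.symm)]
  · exact ha ▸ hF.rank.lt j hjf

theorem HasForest.one_le_link (hF : HasForest N s) (h : IsMeeting u v x y s)
    (hxy : s.nat x 0 ≠ s.nat y 0)
    (huv : rep (s.nat loser) (s.nat winner) (s.nat mergers 0) u =
      rep (s.nat loser) (s.nat winner) (s.nat mergers 0) v)
    (hx : s.nat linkTo (s.nat x 0) = 0) : 1 ≤ s.nat linkTo (s.nat y 0) := by
  obtain ⟨T, hT, hxT, hyT, -⟩ := h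
  by_contra hy
  have hx' := hF.link.rep_eq_self (b := s.nat winner) le_rfl (Or.inl hx)
  have hy' := hF.link.rep_eq_self (b := s.nat winner) le_rfl
    (Or.inl (Nat.lt_one_iff.1 (not_le.1 hy)))
  rw [hxT, hF.merge.rep_rep hT le_rfl] at hx'
  rw [hyT, hF.merge.rep_rep hT le_rfl] at hy'
  exact hxy (by rw [hxT, hyT, ← hx', ← hy', huv])

theorem HasForest.link_injective (hF : HasForest N s) (hx : 1 ≤ s.nat linkTo x)
    (he : s.nat linkTo x = s.nat linkTo y) : x = y := by
  obtain ⟨j, hj⟩ := Nat.exists_eq_add_of_le' hx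
  exact ((hF.link _ _).1 hj).2.symm.trans ((hF.link _ _).1 (he ▸ hj)).2

theorem HasForest.rank_lt (hF : HasForest N s) (hl : N ≤ 2 ^ l) (hx : 1 ≤ s.nat linkTo x) :
    s.nat rankOf x < l := by
  obtain ⟨j, hj⟩ := Nat.exists_eq_add_of_le' hx
  obtain ⟨hjf, rfl⟩ := (hF.link _ _).1 hj
  exact (hF.rank.lt j hjf).trans_le (hF.rank.rank_le hl (hF.merge.b_lt j hjf))

theorem IsMeeting.lt (hF : HasForest N s) (h : IsMeeting u v x y s) (hu : u < N) (hv : v < N) :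
    s.nat x 0 < N ∧ s.nat y 0 < N := by
  obtain ⟨T, hT, hx, hy, -⟩ := h
  exact ⟨hx ▸ hF.merge.rep_lt hT hu, hy ▸ hF.merge.rep_lt hT hv⟩

/-- A state on the way to the merger that joins `u` and `v`. The ranks of the representatives grow
with the number `t` of steps. -/
structure IsClimb (N u v x y t : ℕ) (s : State) : Prop where
  forest : HasForest N s
  connected : rep (s.nat loser) (s.nat winner) (s.nat mergers 0) u =
    rep (s.nat loser) (s.nat winner) (s.nat mergers 0) v
  isMeeting : IsMeeting u v x y s
  le_rank : t ≤ s.nat rankOf (s.nat x 0) + s.nat rankOf (s.nat y 0)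

theorem IsClimb.symm (h : IsClimb N u v x y t s) : IsClimb N v u y x t s :=
  ⟨h.forest, h.connected.symm, h.isMeeting.symm, add_comm (s.nat rankOf _) _ ▸ h.le_rank⟩

theorem IsClimb.lt_two_mul (h : IsClimb N u v x y t s) (hl : N ≤ 2 ^ l) (hu : u < N) (hv : v < N)
    (hne : s.nat x 0 ≠ s.nat y 0) : t < 2 * l := by
  have ht := h.le_rank
  obtain ⟨hxN, hyN⟩ := h.isMeeting.lt h.forest hu hv
  have hrx := h.forest.rank.rank_le hl hxN
  have hry := h.forest.rank.rank_le hl hyN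
  rcases Nat.eq_zero_or_pos (s.nat linkTo (s.nat x 0)) with hzero | hpos
  · have := h.forest.rank_lt hl (h.forest.one_le_link h.isMeeting hne h.connected hzero)
    omega
  · have := h.forest.rank_lt hl hpos
    omega

theorem IsClimb.climbOnce (h : IsClimb N u v x y t s)
    (hx : ∀ a ∈ [mergers, loser, winner, linkTo, rankOf, meeting, y], x ≠ a) (hy : y ≠ meeting)
    (hne : s.nat x 0 ≠ s.nat y 0) (hlx : 1 ≤ s.nat linkTo (s.nat x 0))
    (hly : s.nat linkTo (s.nat y 0) = 0 ∨
      s.nat linkTo (s.nat x 0) < s.nat linkTo (s.nat y 0)) :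
    IsClimb N u v x y (t + 1) ((climbOnce x).exec s) := by
  simp only [List.forall_mem_cons] at hx
  obtain ⟨hxf, hxa, hxb, hxl, hxr, hxm, hxy, -⟩ := hx
  obtain ⟨hmeet, hrank, hother⟩ := h.forest.climbOnce_spec h.isMeeting
    (by simp [hxf, hxa, hxb, hxl, hxm, hxy]) hy hne hlx hly
  have hf (a : ℕ) (hax : x ≠ a) (ham : a ≠ meeting) :
      ((KCut.climbOnce x).exec s).nat a = s.nat a := by
    simp [KCut.climbOnce, hax.symm, ham]
  have hF := hf mergers hxf (by decide)
  have hA := hf loser hxa (by decide)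
  have hB := hf winner hxb (by decide)
  have hR := hf rankOf hxr (by decide)
  refine ⟨h.forest.congr hF hA hB (hf linkTo hxl (by decide)) hR, ?_, hmeet, ?_⟩
  · rw [hF, hA, hB]
    exact h.connected
  · have := h.le_rank
    rw [hR, hother]
    omega

theorem HasForest.halts_meetEnds (hF : HasForest N s) (hl : N ≤ 2 ^ l) (hu : u < N) (hv : v < N)
    (huv : u ≠ v) (hleft : s.nat left 0 = u) (hright : s.nat right 0 = v)
    (hconn : rep (s.nat loser) (s.nat winner) (s.nat mergers 0) u =
      rep (s.nat loser) (s.nat winner) (s.nat mergers 0) v) :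
    Halts meetEnds s ((2 * l + 1) * 100) (fun s' => s'.nat meeting 0 < s'.nat mergers 0 ∧
      Joins (s'.nat loser) (s'.nat winner) (s'.nat meeting 0) u v) := by
  refine (Halts.loop (B := 2 * l) (c := 80) (I := IsClimb N u v left right) ?_ ?_
    ⟨hF, hconn, ⟨0, Nat.zero_le _, hleft, hright, Or.inl rfl⟩, Nat.zero_le _⟩).mono
    (Nat.mul_le_mul_left _ (Nat.le_of_ble_eq_true rfl)) ?_
  · exact fun t s' h hb => h.lt_two_mul hl hu hv fun he => hb ⟨he.le, he.ge⟩
  · rintro t s' h hb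
    have hne : s'.nat left 0 ≠ s'.nat right 0 := fun he => hb ⟨he.le, he.ge⟩
    refine Halts.of_loopFree rfl rfl ?_
    simp only [Prog.exec]
    split_ifs with hmove
    · exact h.climbOnce (by decide) (by decide) hne hmove.1
        ((not_and_or.1 hmove.2).imp (fun h => Nat.lt_one_iff.1 (not_le.1 h)) not_le.1)
    · have hmove : ¬ (1 ≤ s'.nat linkTo (s'.nat left 0) ∧
        ¬ (1 ≤ s'.nat linkTo (s'.nat right 0) ∧
          s'.nat linkTo (s'.nat right 0) ≤ s'.nat linkTo (s'.nat left 0))) := hmove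
      have hlink : 1 ≤ s'.nat linkTo (s'.nat right 0) := by
        by_contra hlink
        have := h.forest.one_le_link h.isMeeting.symm hne.symm h.connected.symm (by omega)
        exact hmove ⟨this, fun h => hlink h.1⟩
      have hneq : s'.nat linkTo (s'.nat right 0) ≠ s'.nat linkTo (s'.nat left 0) :=
        fun he => hne (h.forest.link_injective hlink he).symm
      exact (h.symm.climbOnce (by decide) (by decide) hne.symm hlink (by omega)).symm
  · rintro s' ⟨hb, t, -, -, ⟨T, hT, hx, hy, h⟩, -⟩
    obtain ⟨hle, hge⟩ := not_not.1 hb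
    have heq : s'.nat left 0 = s'.nat right 0 := le_antisymm hle hge
    rcases h with rfl | ⟨rfl, h⟩
    · exact absurd (hx.symm.trans (heq.trans hy)) huv
    · exact ⟨hT, h, by rw [← hx, ← hy, heq]⟩

/-- The arrays `weight` and `join` hold the contributions of the first `t` edges to the weights of
the cuts around the vertices and to the weights of the mergers. -/
structure HasWeights (t : ℕ) (s : State) : Prop where
  weight_eq : s.real weight =
    cutWeight t (s.nat endU) (s.nat endV) (s.real cap) (s.nat loser) (s.nat winner) 0
  join_eq : ∀ j < s.nat mergers 0, s.real join j =
    joinWeight t (s.nat endU) (s.nat endV) (s.real cap) (s.nat loser) (s.nat winner) j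

theorem HasWeights.congr (h : HasWeights t s)
    (hn : ∀ a ∈ [endU, endV, mergers, loser, winner], s'.nat a = s.nat a)
    (hr : ∀ a ∈ [cap, weight, join], s'.real a = s.real a) : HasWeights t s' := by
  simp only [List.forall_mem_cons] at hn hr
  obtain ⟨hU, hV, hf, ha, hb, -⟩ := hn
  obtain ⟨hc, hw, hj, -⟩ := hr
  constructor
  · rw [hU, hV, ha, hb, hc, hw]; exact h.weight_eq
  · rw [hU, hV, ha, hb, hc, hf, hj]; exact h.join_eq

theorem HasWeights.exec_addWeight (h : HasWeights t s) (hF : HasForest N s)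
    (hround : s.nat round 0 = t) (hne : s.nat endU t ≠ s.nat endV t)
    (hmeeting : s.nat meeting 0 < s.nat mergers 0)
    (hjoins : Joins (s.nat loser) (s.nat winner) (s.nat meeting 0) (s.nat endU t)
      (s.nat endV t)) : HasWeights (t + 1) (addWeight.exec s) := by
  have hnat : (addWeight.exec s).nat = s.nat := rfl
  have hreal : ∀ a, (addWeight.exec s).real a =
      if a = weight then fun r => s.real weight r +
        if s.nat endU t = r ↔ s.nat endV t = r then 0 else s.real cap t
      else if a = join then Function.update (s.real join) (s.nat meeting 0)
        (s.real join (s.nat meeting 0) + s.real cap t)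
      else s.real a := by
    intro a
    simp +decide only [addWeight, Prog.exec, NExp.eval, RExp.eval,
      State.setReal_real, State.setReal_nat, hround, if_true, if_false]
    split_ifs
    · funext r
      grind
    · rfl
    · rfl
  constructor
  · simp +decide only [hnat, hreal, if_true, if_false, h.weight_eq]
    exact funext fun r => (sum_range_succ _ t).symm
  · intro j hj
    simp +decide only [hnat, hreal, if_true, if_false, joinWeight, sum_range_succ,
      Function.update_apply]
    rcases eq_or_ne j (s.nat meeting 0) with rfl | hjm
    · rw [if_pos rfl, if_pos hjoins, h.join_eq _ hmeeting, joinWeight]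
    · rw [if_neg hjm, if_neg fun hj' => hjm (hF.merge.joins_unique hj hmeeting hj' hjoins),
        h.join_eq j hj, joinWeight, add_zero]

theorem halts_addWeights (hl : 0 < M → N ≤ 2 ^ l) (hM : s.nat count 0 = M)
    (hF : HasForest N s)
    (hU : ∀ t < M, s.nat endU t < N) (hV : ∀ t < M, s.nat endV t < N)
    (hne : ∀ t < M, s.nat endU t ≠ s.nat endV t)
    (hconn : ∀ t < M, rep (s.nat loser) (s.nat winner) (s.nat mergers 0) (s.nat endU t) =
      rep (s.nat loser) (s.nat winner) (s.nat mergers 0) (s.nat endV t))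
    (h : HasWeights 0 s) : Halts addWeights s ((M + 1) * ((l + 1) * 400)) (HasWeights M) := by
  refine (Halts.forTo (B := M) (c := (l + 1) * 300) (I := HasWeights) (fun s' hf => ?_) (by rfl)
    (h.congr (by simp +decide) (by simp)) fun t s' ht hf hround h => ?_).mono
    (Nat.mul_le_mul_left _ ?_) fun _ h => h
  · exact (congrFun (hf.nat_eq count) 0).trans hM
  · have hset : Halts (.setVar left (.get endU (.var round)) ;;
        .setVar right (.get endV (.var round))) s' 20 (fun s'' =>
        s''.nat left 0 = s.nat endU t ∧ s''.nat right 0 = s.nat endV t) :=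
      Halts.of_loopFree rfl rfl (by simp +decide [hround, hf.nat_eq endU, hf.nat_eq endV])
    refine (hset.seq (t' := (2 * l + 1) * 100 + 80) fun s₁ hf₁ ⟨hleft, hright⟩ => ?_).mono
      (by omega) fun _ h => h
    have h₁ : ∀ a ∈ [endU, endV, mergers, loser, winner, linkTo, rankOf], s₁.nat a = s.nat a :=
      fun a ha => (hf₁.nat a (by revert ha a; decide)).trans (hf.nat a (by revert ha a; decide))
    simp only [List.forall_mem_cons] at h₁
    obtain ⟨hU₁, hV₁, hf₁', ha₁, hb₁, hlink₁, hrank₁, -⟩ := h₁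
    have hF₁ : HasForest N s₁ := hF.congr hf₁' ha₁ hb₁ hlink₁ hrank₁
    refine (hF₁.halts_meetEnds (hl (Nat.zero_lt_of_lt ht)) (hU t ht) (hV t ht) (hne t ht)
      hleft hright ?_).seq fun s₂ hf₂ ⟨hmeeting, hjoins⟩ => Halts.of_loopFree rfl rfl ?_
    · rw [ha₁, hb₁, hf₁']; exact hconn t ht
    · have hF₂ : HasForest N s₂ :=
        hF₁.congr (hf₂.nat_eq _) (hf₂.nat_eq _) (hf₂.nat_eq _) (hf₂.nat_eq _) (hf₂.nat_eq _)
      have h₂ : HasWeights t s₂ := h.congr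
        (fun a ha => (hf₂.nat a (by revert ha a; decide)).trans
          (hf₁.nat a (by revert ha a; decide)))
        (fun a ha => (hf₂.real a (by revert ha a; decide)).trans
          (hf₁.real a (by revert ha a; decide)))
      have hU₂ : s₂.nat endU t = s.nat endU t := by rw [hf₂.nat_eq endU, hU₁]
      have hV₂ : s₂.nat endV t = s.nat endV t := by rw [hf₂.nat_eq endV, hV₁]
      have hround₂ : s₂.nat round 0 = t := by rw [hf₂.nat_eq round, hf₁.nat_eq round, hround]
      exact (h₂.exec_addWeight hF₂ hround₂ (hU₂ ▸ hV₂ ▸ hne t ht) hmeeting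
        (hU₂ ▸ hV₂ ▸ hjoins)).congr (by simp +decide) (by simp)
  · simp only [NExp.cost]; omega

end WeightProg

/-! ### The choice of a cut at every merger -/

section Choice

variable {N f i j r e x y : ℕ} {W W' : ℕ → ℝ} {a b : ℕ → ℕ} {D : ℕ → ℕ → ℝ}

/-- The one of two players with the larger key. -/
noncomputable def worse (W : ℕ → ℝ) (x y : ℕ) : ℕ := if key W x ≤ key W y then y else x

theorem key_worse (W : ℕ → ℝ) (x y : ℕ) : key W (worse W x y) = max (key W x) (key W y) := by
  rw [worse]
  split_ifs with h
  · exact (max_eq_right h).symm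
  · exact (max_eq_left (le_of_not_ge h)).symm

theorem better_worse_eq_or (W : ℕ → ℝ) (x y : ℕ) :
    better W x y = x ∧ worse W x y = y ∨ better W x y = y ∧ worse W x y = x := by
  rw [better, worse]
  split_ifs <;> simp

/-- The representative of the `e`-th candidate: the candidates `2 * j` and `2 * j + 1` are the cuts
around the two classes that are united by the `j`-th merger. -/
def candRep (a b : ℕ → ℕ) (e : ℕ) : ℕ := if e % 2 = 0 then a (e / 2) else b (e / 2)

theorem candRep_two_mul (a b : ℕ → ℕ) (j : ℕ) : candRep a b (2 * j) = a j := by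
  simp [candRep]

theorem candRep_two_mul_add_one (a b : ℕ → ℕ) (j : ℕ) : candRep a b (2 * j + 1) = b j := by
  simp [candRep, Nat.add_mod, Nat.add_div]

/-- The candidate that was set aside for the class of a representative before the `j`-th merger, in
the encoding of the players of a tournament. The merger chooses the best candidate among the two
classes and the candidates set aside for them, and then sets aside the better of the candidates of
the other class. -/
noncomputable def pend (W : ℕ → ℝ) (a b : ℕ → ℕ) : ℕ → ℕ → ℕ
  | 0 => fun _ => 0
  | j + 1 => Function.update (pend W a b j) (b j)
      (worse W (better W (pend W a b j (a j)) (2 * j + 1))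
        (better W (pend W a b j (b j)) (2 * j + 2)))

/-- The candidate offered by the first of the two classes of the `j`-th merger. -/
noncomputable def offerA (W : ℕ → ℝ) (a b : ℕ → ℕ) (j : ℕ) : ℕ :=
  better W (pend W a b j (a j)) (2 * j + 1)

/-- The candidate offered by the second of the two classes of the `j`-th merger. -/
noncomputable def offerB (W : ℕ → ℝ) (a b : ℕ → ℕ) (j : ℕ) : ℕ :=
  better W (pend W a b j (b j)) (2 * j + 2)

/-- The candidate chosen at the `j`-th merger. -/
noncomputable def chosen (W : ℕ → ℝ) (a b : ℕ → ℕ) (j : ℕ) : ℕ :=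
  better W (offerA W a b j) (offerB W a b j)

theorem pend_succ (W : ℕ → ℝ) (a b : ℕ → ℕ) (j : ℕ) :
    pend W a b (j + 1) =
      Function.update (pend W a b j) (b j) (worse W (offerA W a b j) (offerB W a b j)) := rfl

theorem pend_le (W : ℕ → ℝ) (a b : ℕ → ℕ) (j r : ℕ) : pend W a b j r ≤ 2 * j := by
  induction j generalizing r with
  | zero => exact le_rfl
  | succ j ih =>
    have ha := better_eq_or W (pend W a b j (a j)) (2 * j + 1)
    have hb := better_eq_or W (pend W a b j (b j)) (2 * j + 2)
    have := ih (a j)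
    have := ih (b j)
    have := ih r
    rw [pend_succ, Function.update_apply, worse, offerA, offerB]
    split_ifs <;> omega

theorem exists_better_eq_succ (W : ℕ → ℝ) (x e : ℕ) : ∃ e', better W x (e + 1) = e' + 1 := by
  refine Nat.exists_eq_succ_of_ne_zero fun h => ?_
  have hkey := key_better W x (e + 1)
  rw [h] at hkey
  exact (lt_of_le_of_lt (min_le_right _ _) (WithTop.coe_lt_top (W e))).ne hkey.symm

theorem exists_offerA (W : ℕ → ℝ) (a b : ℕ → ℕ) (j : ℕ) :
    ∃ e < 2 * j + 2, offerA W a b j = e + 1 := by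
  obtain ⟨e, he⟩ := exists_better_eq_succ W (pend W a b j (a j)) (2 * j)
  have := pend_le W a b j (a j)
  have := better_eq_or W (pend W a b j (a j)) (2 * j + 1)
  exact ⟨e, by omega, he⟩

theorem exists_offerB (W : ℕ → ℝ) (a b : ℕ → ℕ) (j : ℕ) :
    ∃ e < 2 * j + 2, offerB W a b j = e + 1 := by
  obtain ⟨e, he : better W (pend W a b j (b j)) (2 * j + 2) = e + 1⟩ :=
    exists_better_eq_succ W (pend W a b j (b j)) (2 * j + 1)
  have := pend_le W a b j (b j)
  have := better_eq_or W (pend W a b j (b j)) (2 * j + 2)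
  exact ⟨e, by omega, he⟩

theorem exists_chosen (W : ℕ → ℝ) (a b : ℕ → ℕ) (j : ℕ) :
    ∃ e < 2 * j + 2, chosen W a b j = e + 1 := by
  obtain h | h := better_eq_or W (offerA W a b j) (offerB W a b j)
  · rw [chosen, h]
    exact exists_offerA W a b j
  · rw [chosen, h]
    exact exists_offerB W a b j

/-! ### Independence of the chosen cuts -/

/-- The indicator function of the class of `r` after `j` mergers. -/
noncomputable def classVec (N : ℕ) (a b : ℕ → ℕ) (j r : ℕ) : Fin N → ℝ :=
  fun v => if rep a b j v = r then 1 else 0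

/-- The indicator function of the class around which the `e`-th candidate is a cut. -/
noncomputable def candVec (N : ℕ) (a b : ℕ → ℕ) (e : ℕ) : Fin N → ℝ :=
  classVec N a b (e / 2) (candRep a b e)

theorem candVec_two_mul (N : ℕ) (a b : ℕ → ℕ) (j : ℕ) :
    candVec N a b (2 * j) = classVec N a b j (a j) := by
  rw [candVec, candRep_two_mul, Nat.mul_div_cancel_left j two_pos]

theorem candVec_two_mul_add_one (N : ℕ) (a b : ℕ → ℕ) (j : ℕ) :
    candVec N a b (2 * j + 1) = classVec N a b j (b j) := by
  rw [candVec, candRep_two_mul_add_one, show (2 * j + 1) / 2 = j by omega]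

theorem IsMergeSeq.classVec_succ_b (h : IsMergeSeq N f a b) (hj : j < f) :
    classVec N a b (j + 1) (b j) = classVec N a b j (a j) + classVec N a b j (b j) := by
  have hne := h.ne j hj
  ext v
  simp only [classVec, rep, Pi.add_apply]
  grind

theorem classVec_succ_of_ne (hra : r ≠ a j) (hrb : r ≠ b j) :
    classVec N a b (j + 1) r = classVec N a b j r := by
  ext v
  simp only [classVec, rep]
  grind

theorem classVec_zero (v : Fin N) : classVec N a b 0 v = Pi.single v 1 := by
  ext w
  rcases eq_or_ne w v with rfl | hwv
  · simp [classVec, rep]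
  · simp [classVec, rep, hwv, Fin.val_inj]

/-- Modulo `K`, the candidate encoded by `x`, if any, is the cut around the class of `r`. -/
def StandsFor (N : ℕ) (a b : ℕ → ℕ) (K : Submodule ℝ (Fin N → ℝ)) (j r x : ℕ) : Prop :=
  ∀ e, x = e + 1 → candVec N a b e - classVec N a b j r ∈ K

variable {K : Submodule ℝ (Fin N → ℝ)}

theorem StandsFor.offerA (h : StandsFor N a b K j (a j) (pend W a b j (a j))) :
    StandsFor N a b K j (a j) (offerA W a b j) := by
  obtain he | he := better_eq_or W (pend W a b j (a j)) (2 * j + 1)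
  · rwa [KCut.offerA, he]
  · rw [KCut.offerA, he]
    rintro e he
    obtain rfl : e = 2 * j := by omega
    rw [candVec_two_mul, sub_self]
    exact K.zero_mem

theorem StandsFor.offerB (h : StandsFor N a b K j (b j) (pend W a b j (b j))) :
    StandsFor N a b K j (b j) (offerB W a b j) := by
  obtain he | he := better_eq_or W (pend W a b j (b j)) (2 * j + 2)
  · rwa [KCut.offerB, he]
  · rw [KCut.offerB, he]
    rintro e he
    obtain rfl : e = 2 * j + 1 := by omega
    rw [candVec_two_mul_add_one, sub_self]
    exact K.zero_mem

theorem StandsFor.classVec_mem (h : StandsFor N a b K j r (e + 1)) (he : candVec N a b e ∈ K) :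
    classVec N a b j r ∈ K :=
  (Submodule.sub_mem_iff_right K he).1 (h e rfl)

theorem IsMergeSeq.classVec_mem_or (h : IsMergeSeq N f a b) (hj : j < f)
    (hA : StandsFor N a b K j (a j) (pend W a b j (a j)))
    (hB : StandsFor N a b K j (b j) (pend W a b j (b j)))
    (hchosen : candVec N a b (chosen W a b j - 1) ∈ K) :
    (classVec N a b j (a j) ∈ K ∨ classVec N a b j (b j) ∈ K) ∧
      StandsFor N a b K (j + 1) (b j) (pend W a b (j + 1) (b j)) := by
  obtain ⟨e, -, he⟩ := exists_offerA W a b j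
  obtain ⟨e', -, he'⟩ := exists_offerB W a b j
  have hA := he ▸ hA.offerA
  have hB := he' ▸ hB.offerB
  have hdrop (z u v : Fin N → ℝ) (hu : u ∈ K) (hz : z - v ∈ K) : z - (u + v) ∈ K := by
    rw [show z - (u + v) = z - v - u by abel]
    exact K.sub_mem hz hu
  rw [pend_succ, Function.update_self, he, he']
  rw [chosen, he, he'] at hchosen
  rcases better_worse_eq_or W (e + 1) (e' + 1) with ⟨hb, hw⟩ | ⟨hb, hw⟩
  · rw [hb] at hchosen
    have hmem := hA.classVec_mem hchosen
    refine ⟨Or.inl hmem, fun e'' he'' => ?_⟩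
    rw [h.classVec_succ_b hj]
    exact hdrop _ _ _ hmem (hB e'' (hw ▸ he''))
  · rw [hb] at hchosen
    have hmem := hB.classVec_mem hchosen
    refine ⟨Or.inr hmem, fun e'' he'' => ?_⟩
    rw [h.classVec_succ_b hj, add_comm]
    exact hdrop _ _ _ hmem (hA e'' (hw ▸ he''))

theorem IsMergeSeq.standsFor_pend (h : IsMergeSeq N f a b)
    (hchosen : ∀ i < f, candVec N a b (chosen W a b i - 1) ∈ K) (hj : j ≤ f)
    (hr : r ∈ reps N a b j) : StandsFor N a b K j r (pend W a b j r) := by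
  induction j generalizing r with
  | zero => exact fun e he => absurd he (Nat.succ_ne_zero e).symm
  | succ j ih =>
    obtain rfl | hrb := eq_or_ne r (b j)
    · exact (h.classVec_mem_or hj (ih (by omega) (h.a_mem_reps hj))
        (ih (by omega) (h.b_mem_reps hj)) (hchosen j hj)).2
    · rw [h.reps_succ hj, mem_erase] at hr
      rw [pend_succ, Function.update_of_ne hrb, StandsFor, classVec_succ_of_ne hr.1 hrb]
      exact ih (by omega) hr.2

/-- The chosen cuts and the components generate all functions on the vertices: going back in time,
a chosen cut separates the two classes of its merger. -/
theorem IsMergeSeq.eq_top_of_chosen_mem (h : IsMergeSeq N f a b)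
    (hchosen : ∀ i < f, candVec N a b (chosen W a b i - 1) ∈ K)
    (hroot : ∀ r ∈ reps N a b f, classVec N a b f r ∈ K) : K = ⊤ := by
  have hclass (j : ℕ) (hj : j ≤ f) : ∀ r ∈ reps N a b j, classVec N a b j r ∈ K := by
    induction hj using Nat.decreasingInduction with
    | self => exact hroot
    | of_succ j hj ih =>
      have hsum := ih _ (h.b_mem_reps_succ hj)
      rw [h.classVec_succ_b hj] at hsum
      obtain ⟨hA, hB⟩ : classVec N a b j (a j) ∈ K ∧ classVec N a b j (b j) ∈ K := by
        rcases (h.classVec_mem_or hj (h.standsFor_pend hchosen hj.le (h.a_mem_reps hj))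
          (h.standsFor_pend hchosen hj.le (h.b_mem_reps hj)) (hchosen j hj)).1 with hA | hB
        · exact ⟨hA, (K.add_mem_iff_right hA).1 hsum⟩
        · exact ⟨(K.add_mem_iff_left hB).1 hsum, hB⟩
      intro r hr
      by_cases hra : r = a j
      · exact hra ▸ hA
      by_cases hrb : r = b j
      · exact hrb ▸ hB
      rw [← classVec_succ_of_ne hra hrb]
      exact ih r (by rw [h.reps_succ hj]; exact mem_erase.2 ⟨hra, hr⟩)
  rw [← top_le_iff, ← (Pi.basisFun ℝ (Fin N)).span_eq, Submodule.span_le]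
  rintro _ ⟨v, rfl⟩
  rw [Pi.basisFun_apply, ← classVec_zero (a := a) (b := b)]
  exact hclass 0 (Nat.zero_le _) v (mem_reps.2 ⟨v.2, rfl⟩)

/-! ### The weight of the chosen cuts -/

/-- The weight of the best candidate for a cut around the class of `r` before the `j`-th merger,
where `D j r` is the weight of the cut around the class itself. -/
noncomputable def effWeight (W : ℕ → ℝ) (D : ℕ → ℕ → ℝ) (a b : ℕ → ℕ) (j r : ℕ) : ℝ :=
  if pend W a b j r = 0 then D j r else min (W (pend W a b j r - 1)) (D j r)

theorem coe_effWeight : (effWeight W D a b j r : WithTop ℝ) =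
    min (key W (pend W a b j r)) (D j r) := by
  rw [effWeight]
  rcases pend W a b j r with _ | e
  · simp [key]
  · simp [key]

/-- The candidates have the weights given by `D`, which only change for the united classes. -/
structure IsCandWeight (a b : ℕ → ℕ) (D : ℕ → ℕ → ℝ) (W : ℕ → ℝ) : Prop where
  nonneg : ∀ j r, 0 ≤ D j r
  succ_of_ne : ∀ j r, r ≠ a j → r ≠ b j → D (j + 1) r = D j r
  eq : ∀ e, W e = D (e / 2) (candRep a b e)

namespace IsCandWeight

variable (h : IsCandWeight a b D W)
include h

theorem key_offerA : key W (offerA W a b j) = effWeight W D a b j (a j) := by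
  rw [offerA, key_better, coe_effWeight, key, h.eq, candRep_two_mul,
    Nat.mul_div_cancel_left j two_pos]

theorem key_offerB : key W (offerB W a b j) = effWeight W D a b j (b j) := by
  rw [offerB, key_better, coe_effWeight, key, h.eq, candRep_two_mul_add_one,
    show (2 * j + 1) / 2 = j by omega]

theorem weight_chosen : W (chosen W a b j - 1) =
    min (effWeight W D a b j (a j)) (effWeight W D a b j (b j)) := by
  obtain ⟨e, -, he⟩ := exists_chosen W a b j
  rw [← WithTop.coe_inj, WithTop.coe_min, ← h.key_offerA, ← h.key_offerB, ← key_better, ← chosen,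
    he, key, Nat.add_sub_cancel]

theorem effWeight_succ_b_le : effWeight W D a b (j + 1) (b j) ≤
    max (effWeight W D a b j (a j)) (effWeight W D a b j (b j)) := by
  rw [← WithTop.coe_le_coe, WithTop.coe_max, ← h.key_offerA, ← h.key_offerB, ← key_worse,
    coe_effWeight, pend_succ, Function.update_self]
  exact min_le_left _ _

theorem effWeight_succ_of_ne (hra : r ≠ a j) (hrb : r ≠ b j) :
    effWeight W D a b (j + 1) r = effWeight W D a b j r := by
  rw [effWeight, effWeight, pend_succ, Function.update_of_ne hrb, h.succ_of_ne j r hra hrb]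

theorem effWeight_nonneg : 0 ≤ effWeight W D a b j r := by
  rw [effWeight]
  split_ifs
  · exact h.nonneg j r
  · exact le_min (h.eq _ ▸ h.nonneg _ _) (h.nonneg j r)

theorem sum_weight_chosen_add_effWeight_le (hm : IsMergeSeq N f a b) (hj : j ≤ f)
    (hr : r ∈ reps N a b j) :
    ∑ i ∈ Ico j f, W (chosen W a b i - 1) + effWeight W D a b j r ≤
      ∑ r ∈ reps N a b j, effWeight W D a b j r := by
  induction hj using Nat.decreasingInduction generalizing r with
  | self =>
    rw [Ico_self, sum_empty, zero_add]
    exact single_le_sum (f := effWeight W D a b f) (fun _ _ => h.effWeight_nonneg) hr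
  | of_succ j hj ih =>
    let E := effWeight W D a b
    have hsucc : ∑ r ∈ reps N a b (j + 1), E (j + 1) r =
        ∑ r ∈ ((reps N a b j).erase (a j)).erase (b j), E j r + E (j + 1) (b j) := by
      rw [← sum_erase_add _ _ (hm.b_mem_reps_succ hj), hm.reps_succ hj]
      refine congrArg (· + _) (sum_congr rfl fun r hr => ?_)
      rw [mem_erase, mem_erase] at hr
      exact h.effWeight_succ_of_ne hr.2.1 hr.1
    have hsum : ∑ r ∈ reps N a b j, E j r =
        ∑ r ∈ ((reps N a b j).erase (a j)).erase (b j), E j r + E j (b j) + E j (a j) := by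
      rw [sum_erase_add _ _ (hm.reps_succ hj ▸ hm.b_mem_reps_succ hj),
        sum_erase_add _ _ (hm.a_mem_reps hj)]
    have hmin : W (chosen W a b j - 1) = min (E j (a j)) (E j (b j)) := h.weight_chosen
    have hmax : E (j + 1) (b j) ≤ max (E j (a j)) (E j (b j)) := h.effWeight_succ_b_le
    have hminmax := min_add_max (E j (a j)) (E j (b j))
    rw [sum_eq_sum_Ico_succ_bot hj, hsum]
    by_cases hra : r = a j ∨ r = b j
    · have := ih (hm.b_mem_reps_succ hj)
      rw [hsucc] at this
      have hle : E j r ≤ max (E j (a j)) (E j (b j)) := by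
        rcases hra with rfl | rfl
        · exact le_max_left _ _
        · exact le_max_right _ _
      linarith
    · rw [not_or] at hra
      have := ih (hm.reps_succ hj ▸ mem_erase.2 ⟨hra.1, hr⟩)
      rw [hsucc, h.effWeight_succ_of_ne hra.1 hra.2] at this
      linarith

/-- Averaging the preceding bound over the classes. -/
theorem sum_weight_chosen_le (hm : IsMergeSeq N f a b) (hj : j ≤ f) :
    ∑ i ∈ Ico j f, W (chosen W a b i - 1) ≤ (1 - 1 / N) * ∑ r ∈ reps N a b j, D j r := by
  rcases N.eq_zero_or_pos with rfl | hN
  · simp [Nat.le_zero.1 hm.le, reps]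
  let S := ∑ i ∈ Ico j f, W (chosen W a b i - 1)
  let T := ∑ r ∈ reps N a b j, effWeight W D a b j r
  have hle : ∀ r ∈ reps N a b j, S + effWeight W D a b j r ≤ T :=
    fun r hr => h.sum_weight_chosen_add_effWeight_le hm hj hr
  have hcard := hm.card_reps_add hj
  have hf := hm.lt_of_pos hN
  obtain ⟨r, hr⟩ := card_pos.1 (show 0 < #(reps N a b j) by omega)
  have hST : S ≤ T := (le_add_of_nonneg_right h.effWeight_nonneg).trans (hle r hr)
  have hsum : #(reps N a b j) * S + T ≤ #(reps N a b j) * T := by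
    simpa only [sum_add_distrib, sum_const, nsmul_eq_mul] using sum_le_sum hle
  have hcast : (#(reps N a b j) : ℝ) + j = N := by exact_mod_cast hcard
  have hN' : (0 : ℝ) < N := by exact_mod_cast hN
  have hTD : T ≤ ∑ r ∈ reps N a b j, D j r :=
    sum_le_sum fun r _ => by
      rw [effWeight]
      split_ifs
      · exact le_rfl
      · exact min_le_right _ _
  calc S ≤ (1 - 1 / N) * T := by
        rw [one_sub_div hN'.ne', div_mul_eq_mul_div, le_div_iff₀ hN']
        nlinarith [mul_le_mul_of_nonneg_left hST (Nat.cast_nonneg (α := ℝ) j)]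
    _ ≤ _ := mul_le_mul_of_nonneg_left hTD
      (sub_nonneg.2 ((div_le_one hN').2 (by exact_mod_cast hN)))

end IsCandWeight

end Choice

/-! ### The choice of the cuts on the machine -/

section ChoiceProg

abbrev pending : ℕ := 19
abbrev choice : ℕ := 20
abbrev offer₁ : ℕ := 21
abbrev offer₂ : ℕ := 22
abbrev candWt : ℕ := 4
abbrev choiceWt : ℕ := 5

variable {N f j e x : ℕ} {a b : ℕ → ℕ} {D : ℕ → ℕ → ℝ} {J W W' : ℕ → ℝ} {s s' : State}

/-- Records the weights of the two candidates of the merger number `round`. -/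
def recordCands : Prog :=
  .setReal candWt (.var round + .var round) (.get weight (.get loser (.var round))) ;;
    .setReal candWt (.var round + .var round + 1) (.get weight (.get winner (.var round)))

/-- Writes to the variable `x` the better one of the candidate `e` and that set aside for `r`. -/
def makeOffer (x : ℕ) (r e : NExp) : Prog :=
  .ite (keyLe candWt (.get pending r) e) (.setVar x (.get pending r)) (.setVar x e)

/-- Chooses the better one of the two offers and sets the other one aside. -/
def chooseOffer : Prog :=
  .ite (keyLe candWt (.var offer₁) (.var offer₂))
    (.setNat choice (.var round) (.var offer₁) ;;
      .setNat pending (.get winner (.var round)) (.var offer₂))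
    (.setNat choice (.var round) (.var offer₂) ;;
      .setNat pending (.get winner (.var round)) (.var offer₁))

/-- Updates the weights after the merger number `round`. -/
def uniteWeights : Prog :=
  .setReal weight (.get winner (.var round))
      (.get weight (.get loser (.var round)) + .get weight (.get winner (.var round)) -
        (.get join (.var round) + .get join (.var round))) ;;
    .setReal choiceWt (.var round) (.get candWt (.get choice (.var round) - 1))

/-- Chooses a candidate for the merger number `round`. -/
def chooseCut : Prog :=
  recordCands ;; makeOffer offer₁ (.get loser (.var round)) (.var round + .var round + 1) ;;
    makeOffer offer₂ (.get winner (.var round)) (.var round + .var round + 2) ;; chooseOffer ;;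
    uniteWeights

/-- Chooses a candidate for every merger. -/
def chooseCuts : Prog := .forTo round (.var mergers) chooseCut

theorem better_congr {x y : ℕ} (hx : key W x = key W' x) (hy : key W y = key W' y) :
    better W x y = better W' x y := by
  rw [better, better, hx, hy]

theorem worse_congr {x y : ℕ} (hx : key W x = key W' x) (hy : key W y = key W' y) :
    worse W x y = worse W' x y := by
  rw [worse, worse, hx, hy]

theorem makeOffer_exec (x : ℕ) (r e : NExp) (s : State) : (makeOffer x r e).exec s =
    s.setNat x 0 (better (s.real candWt) (s.nat pending (r.eval s)) (e.eval s)) := by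
  simp only [makeOffer, Prog.exec, keyLe_eval, NExp.eval, better]
  split_ifs <;> rfl

theorem chooseOffer_exec (s : State) : chooseOffer.exec s =
    (s.setNat choice (s.nat round 0)
      (better (s.real candWt) (s.nat offer₁ 0) (s.nat offer₂ 0))).setNat pending
      (s.nat winner (s.nat round 0))
      (worse (s.real candWt) (s.nat offer₁ 0) (s.nat offer₂ 0)) := by
  simp only [chooseOffer, Prog.exec, keyLe_eval, NExp.eval, better, worse]
  split_ifs <;> rfl

/-- The memory after the choice of cuts for the first `j` of the `f` mergers; `D` and `W` are the
weights of the cuts and of the candidates, and `J` are the weights of the mergers. -/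
structure HasChoices (f : ℕ) (a b : ℕ → ℕ) (D : ℕ → ℕ → ℝ) (W J : ℕ → ℝ) (j : ℕ) (s : State) :
    Prop where
  loser_eq : s.nat loser = a
  winner_eq : s.nat winner = b
  mergers_eq : s.nat mergers 0 = f
  join_eq : ∀ i < f, s.real join i = J i
  weight_eq : ∀ r, rep a b j r = r → s.real weight r = D j r
  candWt_eq : ∀ e < 2 * j, s.real candWt e = W e
  pending_eq : s.nat pending = pend W a b j
  choice_eq : ∀ i < j, s.nat choice i = chosen W a b i
  choiceWt_eq : ∀ i < j, s.real choiceWt i = W (chosen W a b i - 1)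

theorem HasChoices.recordCands (h : HasChoices f a b D W J j s) (hm : IsMergeSeq N f a b)
    (hD : IsCandWeight a b D W) (hround : s.nat round 0 = j) (hj : j < f) (he : e < 2 * j + 2) :
    (recordCands.exec s).real candWt e = W e := by
  have hW : (KCut.recordCands.exec s).real candWt = Function.update (Function.update
      (s.real candWt) (2 * j) (s.real weight (a j))) (2 * j + 1) (s.real weight (b j)) := by
    simp +decide [KCut.recordCands, hround, h.loser_eq, h.winner_eq, ← two_mul]
  rw [hW, Function.update_apply, Function.update_apply, h.weight_eq _ (hm.rep_a j hj),
    h.weight_eq _ (hm.rep_b j hj)]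
  split_ifs with h₁ h₂
  · rw [h₁, hD.eq, candRep_two_mul_add_one, show (2 * j + 1) / 2 = j by omega]
  · rw [h₂, hD.eq, candRep_two_mul, Nat.mul_div_cancel_left j two_pos]
  · exact h.candWt_eq e (by omega)

theorem HasChoices.exec_chooseCut_eq (h : HasChoices f a b D W J j s) (hm : IsMergeSeq N f a b)
    (hD : IsCandWeight a b D W) (hround : s.nat round 0 = j) (hj : j < f) :
    chooseCut.exec s = uniteWeights.exec (((((KCut.recordCands.exec s).setNat offer₁ 0
      (offerA W a b j)).setNat offer₂ 0 (offerB W a b j)).setNat choice j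
        (chosen W a b j)).setNat pending (b j) (worse W (offerA W a b j) (offerB W a b j))) := by
  have hnat : (KCut.recordCands.exec s).nat = s.nat := rfl
  have hkey : ∀ x ≤ 2 * j + 2, key ((KCut.recordCands.exec s).real candWt) x = key W x := by
    rintro (_ | e) hx
    · rfl
    · exact congrArg _ (h.recordCands hm hD hround hj hx)
  have hA : better ((KCut.recordCands.exec s).real candWt) (pend W a b j (a j)) (2 * j + 1) =
      offerA W a b j :=
    better_congr (hkey _ ((pend_le W a b j _).trans (by omega))) (hkey _ (by omega))
  have hB : better ((KCut.recordCands.exec s).real candWt) (pend W a b j (b j)) (2 * j + 2) =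
      offerB W a b j :=
    better_congr (hkey _ ((pend_le W a b j _).trans (by omega))) (hkey _ (by omega))
  obtain ⟨e, he, heA⟩ := exists_offerA W a b j
  obtain ⟨e', he', heB⟩ := exists_offerB W a b j
  have hchosen := better_congr (hkey (offerA W a b j) (by omega)) (hkey (offerB W a b j) (by omega))
  have hworse := worse_congr (hkey (offerA W a b j) (by omega)) (hkey (offerB W a b j) (by omega))
  rw [← chosen] at hchosen
  simp +decide only [chooseCut, Prog.exec, makeOffer_exec, chooseOffer_exec, State.setNat_nat,
    State.setNat_real, hnat, hround, h.loser_eq, h.winner_eq, h.pending_eq, NExp.eval,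
    ← two_mul, if_true, if_false, Function.update_self, hA, hB, hchosen, hworse]

theorem HasChoices.exec_chooseCut (h : HasChoices f a b D W J j s) (hm : IsMergeSeq N f a b)
    (hD : IsCandWeight a b D W) (hround : s.nat round 0 = j) (hj : j < f)
    (hJ : D (j + 1) (b j) = D j (a j) + D j (b j) - (J j + J j)) :
    HasChoices f a b D W J (j + 1) (chooseCut.exec s) := by
  obtain ⟨e, he, hchosen⟩ := exists_chosen W a b j
  have hV := fun e => h.recordCands (e := e) hm hD hround hj
  have hother (A : ℕ) (hA : A ≠ candWt) : (KCut.recordCands.exec s).real A = s.real A := by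
    simp [KCut.recordCands, hA]
  have hnat : (KCut.recordCands.exec s).nat = s.nat := rfl
  rw [h.exec_chooseCut_eq hm hD hround hj]
  generalize KCut.recordCands.exec s = s₁ at *
  refine ⟨?_, ?_, ?_, ?_, ?_, ?_, ?_, ?_, ?_⟩ <;>
    simp +decide only [uniteWeights, Prog.exec, State.setReal_nat, State.setNat_nat,
      State.setReal_real, State.setNat_real, hnat, if_true, if_false, NExp.eval, NExp.eval_sub,
      RExp.eval, RExp.eval_sub, hround, h.loser_eq, h.winner_eq, h.mergers_eq,
      Function.update_self]
  · rw [hother _ (by decide)]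
    exact h.join_eq
  · intro r hr
    rw [hother _ (by decide), hother _ (by decide), Function.update_apply]
    split_ifs with hrb
    · rw [hrb, hJ, h.weight_eq _ (hm.rep_a j hj), h.weight_eq _ (hm.rep_b j hj), h.join_eq j hj]
    · have hra : r ≠ a j := hr ▸ hm.rep_ne_a j.lt_succ_self hj r
      rw [hD.succ_of_ne j r hra hrb,
        h.weight_eq r (hm.rep_eq_self_of_le j.le_succ hj hr)]
  · exact hV
  · rw [pend_succ, h.pending_eq]
  · intro i hi
    rw [Function.update_apply]
    split_ifs with hij
    · rw [hij]
    · exact h.choice_eq i (by omega)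
  · intro i hi
    rw [Function.update_apply]
    split_ifs with hij
    · rw [hij, hchosen, Nat.add_sub_cancel, hV e he]
    · rw [hother _ (by decide), h.choiceWt_eq i (by omega)]

theorem HasChoices.congr (h : HasChoices f a b D W J j s)
    (hn : ∀ A ∈ [loser, winner, mergers, pending, choice], s'.nat A = s.nat A)
    (hr : s'.real = s.real) : HasChoices f a b D W J j s' := by
  simp only [List.forall_mem_cons] at hn
  obtain ⟨ha, hb, hf, hp, hc, -⟩ := hn
  exact ⟨ha.trans h.loser_eq, hb.trans h.winner_eq, hf ▸ h.mergers_eq, hr ▸ h.join_eq,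
    hr ▸ h.weight_eq, hr ▸ h.candWt_eq, hp.trans h.pending_eq, hc ▸ h.choice_eq,
    hr ▸ h.choiceWt_eq⟩

theorem HasChoices.halts_chooseCuts (h : HasChoices f a b D W J 0 s) (hm : IsMergeSeq N f a b)
    (hD : IsCandWeight a b D W)
    (hJ : ∀ j < f, D (j + 1) (b j) = D j (a j) + D j (b j) - (J j + J j)) :
    Halts chooseCuts s ((f + 1) * 400) (HasChoices f a b D W J f) := by
  refine (Halts.forTo (B := f) (c := 350) (I := HasChoices f a b D W J) (fun s' hf => ?_) (by rfl)
    (h.congr (by simp +decide) rfl) fun j s' hj _ hround h => Halts.of_loopFree rfl rfl ?_).mono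
    (Nat.mul_le_mul_left _ (Nat.le_of_ble_eq_true rfl)) fun _ h => h
  · exact (congrFun (hf.nat_eq mergers) 0).trans h.mergers_eq
  · exact (h.exec_chooseCut hm hD hround hj (hJ j hj)).congr (by simp +decide) rfl

end ChoiceProg

/-! ### The edges separated by the cheapest cuts -/

section Label

variable {N f j : ℕ} {a b lab : ℕ → ℕ} {P : Finset ℕ}

/-- The `e`-th candidate separates `x` from `y`. -/
def Separates (a b : ℕ → ℕ) (e x y : ℕ) : Prop :=
  ¬ (rep a b (e / 2) x = candRep a b e ↔ rep a b (e / 2) y = candRep a b e)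

/-- The representatives before the `j`-th merger are labelled in such a way that two vertices get
the same label iff no candidate of the later mergers in `P` separates them. A candidate `e` uses the
label `e + 1`. -/
structure IsLabelling (a b : ℕ → ℕ) (P : Finset ℕ) (j : ℕ) (lab : ℕ → ℕ) : Prop where
  eq_zero_or_lt : ∀ r, lab r = 0 ∨ 2 * j < lab r
  eq_iff : ∀ x y, lab (rep a b j x) = lab (rep a b j y) ↔
    ∀ e ∈ P, 2 * j ≤ e → ¬ Separates a b e x y

/-- The labels before a merger, from those after it. -/
def relabel (a b : ℕ → ℕ) (P : Finset ℕ) (j : ℕ) (lab : ℕ → ℕ) : ℕ → ℕ :=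
  Function.update (Function.update lab (a j) (if 2 * j ∈ P then 2 * j + 1 else lab (b j))) (b j)
    (if 2 * j + 1 ∈ P then 2 * j + 2 else lab (b j))

theorem isLabelling_zero (hP : ∀ e ∈ P, e < 2 * j) : IsLabelling a b P j fun _ => 0 where
  eq_zero_or_lt _ := Or.inl rfl
  eq_iff _ _ := ⟨fun _ e he hje => absurd (hP e he) (not_lt.2 hje), fun _ => rfl⟩

theorem forall_two_mul_le_iff {p : ℕ → Prop} : (∀ e ∈ P, 2 * j ≤ e → p e) ↔
    (2 * j ∈ P → p (2 * j)) ∧ (2 * j + 1 ∈ P → p (2 * j + 1)) ∧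
      ∀ e ∈ P, 2 * (j + 1) ≤ e → p e := by
  refine ⟨fun h => ⟨fun he => h _ he le_rfl, fun he => h _ he (by omega),
    fun e he hje => h e he (by omega)⟩, fun ⟨h₀, h₁, h⟩ e he hje => ?_⟩
  obtain rfl | rfl | hje : e = 2 * j ∨ e = 2 * j + 1 ∨ 2 * (j + 1) ≤ e := by omega
  exacts [h₀ he, h₁ he, h e he hje]

theorem IsLabelling.relabel (h : IsLabelling a b P (j + 1) lab) (hne : a j ≠ b j) :
    IsLabelling a b P j (relabel a b P j lab) := by
  have hb := h.eq_zero_or_lt (b j)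
  refine ⟨fun r => ?_, fun x y => ?_⟩
  · have hr := h.eq_zero_or_lt r
    simp only [KCut.relabel, Function.update_apply]
    split_ifs <;> omega
  · have hx := h.eq_zero_or_lt (rep a b j x)
    have hy := h.eq_zero_or_lt (rep a b j y)
    have heven : (2 * j) / 2 = j := by omega
    have hodd : (2 * j + 1) / 2 = j := by omega
    rw [forall_two_mul_le_iff, ← h.eq_iff]
    simp only [Separates, not_not, candRep_two_mul, candRep_two_mul_add_one, heven, hodd, rep,
      KCut.relabel, Function.update_apply]
    grind

end Label

section LabelProg

abbrev input : ℕ := 0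
abbrev output : ℕ := 3
abbrev mark : ℕ := 23
abbrev label : ℕ := 24

variable {N M f p : ℕ} {a b : ℕ → ℕ} {P : Finset ℕ} {s : State}

/-- Marks the cheapest ones of the chosen candidates, so many as the number of mergers exceeds
the number of vertices minus the number of components to be reached. -/
def markCuts : Prog :=
  .forTo round (.var mergers + .get input 2 - .get input 0)
    (.setNat mark (.get choice (.get order (.var round)) - 1) 1)

/-- Labels the representative `r` before the merger `meeting`, if the candidate around its class is
`e`. -/
def labelClass (r e : NExp) : Prog :=
  .ite (.natLe 1 (.get mark e)) (.setNat label r (e + 1))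
    (.setNat label r (.get label (.get winner (.var meeting))))

/-- Labels the vertices by the smallest classes around them whose cuts are marked, from the last
merger to the first. -/
def labelVertices : Prog :=
  .forTo round (.var mergers)
    (.setVar meeting (.var mergers - 1 - .var round) ;;
      labelClass (.get loser (.var meeting)) (.var meeting + .var meeting) ;;
      labelClass (.get winner (.var meeting)) (.var meeting + .var meeting + 1))

/-- Outputs the edges whose ends have different labels. -/
def outputEdges : Prog :=
  .forTo round (.var count)
    (.ite (.and (.natLe (.get label (.get endU (.var round))) (.get label (.get endV (.var round))))
        (.natLe (.get label (.get endV (.var round))) (.get label (.get endU (.var round)))))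
      (.setNat output (.var round) 0) (.setNat output (.var round) 1))

theorem halts_markCuts (hp : s.nat mergers 0 + s.nat input 2 - s.nat input 0 = p)
    (hmark : s.nat mark = fun _ => 0) :
    Halts markCuts s ((p + 1) * 100) (fun s' => ∀ e, 1 ≤ s'.nat mark e ↔
      e ∈ (range p).image fun i => s.nat choice (s.nat order i) - 1) := by
  refine (Halts.forTo (B := p) (c := 20) (I := fun t s' => ∀ e, 1 ≤ s'.nat mark e ↔
    e ∈ (range t).image fun i => s.nat choice (s.nat order i) - 1) (fun s' hf => ?_) (by rfl)
    (by simp +decide [hmark]) fun t s' _ hf hround h => Halts.of_loopFree rfl rfl ?_).mono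
    (Nat.mul_le_mul_left _ (Nat.le_of_ble_eq_true rfl)) fun _ h => h
  · simp only [NExp.eval, NExp.eval_sub, hf.nat_eq mergers, hf.nat_eq input, hp]
  · intro e
    have he := h e
    simp +decide only [Prog.exec, NExp.eval, NExp.eval_sub, State.setNat_nat, hround,
      hf.nat_eq choice, hf.nat_eq order, if_true, if_false, Function.update_apply]
    rw [range_add_one, image_insert, mem_insert, ← he]
    split_ifs with hte
    · simp [hte]
    · simp [hte]

theorem labelClass_exec (r e : NExp) (s : State) : (labelClass r e).exec s =
    s.setNat label (r.eval s) (if 1 ≤ s.nat mark (e.eval s) then e.eval s + 1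
      else s.nat label (s.nat winner (s.nat meeting 0))) := by
  by_cases h : 1 ≤ s.nat mark (e.eval s) <;>
    simp only [labelClass, Prog.exec, BExp.eval, NExp.eval, h, if_true, if_false]

theorem halts_labelVertices (hm : IsMergeSeq N f (s.nat loser) (s.nat winner))
    (hf : s.nat mergers 0 = f) (hmark : ∀ e, 1 ≤ s.nat mark e ↔ e ∈ P) (hP : ∀ e ∈ P, e < 2 * f)
    (hlabel : s.nat label = fun _ => 0) :
    Halts labelVertices s ((f + 1) * 150)
      (fun s' => IsLabelling (s.nat loser) (s.nat winner) P 0 (s'.nat label)) := by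
  refine (Halts.forTo (B := f) (c := 100) (I := fun t s' =>
    IsLabelling (s.nat loser) (s.nat winner) P (f - t) (s'.nat label))
    (fun s' hf' => ?_) (by rfl) ?_ fun t s' ht hf' hround h => Halts.of_loopFree rfl rfl ?_).mono
    (Nat.mul_le_mul_left _ (Nat.le_of_ble_eq_true rfl)) fun s' h => ?_
  · exact (congrFun (hf'.nat_eq mergers) 0).trans hf
  · simpa +decide [hlabel] using isLabelling_zero hP
  · obtain ⟨j, hj⟩ : ∃ j, f - t = j + 1 := ⟨f - t - 1, by omega⟩
    rw [hj] at h
    have hne := hm.ne j (by omega)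
    have hlabel : ((Prog.exec (.setVar meeting (.var mergers - 1 - .var round) ;;
        labelClass (.get loser (.var meeting)) (.var meeting + .var meeting) ;;
        labelClass (.get winner (.var meeting)) (.var meeting + .var meeting + 1)) s').nat
        label) = relabel (s.nat loser) (s.nat winner) P j (s'.nat label) := by
      have hj' : f - 1 - t = j := by omega
      simp +decide only [Prog.exec, labelClass_exec, NExp.eval, NExp.eval_sub,
        State.setNat_nat, hround, hf'.nat_eq mergers, hf'.nat_eq loser,
        hf'.nat_eq winner, hf'.nat_eq mark, hf, hj', hmark, if_true, if_false,
        Function.update_self, ← two_mul, relabel, Function.update_of_ne hne.symm]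
    have hstep := h.relabel hne
    rw [show f - (t + 1) = j by omega]
    simpa +decide only [State.setNat_nat, hlabel, if_false] using hstep
  · simpa using h

theorem halts_outputEdges (hM : s.nat count 0 = M) :
    Halts outputEdges s ((M + 1) * 100) (fun s' => ∀ i < M, s'.nat output i = 1 ↔
      s.nat label (s.nat endU i) ≠ s.nat label (s.nat endV i)) := by
  refine (Halts.forTo (B := M) (c := 50) (I := fun t s' => ∀ i < t, s'.nat output i = 1 ↔
      s.nat label (s.nat endU i) ≠ s.nat label (s.nat endV i))
    (fun s' hf => ?_) (by rfl) (fun _ h => absurd h (Nat.not_lt_zero _))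
    fun t s' _ hf hround h => Halts.of_loopFree rfl rfl ?_).mono
    (Nat.mul_le_mul_left _ (Nat.le_of_ble_eq_true rfl)) fun _ h => h
  · exact (congrFun (hf.nat_eq count) 0).trans hM
  · intro i hi
    have hi' := h i
    simp only [Prog.exec, BExp.eval, NExp.eval, hround, hf.nat_eq label, hf.nat_eq endU,
      hf.nat_eq endV, ← le_antisymm_iff]
    split_ifs with heq <;>
      simp +decide only [State.setNat_nat, if_true, if_false, Function.update_apply] <;> grind

end LabelProg

/-! ### The weight of the cheapest chosen cuts -/

theorem sum_le_sum_mul_of_threshold {ι : Type*} {S T : Finset ι} {t w : ι → ℝ} {θ : ℝ}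
    (hST : S ⊆ T) (hθ : 0 ≤ θ) (hle : ∀ i ∈ S, w i ≤ θ) (hge : ∀ i ∈ T, i ∉ S → θ ≤ w i)
    (ht₀ : ∀ i ∈ T, 0 ≤ t i) (ht₁ : ∀ i ∈ T, t i ≤ 1) (hcard : #S ≤ ∑ i ∈ T, t i) :
    ∑ i ∈ S, w i ≤ ∑ i ∈ T, t i * w i := by
  classical
  have hterm (i : ι) (hi : i ∈ T) :
      (t i - if i ∈ S then 1 else 0) * θ ≤ t i * w i - if i ∈ S then w i else 0 := by
    split_ifs with hiS
    · nlinarith [ht₁ i hi, hle i hiS]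
    · nlinarith [ht₀ i hi, hge i hi hiS]
  have hsum := sum_le_sum hterm
  rw [← sum_mul, sum_sub_distrib, sum_sub_distrib, ← sum_filter, ← sum_filter, filter_mem_eq_inter,
    inter_eq_right.2 hST, sum_const, nsmul_one] at hsum
  nlinarith

theorem IsSorted.image_eq {M : ℕ} {W : ℕ → ℝ} {σ : ℕ → ℕ} (h : IsSorted M W M σ) :
    (range M).image σ = range M := by
  refine eq_of_subset_of_card_le (image_subset_iff.2 fun i hi => ?_) ?_
  · exact mem_range.2 (h.lt i (mem_range.1 hi))
  · rw [card_image_of_injOn fun i hi j hj => h.inj i (mem_range.1 hi) j (mem_range.1 hj)]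

theorem IsSorted.sum_range_le_sum_mul {M p : ℕ} {W t : ℕ → ℝ} {σ : ℕ → ℕ} (h : IsSorted M W M σ)
    (hp : p ≤ M) (hW : ∀ i, 0 ≤ W i) (ht₀ : ∀ i, 0 ≤ t i) (ht₁ : ∀ i, t i ≤ 1)
    (hsum : p ≤ ∑ i ∈ range M, t i) :
    ∑ i ∈ range p, W (σ i) ≤ ∑ i ∈ range M, t i * W i := by
  have hreindex (g : ℕ → ℝ) : ∑ i ∈ range M, g i = ∑ i ∈ range M, g (σ i) := by
    conv_lhs => rw [← h.image_eq]
    exact sum_image fun i hi j hj => h.inj i (mem_range.1 hi) j (mem_range.1 hj)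
  rw [hreindex] at hsum ⊢
  rcases p.eq_zero_or_pos with rfl | hp₀
  · simpa using sum_nonneg fun i _ => mul_nonneg (ht₀ (σ i)) (hW (σ i))
  refine sum_le_sum_mul_of_threshold (θ := W (σ (p - 1))) (range_subset_range.2 hp) (hW _)
    (fun i hi => ?_) (fun i hi hip => ?_) (fun i _ => ht₀ _) (fun i _ => ht₁ _) (by simpa)
  · exact h.mono i _ (Nat.le_sub_one_of_lt (mem_range.1 hi)) (by omega)
  · rw [mem_range] at hi hip
    exact h.mono _ i (by omega) hi

theorem sum_increments_mul_sum_Ico {f : ℕ} {T : ℕ → ℝ} (hT : T 0 = 0) (w : ℕ → ℝ) :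
    ∑ j ∈ range f, (T (j + 1) - T j) * ∑ i ∈ Ico j f, w i = ∑ i ∈ range f, T (i + 1) * w i := by
  simp only [mul_sum, range_eq_Ico]
  rw [sum_Ico_Ico_comm]
  refine sum_congr rfl fun i _ => ?_
  rw [← sum_mul, ← range_eq_Ico, sum_range_sub, hT, sub_zero]

section Weights

variable {m n f : ℕ} {u v a b : ℕ → ℕ} {c x T : ℕ → ℝ}

theorem cutWeight_nonneg (hc : ∀ i < m, 0 ≤ c i) (j r : ℕ) : 0 ≤ cutWeight m u v c a b j r := by
  refine sum_nonneg fun i hi => ?_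
  split_ifs
  exacts [le_rfl, hc i (mem_range.1 hi)]

/-- The weight of the edges between different classes after `j` mergers. -/
def crossWeight (m : ℕ) (u v : ℕ → ℕ) (c : ℕ → ℝ) (a b : ℕ → ℕ) (j : ℕ) : ℝ :=
  ∑ i ∈ range m, if rep a b j (u i) = rep a b j (v i) then 0 else c i

theorem IsMergeSeq.sum_cutWeight (h : IsMergeSeq n f a b) (hu : ∀ i < m, u i < n)
    (hv : ∀ i < m, v i < n) {j : ℕ} (hj : j ≤ f) :
    ∑ r ∈ reps n a b j, cutWeight m u v c a b j r = 2 * crossWeight m u v c a b j := by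
  simp only [cutWeight, crossWeight]
  rw [sum_comm, mul_sum]
  refine sum_congr rfl fun i hi => ?_
  rw [mem_range] at hi
  by_cases he : rep a b j (u i) = rep a b j (v i)
  · simp [he]
  have hsplit (r : ℕ) : (if (rep a b j (u i) = r ↔ rep a b j (v i) = r) then 0 else c i) =
      (if rep a b j (u i) = r then c i else 0) + if rep a b j (v i) = r then c i else 0 := by
    grind
  simp only [hsplit, sum_add_distrib, sum_ite_eq, h.rep_mem_reps hj (hu i hi),
    h.rep_mem_reps hj (hv i hi), if_true, if_neg he, two_mul]

/-- An edge crosses the classes only before the merger by which `T` exceeds its value `x e`, so the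
increments of `T` at which it crosses add up to at most `x e`. -/
theorem IsMergeSeq.sum_increments_mul_crossWeight_le (h : IsMergeSeq n f a b)
    (hc : ∀ e < m, 0 ≤ c e) (hT : ∀ j < f, T j ≤ T (j + 1)) (hT₀ : T 0 = 0)
    (hx : ∀ e < m, ∃ j ≤ f, rep a b j (u e) = rep a b j (v e) ∧ T j ≤ x e) :
    ∑ j ∈ range f, (T (j + 1) - T j) * crossWeight m u v c a b j ≤ ∑ e ∈ range m, c e * x e := by
  simp only [crossWeight, mul_sum]
  rw [sum_comm]
  refine sum_le_sum fun e he => ?_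
  have hce := hc e (mem_range.1 he)
  obtain ⟨l, hl, hrep, hTl⟩ := hx e (mem_range.1 he)
  calc ∑ j ∈ range f, (T (j + 1) - T j) * (if rep a b j (u e) = rep a b j (v e) then 0 else c e)
      ≤ ∑ j ∈ range f, if j < l then (T (j + 1) - T j) * c e else 0 := by
        refine sum_le_sum fun j hj => ?_
        have hjf := mem_range.1 hj
        have hinc := mul_nonneg (sub_nonneg.2 (hT j hjf)) hce
        by_cases hlj : l ≤ j
        · simp [h.rep_eq_of_le hlj hjf.le hrep, hlj.not_gt]
        · rw [if_pos (not_le.1 hlj)]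
          split_ifs <;> linarith
    _ = T l * c e := by
        have hfilter : {j ∈ range f | j < l} = range l := by ext j; simp; omega
        rw [← sum_filter, hfilter, ← sum_mul, sum_range_sub, hT₀, sub_zero]
    _ ≤ c e * x e := by rw [mul_comm]; exact mul_le_mul_of_nonneg_left hTl hce

/-- The weight of the `e`-th candidate. -/
def candWeight (m : ℕ) (u v : ℕ → ℕ) (c : ℕ → ℝ) (a b : ℕ → ℕ) (e : ℕ) : ℝ :=
  cutWeight m u v c a b (e / 2) (candRep a b e)

/-- The candidate chosen at the `j`-th merger, numbered from `0`. -/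
noncomputable def chosenCand (m : ℕ) (u v : ℕ → ℕ) (c : ℕ → ℝ) (a b : ℕ → ℕ) (j : ℕ) : ℕ :=
  chosen (candWeight m u v c a b) a b j - 1

theorem isCandWeight_candWeight (hc : ∀ i < m, 0 ≤ c i) :
    IsCandWeight a b (cutWeight m u v c a b) (candWeight m u v c a b) where
  nonneg := cutWeight_nonneg hc
  succ_of_ne _ _ := cutWeight_succ_of_ne
  eq _ := rfl

/-- The chosen candidates of the mergers from the `j`-th on weigh at most `2 (1 - 1 / n)` times the
edges that cross before the `j`-th merger; this is summed over `j` with the increments of `T`. -/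
theorem IsMergeSeq.sum_mul_weight_chosenCand_le (h : IsMergeSeq n f a b) (hu : ∀ i < m, u i < n)
    (hv : ∀ i < m, v i < n) (hc : ∀ i < m, 0 ≤ c i) (hT : ∀ j < f, T j ≤ T (j + 1)) (hT₀ : T 0 = 0)
    (hx : ∀ e < m, ∃ j ≤ f, rep a b j (u e) = rep a b j (v e) ∧ T j ≤ x e) :
    ∑ j ∈ range f, T (j + 1) * candWeight m u v c a b (chosenCand m u v c a b j) ≤
      2 * (1 - 1 / n) * ∑ e ∈ range m, c e * x e := by
  have hn : (0 : ℝ) ≤ 2 * (1 - 1 / n) := by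
    have := Nat.cast_inv_le_one (α := ℝ) n
    rw [one_div]
    linarith
  rw [← sum_increments_mul_sum_Ico hT₀]
  calc _ ≤ ∑ j ∈ range f, (T (j + 1) - T j) * (2 * (1 - 1 / n) * crossWeight m u v c a b j) := by
        refine sum_le_sum fun j hj => mul_le_mul_of_nonneg_left ?_
          (sub_nonneg.2 (hT j (mem_range.1 hj)))
        have hj := (mem_range.1 hj).le
        rw [mul_comm 2, mul_assoc, ← h.sum_cutWeight hu hv hj]
        exact (isCandWeight_candWeight hc).sum_weight_chosen_le h hj
    _ = 2 * (1 - 1 / n) * ∑ j ∈ range f, (T (j + 1) - T j) * crossWeight m u v c a b j := by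
        rw [mul_sum]
        exact sum_congr rfl fun j _ => by ring
    _ ≤ _ := mul_le_mul_of_nonneg_left (h.sum_increments_mul_crossWeight_le hc hT hT₀ hx) hn

theorem sum_le_sum_candWeight {S I : Finset ℕ} {E : ℕ → ℕ} (hc : ∀ i < m, 0 ≤ c i)
    (hS : ∀ i ∈ S, i < m ∧ ∃ t ∈ I, Separates a b (E t) (u i) (v i)) :
    ∑ i ∈ S, c i ≤ ∑ t ∈ I, candWeight m u v c a b (E t) := by
  simp only [candWeight, cutWeight]
  have hnonneg (i : ℕ) (hi : i < m) (p : Prop) [Decidable p] : 0 ≤ if p then 0 else c i := by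
    split_ifs
    exacts [le_rfl, hc i hi]
  rw [sum_comm]
  calc ∑ i ∈ S, c i ≤ ∑ i ∈ S, ∑ t ∈ I, _ := sum_le_sum fun i hi => by
        obtain ⟨him, t, ht, hsep⟩ := hS i hi
        refine le_trans ?_ (single_le_sum (fun t _ => hnonneg i him _) ht)
        rw [if_neg hsep]
    _ ≤ _ := sum_le_sum_of_subset_of_nonneg (fun i hi => mem_range.2 (hS i hi).1)
        fun i hi _ => sum_nonneg fun t _ => hnonneg i (mem_range.1 hi) _

end Weights

/-! ### Forests and components -/

section Graph

variable {V : Type*}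

theorem eq_of_reachable {α : Type*} {H : SimpleGraph V} {φ : V → α}
    (hφ : ∀ x y, H.Adj x y → φ x = φ y) {x y : V} (h : H.Reachable x y) : φ x = φ y := by
  obtain ⟨p⟩ := h
  induction p with
  | nil => rfl
  | cons hadj _ ih => exact (hφ _ _ hadj).trans ih

theorem card_le_card_connectedComponent_add [Fintype V] (H : SimpleGraph V) (S : Finset (V → ℝ))
    (hS : Submodule.span ℝ ({g : V → ℝ | ∀ y z, H.Adj y z → g y = g z} ∪ S) = ⊤) :
    Fintype.card V ≤ Nat.card H.ConnectedComponent + #S := by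
  classical
  set K := (H.lapMatrix ℝ).toLin'.ker
  have hK : {g : V → ℝ | ∀ y z, H.Adj y z → g y = g z} = K := by
    ext g
    rw [Set.mem_ofPred_eq, ← H.lapMatrix_mulVec_eq_zero_iff_forall_adj]
    rfl
  have hcard := Submodule.finrank_add_le_finrank_add_finrank K (Submodule.span ℝ S)
  rw [← Submodule.span_eq K, ← Submodule.span_union, ← hK, hS, finrank_top, hK,
    Submodule.span_eq, Module.finrank_fintype_fun_eq_card,
    ← H.card_connectedComponent_eq_finrank_ker_toLin'_lapMatrix] at hcard
  have hspan : Module.finrank ℝ (Submodule.span ℝ (S : Set (V → ℝ))) ≤ #S :=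
    finrank_span_finset_le_card S
  rw [Nat.card_eq_fintype_card]
  omega

variable {n k : ℕ} {G : SimpleGraph (Fin n)} {x : G.edgeSet → ℝ} {F : Finset G.edgeSet}

theorem IsForest.subset {F' : Finset G.edgeSet} (hF : IsForest G F) (h : F' ⊆ F) :
    IsForest G F' :=
  SimpleGraph.IsAcyclic.anti (SimpleGraph.fromEdgeSet_mono (Set.image_mono (coe_subset.2 h))) hF

theorem IsFeasible.card_add_sub_le_sum_min (hx : IsFeasible G k x) (hF : IsForest G F) :
    #F + k - n ≤ ∑ e ∈ F, min 1 (x e) := by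
  have hlight := hx.2 _ (hF.subset (filter_subset (fun e => x e < 1) F))
  have hsum : ∑ e ∈ F, min 1 (x e) =
      ∑ e ∈ F with x e < 1, x e + #{e ∈ F | ¬ x e < 1} := by
    rw [← sum_filter_add_sum_filter_not F fun e => x e < 1, cast_card]
    refine congr_arg₂ _ (sum_congr rfl fun e he => ?_) (sum_congr rfl fun e he => ?_)
    · exact min_eq_right (mem_filter.1 he).2.le
    · exact min_eq_left (not_lt.1 (mem_filter.1 he).2)
  have hcard : (#{e ∈ F | x e < 1} : ℝ) + #{e ∈ F | ¬ x e < 1} = #F := by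
    exact_mod_cast card_filter_add_card_filter_not (s := F) fun e => x e < 1
  linarith

end Graph

/-- The edges of the first `j` mergers. -/
def mergerEdges (N : ℕ) (U V acc : ℕ → ℕ) (j : ℕ) : Set (Sym2 (Fin N)) :=
  {e | ∃ i < j, e.map Fin.val = s(U (acc i), V (acc i))}

namespace IsKruskal

variable {N t f : ℕ} {U V acc a b : ℕ → ℕ} (h : IsKruskal N t U V f acc a b)
include h

theorem acc_injOn : Set.InjOn acc (Set.Iio f) := by
  have hmono : StrictMonoOn acc (Set.Iio f) := fun i _ j hj hij => h.acc_lt_acc i j hij hj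
  exact hmono.injOn

theorem le : f ≤ t := by
  have := card_le_card_of_injOn (s := range f) (t := range t) acc
    (fun j hj => mem_coe.2 (mem_range.2 (h.acc_lt j (mem_range.1 hj)))) (by simpa using h.acc_injOn)
  simpa using this

theorem rep_ends_ne {j : ℕ} (hj : j < f) :
    rep a b j (U (acc j)) ≠ rep a b j (V (acc j)) := by
  have hne := h.merge.ne j hj
  rcases Sym2.eq_iff.1 (h.ends j hj) with ⟨hU, hV⟩ | ⟨hU, hV⟩ <;> grind

theorem rep_ends_eq {i j : ℕ} (hij : i < j) (hj : j ≤ f) :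
    rep a b j (U (acc i)) = rep a b j (V (acc i)) := by
  refine h.merge.rep_eq_of_le hij hj ?_
  rcases Sym2.eq_iff.1 (h.ends i (by omega)) with ⟨hU, hV⟩ | ⟨hU, hV⟩ <;> simp [rep, hU, hV]

theorem rep_final_eq {i : ℕ} (hi : i < t) : rep a b f (U i) = rep a b f (V i) := by
  obtain ⟨j, hj, hrep, -⟩ := h.span i hi
  exact h.merge.rep_eq_of_le hj le_rfl hrep

theorem isAcyclic_mergerEdges (hU : ∀ i < t, U i < N) (hV : ∀ i < t, V i < N) {j : ℕ} (hj : j ≤ f) :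
    (SimpleGraph.fromEdgeSet (mergerEdges N U V acc j)).IsAcyclic := by
  induction j with
  | zero => simp [mergerEdges]
  | succ j ih =>
    obtain ⟨p, hp⟩ : ∃ p : Fin N, p = U (acc j) := ⟨⟨_, hU _ (h.acc_lt j hj)⟩, rfl⟩
    obtain ⟨q, hq⟩ : ∃ q : Fin N, q = V (acc j) := ⟨⟨_, hV _ (h.acc_lt j hj)⟩, rfl⟩
    have hlast (e : Sym2 (Fin N)) : e.map Fin.val = s(U (acc j), V (acc j)) ↔ e = s(p, q) := by
      rw [← hp, ← hq, ← Sym2.map_mk]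
      exact (Sym2.map.injective Fin.val_injective).eq_iff
    have hsucc : mergerEdges N U V acc (j + 1) = mergerEdges N U V acc j ∪ {s(p, q)} := by
      ext e
      simp only [mergerEdges, Nat.lt_succ_iff_lt_or_eq, or_and_right, exists_or, exists_eq_left,
        hlast, Set.mem_ofPred_eq, Set.mem_union, Set.mem_singleton_iff]
    rw [hsucc, SimpleGraph.fromEdgeSet_union]
    refine SimpleGraph.IsAcyclic.sup_edge_of_not_reachable (fun hpq => ?_) (ih (by omega))
    have hrep := eq_of_reachable (φ := fun w : Fin N => rep a b j w) (fun y z hyz => ?_) hpq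
    · exact h.rep_ends_ne hj (by rwa [← hp, ← hq])
    · obtain ⟨i, hi, he⟩ := (SimpleGraph.fromEdgeSet_adj _).1 hyz |>.1
      have hends := h.rep_ends_eq hi (by omega)
      rcases Sym2.eq_iff.1 he with ⟨hy, hz⟩ | ⟨hy, hz⟩
      · rwa [hy, hz]
      · rw [hy, hz, hends]

end IsKruskal

theorem IsKruskal.rep_eq_of_isSorted {N t f i : ℕ} {u v σ acc a b : ℕ → ℕ} {x : ℕ → ℝ}
    (h : IsKruskal N t (fun i => u (σ i)) (fun i => v (σ i)) f acc a b) (hσ : IsSorted t x t σ)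
    (hi : i < t) : rep a b f (u i) = rep a b f (v i) := by
  obtain ⟨j, hj, rfl⟩ := mem_image.1 (hσ.image_eq ▸ mem_range.2 hi)
  exact h.rep_final_eq (mem_range.1 hj)

/-! ### The rounded solution -/

/-- The values of the tree edges in the order of the mergers, truncated at `1` and preceded by `0`.
Its increments are the multiplicities with which the partitions between mergers are counted. -/
noncomputable def truncation (y : ℕ → ℝ) : ℕ → ℝ
  | 0 => 0
  | j + 1 => min 1 (y j)

/-- The data computed by the algorithm from the arrays `u`, `v` of edge ends, the capacities `c`
and the fractional solution `x`: the edges sorted by `x` in the order `σ`, the `f` mergers of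
Kruskal's algorithm in this order, and the chosen candidates sorted by weight in the order `ρ`. -/
structure IsRounding (n m : ℕ) (u v : ℕ → ℕ) (c x : ℕ → ℝ) (f : ℕ) (σ acc a b ρ : ℕ → ℕ) :
    Prop where
  sorted : IsSorted m x m σ
  kruskal : IsKruskal n m (fun i => u (σ i)) (fun i => v (σ i)) f acc a b
  sorted_chosen :
    IsSorted f (fun j => candWeight m u v c a b (chosenCand m u v c a b j)) f ρ

namespace IsRounding

variable {n m f p : ℕ} {u v σ acc a b ρ : ℕ → ℕ} {c x : ℕ → ℝ}
  (h : IsRounding n m u v c x f σ acc a b ρ)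
include h

theorem sum_candWeight_le (hu : ∀ i < m, u i < n) (hv : ∀ i < m, v i < n) (hc : ∀ i < m, 0 ≤ c i)
    (hx : ∀ i, 0 ≤ x i) (hp : p ≤ f) (hpx : p ≤ ∑ j ∈ range f, min 1 (x (σ (acc j)))) :
    ∑ t ∈ range p, candWeight m u v c a b (chosenCand m u v c a b (ρ t)) ≤
      2 * (1 - 1 / n) * ∑ i ∈ range m, c i * x i := by
  set y := fun j => x (σ (acc j))
  refine (h.sorted_chosen.sum_range_le_sum_mul hp (fun j => cutWeight_nonneg hc _ _)
    (fun j => le_min zero_le_one (hx _)) (fun j => min_le_left _ _) hpx).trans ?_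
  refine h.kruskal.merge.sum_mul_weight_chosenCand_le (T := truncation y) hu hv hc ?_ rfl ?_
  · rintro (_ | j) hj
    · exact le_min zero_le_one (hx _)
    · have hacc := h.kruskal.acc_lt_acc j (j + 1) j.lt_succ_self hj
      exact min_le_min le_rfl (h.sorted.mono _ _ hacc.le (h.kruskal.acc_lt _ hj))
  · intro e he
    obtain ⟨i, hi, rfl⟩ := mem_image.1 (h.sorted.image_eq ▸ mem_range.2 he)
    obtain ⟨j, hj, hrep, hle⟩ := h.kruskal.span i (mem_range.1 hi)
    refine ⟨j, hj, hrep, ?_⟩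
    rcases j with _ | j
    · exact hx _
    · exact (min_le_right _ _).trans
        (h.sorted.mono _ _ (hle j j.lt_succ_self) (mem_range.1 hi))

theorem add_le_card_connectedComponent_add (hp : p ≤ f) {H : SimpleGraph (Fin n)}
    (hH : ∀ y z : Fin n, H.Adj y z → ∃ i < m, s(↑y, ↑z) = s(u i, v i) ∧
      ∀ t < p, ¬ Separates a b (chosenCand m u v c a b (ρ t)) (u i) (v i)) :
    n + p ≤ Nat.card H.ConnectedComponent + f := by
  classical
  let S := (Ico p f).image fun t => candVec n a b (chosenCand m u v c a b (ρ t))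
  have hcard : #S ≤ f - p := card_image_le.trans_eq (Nat.card_Ico p f)
  suffices hspan : Submodule.span ℝ ({g : Fin n → ℝ | ∀ y z, H.Adj y z → g y = g z} ∪ S) = ⊤ by
    have := card_le_card_connectedComponent_add H S hspan
    rw [Fintype.card_fin] at this
    omega
  refine h.kruskal.merge.eq_top_of_chosen_mem (W := candWeight m u v c a b) (fun j hj => ?_)
    fun r _ => ?_
  · obtain ⟨t, ht, rfl⟩ := mem_image.1 (h.sorted_chosen.image_eq ▸ mem_range.2 hj)
    rw [mem_range] at ht
    refine Submodule.subset_span ?_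
    rcases lt_or_ge t p with htp | htp
    · refine Or.inl fun y z hyz => ?_
      obtain ⟨i, -, he, hsep⟩ := hH y z hyz
      have hiff := not_not.1 (hsep t htp)
      change (if _ then _ else _) = ite _ _ _
      rcases Sym2.eq_iff.1 he with ⟨hy, hz⟩ | ⟨hy, hz⟩
      · exact if_congr (by rw [hy, hz]; exact hiff) rfl rfl
      · exact if_congr (by rw [hy, hz]; exact hiff.symm) rfl rfl
    · exact Or.inr (mem_image_of_mem _ (mem_Ico.2 ⟨htp, ht⟩))
  · refine Submodule.subset_span (Or.inl fun y z hyz => ?_)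
    obtain ⟨i, hi, he, -⟩ := hH y z hyz
    have hrep := h.kruskal.rep_eq_of_isSorted h.sorted hi
    rcases Sym2.eq_iff.1 he with ⟨hy, hz⟩ | ⟨hy, hz⟩ <;> simp only [classVec, hy, hz, hrep]

end IsRounding

section Edges

variable {n m k f : ℕ} {G : SimpleGraph (Fin n)} {c x : G.edgeSet → ℝ} {ε : Fin m ≃ G.edgeSet}
  {u v : Fin m → Fin n} {C : Finset G.edgeSet} {w : ℕ → ℝ} {σ acc a b ρ : ℕ → ℕ}

theorem toArray_apply {α : Type*} [Zero α] (y : Fin m → α) (i : Fin m) : toArray y i = y i := by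
  simp [toArray]

theorem toArray_of_lt {α : Type*} [Zero α] (y : Fin m → α) {i : ℕ} (hi : i < m) :
    toArray y i = y ⟨i, hi⟩ := by
  simp [toArray, hi]

theorem toArray_nonneg {y : Fin m → ℝ} (hy : ∀ i, 0 ≤ y i) (i : ℕ) : 0 ≤ toArray y i := by
  unfold toArray
  split_ifs
  exacts [hy _, le_rfl]

theorem toArray_val_lt (u : Fin m → Fin n) {i : ℕ} (hi : i < m) :
    toArray (fun i => (u i : ℕ)) i < n := by
  rw [toArray_of_lt _ hi]
  exact (u _).2

theorem IsFeasible.le (hx : IsFeasible G k x) : k ≤ n := by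
  have h := hx.2 ∅ (by simp [IsForest])
  simp only [card_empty, CharP.cast_eq_zero, zero_add, sum_empty, tsub_le_iff_right] at h
  exact_mod_cast h

theorem IsFeasible.add_sub_le_sum_min (hx : IsFeasible G k x)
    (hε : ∀ i, (ε i : Sym2 (Fin n)) = s(u i, v i))
    (h : IsRounding n m (toArray fun i => (u i : ℕ)) (toArray fun i => (v i : ℕ)) w
      (toArray fun i => x (ε i)) f σ acc a b ρ) :
    f + k - n ≤ ∑ j ∈ range f, min 1 (toArray (fun i => x (ε i)) (σ (acc j))) := by
  have hacc (j : Fin f) : acc j < m := h.kruskal.acc_lt j j.2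
  have hσ (j : Fin f) : σ (acc j) < m := h.sorted.lt _ (hacc j)
  let τ (j : Fin f) : Fin m := ⟨σ (acc j), hσ j⟩
  have hτ : Function.Injective τ := fun i j hij =>
    Fin.ext (h.kruskal.acc_injOn i.2 j.2 (h.sorted.inj _ (hacc i) _ (hacc j) (Fin.ext_iff.1 hij)))
  have hforest : IsForest G (univ.map ⟨ε ∘ τ, ε.injective.comp hτ⟩) := by
    refine SimpleGraph.IsAcyclic.anti (SimpleGraph.fromEdgeSet_mono ?_)
      (h.kruskal.isAcyclic_mergerEdges (fun i hi => toArray_val_lt u (h.sorted.lt i hi))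
        (fun i hi => toArray_val_lt v (h.sorted.lt i hi)) le_rfl)
    rintro _ ⟨_, he, rfl⟩
    obtain ⟨j, -, rfl⟩ := mem_map.1 (mem_coe.1 he)
    refine ⟨j, j.2, ?_⟩
    simp only [toArray_of_lt _ (hσ j)]
    exact congr_arg (Sym2.map Fin.val) (hε (τ j))
  have hsum := hx.card_add_sub_le_sum_min hforest
  rw [card_map, card_univ, Fintype.card_fin, sum_map] at hsum
  rw [sum_range]
  refine hsum.trans_eq (sum_congr rfl fun j _ => ?_)
  rw [toArray_of_lt _ (hσ j)]
  rfl

section Rounded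

variable (hε : ∀ i, (ε i : Sym2 (Fin n)) = s(u i, v i)) (hx : IsFeasible G k x)
  (h : IsRounding n m (toArray fun i => (u i : ℕ)) (toArray fun i => (v i : ℕ))
    (toArray fun i => c (ε i)) (toArray fun i => x (ε i)) f σ acc a b ρ)
  (hC : ∀ i, ε i ∈ C ↔ ∃ t < f + k - n, Separates a b
    (chosenCand m (toArray fun i => (u i : ℕ)) (toArray fun i => (v i : ℕ))
      (toArray fun i => c (ε i)) a b (ρ t)) (u i) (v i))
include hε hx h hC

theorem isKCut_of_isRounding : IsKCut G k C := by
  have hp : f + k - n ≤ f := by have := hx.le; omega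
  have hcard := h.add_le_card_connectedComponent_add hp (H := G.deleteEdges
    ((fun e : G.edgeSet => (e : Sym2 (Fin n))) '' (C : Set G.edgeSet))) fun y z hyz => by
      obtain ⟨hadj, hnotMem⟩ := SimpleGraph.deleteEdges_adj.1 hyz
      obtain ⟨i, hi⟩ := ε.surjective ⟨s(y, z), hadj⟩
      have hends : s(u i, v i) = s(y, z) := by rw [← hε, hi]
      have hiC : ε i ∉ C := fun hiC => hnotMem ⟨ε i, hiC, by rw [hi]⟩
      rw [hC] at hiC
      push Not at hiC
      refine ⟨i, i.2, ?_, ?_⟩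
      · rw [toArray_apply, toArray_apply]
        exact (congr_arg (Sym2.map Fin.val) hends).symm
      · simpa only [toArray_apply] using hiC
  unfold IsKCut
  omega

theorem sum_cost_le_of_isRounding [Fintype G.edgeSet] (hc : ∀ e, 0 ≤ c e) :
    ∑ e ∈ C, c e ≤ 2 * (1 - 1 / (n : ℝ)) * ∑ e, c e * x e := by
  have hc' := toArray_nonneg fun i => hc (ε i)
  have hx' := toArray_nonneg fun i => hx.1 (ε i)
  have hp : f + k - n ≤ f := by have := hx.le; omega
  have hpx : ((f + k - n : ℕ) : ℝ) ≤
      ∑ j ∈ range f, min 1 (toArray (fun i => x (ε i)) (σ (acc j))) := by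
    rcases le_total n (f + k) with hnf | hnf
    · rw [Nat.cast_sub hnf, Nat.cast_add]
      exact hx.add_sub_le_sum_min hε h
    · rw [Nat.sub_eq_zero_of_le hnf, Nat.cast_zero]
      exact sum_nonneg fun j _ => le_min zero_le_one (hx' _)
  let S := (C.map ε.symm.toEmbedding).map Fin.valEmbedding
  calc ∑ e ∈ C, c e = ∑ i ∈ S, toArray (fun i => c (ε i)) i := by
        simp only [S, sum_map, Fin.valEmbedding_apply, toArray_apply, Equiv.coe_toEmbedding,
          Equiv.apply_symm_apply]
    _ ≤ _ := sum_le_sum_candWeight (I := range (f + k - n)) (fun i _ => hc' i) fun i hi => by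
        obtain ⟨_, hiC, rfl⟩ := mem_map.1 hi
        obtain ⟨e, he, rfl⟩ := mem_map.1 hiC
        obtain ⟨t, ht, hsep⟩ := (hC (ε.symm e)).1 (by rwa [ε.apply_symm_apply])
        refine ⟨(ε.symm e).2, t, mem_range.2 ht, ?_⟩
        simpa only [Fin.valEmbedding_apply, Equiv.coe_toEmbedding, toArray_apply] using hsep
    _ ≤ _ := h.sum_candWeight_le (fun _ => toArray_val_lt u) (fun _ => toArray_val_lt v)
        (fun i _ => hc' i) hx' hp hpx
    _ = 2 * (1 - 1 / (n : ℝ)) * ∑ e, c e * x e := by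
        rw [sum_range, ← ε.sum_comp]
        simp only [toArray_apply]

end Rounded

end Edges

section Assembly

abbrev frac : ℕ := 1

/-- Sort the edges by their fractional values and merge their ends in this order. -/
def mergeEdges : Prog :=
  .setVar count (.get input 1) ;; sortBy frac ;; kruskal

/-- Merge the ends of the edges, then weigh and choose the candidates. -/
def buildCuts : Prog :=
  mergeEdges ;; addWeights ;; chooseCuts

/-- Mark the cheapest of the chosen candidates, as many as are needed for a `k`-cut. -/
def markCheapest : Prog :=
  .setVar count (.var mergers) ;; sortBy choiceWt ;; markCuts

/-- Output the edges that are cut by the marked candidates. -/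
def outputCuts : Prog :=
  labelVertices ;; .setVar count (.get input 1) ;; outputEdges

/-- The rounding algorithm. -/
def roundingProg : Prog :=
  buildCuts ;; markCheapest ;; outputCuts

/-- The memory describes `n` vertices, `m` edges with distinct ends and nonnegative capacities, and
a number `k`, and everything that is not part of the input is zero. -/
structure IsInput (n m k : ℕ) (s : State) : Prop where
  num_vertices : s.nat input 0 = n
  num_edges : s.nat input 1 = m
  num_parts : s.nat input 2 = k
  endU_lt : ∀ i < m, s.nat endU i < n
  endV_lt : ∀ i < m, s.nat endV i < n
  ends_ne : ∀ i < m, s.nat endU i ≠ s.nat endV i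
  cap_nonneg : ∀ i < m, 0 ≤ s.real cap i
  nat_eq_zero : ∀ a ∉ [input, endU, endV], s.nat a = fun _ => 0
  real_eq_zero : ∀ a ∉ [cap, frac], s.real a = fun _ => 0

variable {n m l f k p : ℕ} {a b : ℕ → ℕ} {D : ℕ → ℕ → ℝ} {W J : ℕ → ℝ} {s : State}

theorem IsInput.halts_mergeEdges (h : IsInput n m k s) (hml : 2 * m ≤ 2 ^ l)
    (hnl : 0 < m → n ≤ 2 ^ l) :
    Halts mergeEdges s ((m + 1) * ((l + 1) * 810)) (fun s' =>
      s'.nat count 0 = m ∧ IsSorted m (s.real frac) m (s'.nat order) ∧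
        ∃ acc, HasKruskal n m acc s') := by
  have hset : Halts (.setVar count (.get input 1)) s 10 (fun s' => s'.nat count 0 = m) :=
    Halts.of_loopFree rfl rfl (by simp [h.num_edges])
  refine (hset.seq (t' := (m + 1) * ((l + 1) * 500) + (m + 1) * ((l + 1) * 300))
    fun s₁ hf₁ hcount₁ => ?_).mono (by nlinarith) fun _ h => h
  refine (halts_sortBy (W := frac) hml hcount₁).seq fun s₂ hf₂ hsorted => ?_
  rw [hf₁.real_eq frac] at hsorted
  have hcount₂ : s₂.nat count 0 = m := by rw [hf₂.nat_eq count, hcount₁]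
  have hzero (a : ℕ) (ha : a ∈ [mergers, linkTo, rankOf]) : s₂.nat a = fun _ => 0 := by
    rw [hf₂.nat a (by revert ha a; decide), hf₁.nat a (by revert ha a; decide)]
    exact h.nat_eq_zero a (by revert ha a; decide)
  simp only [List.forall_mem_cons] at hzero
  obtain ⟨hmergers, hlink, hrank, -⟩ := hzero
  refine ((halts_kruskal hnl hcount₂ (fun i hi => ?_) (fun i hi => ?_)
    (HasKruskal.zero (acc := id) (by rw [hmergers]) (congrFun hlink) (congrFun hrank))).frame.mono
    le_rfl fun s₃ ⟨hK, hf₃⟩ => ?_)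
  · rw [hf₂.nat_eq endU, hf₁.nat_eq endU]
    exact h.endU_lt _ (hsorted.lt i hi)
  · rw [hf₂.nat_eq endV, hf₁.nat_eq endV]
    exact h.endV_lt _ (hsorted.lt i hi)
  · exact ⟨by rw [hf₃.nat_eq count, hcount₂], by rwa [hf₃.nat_eq order], hK⟩

theorem HasWeights.hasChoices_zero (h : HasWeights m s) (hpending : s.nat pending = fun _ => 0) :
    HasChoices (s.nat mergers 0) (s.nat loser) (s.nat winner)
      (cutWeight m (s.nat endU) (s.nat endV) (s.real cap) (s.nat loser) (s.nat winner)) W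
      (joinWeight m (s.nat endU) (s.nat endV) (s.real cap) (s.nat loser) (s.nat winner)) 0 s where
  loser_eq := rfl
  winner_eq := rfl
  mergers_eq := rfl
  join_eq := h.join_eq
  weight_eq r _ := congrFun h.weight_eq r
  candWt_eq e he := absurd he e.not_lt_zero
  pending_eq := hpending
  choice_eq i hi := absurd hi i.not_lt_zero
  choiceWt_eq i hi := absurd hi i.not_lt_zero

/-- The memory after the first phase of the algorithm, for a graph stored in memory `s₀`. -/
def HasCuts (n m : ℕ) (s₀ : State) (f : ℕ) (σ acc a b : ℕ → ℕ) (s : State) : Prop :=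
  IsSorted m (s₀.real frac) m σ ∧
    IsKruskal n m (fun i => s₀.nat endU (σ i)) (fun i => s₀.nat endV (σ i)) f acc a b ∧
    HasChoices f a b (cutWeight m (s₀.nat endU) (s₀.nat endV) (s₀.real cap) a b)
      (candWeight m (s₀.nat endU) (s₀.nat endV) (s₀.real cap) a b)
      (joinWeight m (s₀.nat endU) (s₀.nat endV) (s₀.real cap) a b) f s

theorem IsInput.halts_buildCuts (h : IsInput n m k s) (hml : 2 * m ≤ 2 ^ l)
    (hnl : 0 < m → n ≤ 2 ^ l) :
    Halts buildCuts s ((m + 1) * ((l + 1) * 1700)) (fun s' =>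
      ∃ f σ acc a b, HasCuts n m s f σ acc a b s') := by
  refine ((h.halts_mergeEdges hml hnl).seq (t' := (m + 1) * ((l + 1) * 400) + (m + 1) * 400)
    fun s₁ hf₁ ⟨hcount₁, hsorted, acc, hK₁⟩ => ?_).mono (by nlinarith) fun _ h => h
  have hK := hK₁.kruskal
  have hle := hK.le
  have hrep {i : ℕ} (hi : i < m) := hK.rep_eq_of_isSorted hsorted hi
  have hU₁ := hf₁.nat_eq endU
  have hV₁ := hf₁.nat_eq endV
  have hw₁ : HasWeights 0 s₁ := by
    constructor
    · rw [hf₁.real_eq weight, h.real_eq_zero weight (by decide)]; rfl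
    · intro j _
      rw [hf₁.real_eq join, h.real_eq_zero join (by decide)]; rfl
  refine (halts_addWeights hnl hcount₁ hK₁.toHasForest (hU₁ ▸ h.endU_lt) (hV₁ ▸ h.endV_lt)
    (hU₁ ▸ hV₁ ▸ h.ends_ne) (fun i hi => hrep hi) hw₁).seq fun s₂ hf₂ hw₂ => ?_
  have hchoices := hw₂.hasChoices_zero
    (W := candWeight m (s.nat endU) (s.nat endV) (s.real cap) (s₁.nat loser) (s₁.nat winner))
    (by rw [hf₂.nat_eq pending, hf₁.nat_eq pending, h.nat_eq_zero pending (by decide)])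
  rw [hf₂.nat_eq endU, hf₂.nat_eq endV, hf₂.real_eq cap, hf₁.real_eq cap, hU₁, hV₁,
    hf₂.nat_eq loser, hf₂.nat_eq winner, hf₂.nat_eq mergers] at hchoices
  rw [hU₁, hV₁] at hK
  refine (hchoices.halts_chooseCuts hK.merge (isCandWeight_candWeight h.cap_nonneg)
    fun j hj => hK.merge.cutWeight_succ_b hj).mono
    (Nat.mul_le_mul_right _ (Nat.succ_le_succ hle)) fun s₃ h₃ => ⟨_, _, _, _, _, hsorted, hK, h₃⟩

theorem IsSorted.congr {M t : ℕ} {W W' : ℕ → ℝ} {σ : ℕ → ℕ} (h : IsSorted M W t σ)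
    (hW : ∀ e < M, W e = W' e) : IsSorted M W' t σ where
  lt := h.lt
  inj := h.inj
  mono i j hij hj := by
    rw [← hW _ (h.lt i (hij.trans_lt hj)), ← hW _ (h.lt j hj)]
    exact h.mono i j hij hj
  le_rest i hi e he hrest := by
    rw [← hW _ (h.lt i hi), ← hW e he]
    exact h.le_rest i hi e he hrest

theorem IsLabelling.ne_iff {P : Finset ℕ} {lab : ℕ → ℕ} (h : IsLabelling a b P 0 lab) (x y : ℕ) :
    lab x ≠ lab y ↔ ∃ e ∈ P, Separates a b e x y := by
  have h := h.eq_iff x y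
  simp only [mul_zero, zero_le, forall_const] at h
  simp only [Ne, show lab x = lab y ↔ _ from h, not_forall, not_not, exists_prop]

theorem HasChoices.halts_markCheapest (h : HasChoices f a b D W J f s) (hfl : 2 * f ≤ 2 ^ l)
    (hp : f + s.nat input 2 - s.nat input 0 = p) (hpf : p ≤ f) (hmark : s.nat mark = fun _ => 0) :
    Halts markCheapest s ((f + 1) * ((l + 1) * 610)) (fun s' =>
      ∃ ρ, IsSorted f (fun j => W (chosen W a b j - 1)) f ρ ∧
        ∀ e, 1 ≤ s'.nat mark e ↔ e ∈ (range p).image fun t => chosen W a b (ρ t) - 1) := by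
  have hset : Halts (.setVar count (.var mergers)) s 10 (fun s' => s'.nat count 0 = f) :=
    Halts.of_loopFree rfl rfl (by simp [h.mergers_eq])
  refine (hset.seq (t' := (f + 1) * ((l + 1) * 500) + (p + 1) * 100)
    fun s₁ hf₁ hcount₁ => ?_).mono (by nlinarith) fun _ h => h
  refine (halts_sortBy (W := choiceWt) hfl hcount₁).seq fun s₂ hf₂ hsorted => ?_
  have hρ : IsSorted f (fun j => W (chosen W a b j - 1)) f (s₂.nat order) :=
    hsorted.congr fun j hj => by rw [hf₁.real_eq choiceWt, h.choiceWt_eq j hj]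
  refine (halts_markCuts (p := p) ?_ ?_).mono le_rfl fun s₃ hmark₃ => ⟨_, hρ, fun e => ?_⟩
  · rw [hf₂.nat_eq mergers, hf₂.nat_eq input, hf₁.nat_eq mergers, hf₁.nat_eq input, h.mergers_eq,
      hp]
  · rw [hf₂.nat_eq mark, hf₁.nat_eq mark, hmark]
  · have himage : Set.EqOn (fun t => s₂.nat choice (s₂.nat order t) - 1)
        (fun t => chosen W a b (s₂.nat order t) - 1) (range p) := fun t ht => by
      dsimp only
      rw [hf₂.nat_eq choice, hf₁.nat_eq choice,
        h.choice_eq _ (hρ.lt t ((mem_range.1 (mem_coe.1 ht)).trans_le hpf))]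
    rw [hmark₃, image_congr himage]

theorem halts_outputCuts {P : Finset ℕ} (hm : IsMergeSeq n f (s.nat loser) (s.nat winner))
    (hf : s.nat mergers 0 = f) (hmark : ∀ e, 1 ≤ s.nat mark e ↔ e ∈ P) (hP : ∀ e ∈ P, e < 2 * f)
    (hlabel : s.nat label = fun _ => 0) :
    Halts outputCuts s ((f + 1) * 150 + (s.nat input 1 + 1) * 110) (fun s' =>
      ∀ i < s.nat input 1, s'.nat output i = 1 ↔
        ∃ e ∈ P, Separates (s.nat loser) (s.nat winner) e (s.nat endU i) (s.nat endV i)) := by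
  refine (halts_labelVertices hm hf hmark hP hlabel).seq fun s₁ hf₁ hlab => ?_
  have hset : Halts (.setVar count (.get input 1)) s₁ 10 (fun s' =>
      s'.nat count 0 = s.nat input 1) :=
    Halts.of_loopFree rfl rfl (by simp [hf₁.nat_eq input])
  refine (hset.seq fun s₂ hf₂ hcount₂ => (halts_outputEdges hcount₂).mono le_rfl
    fun s₃ hout i hi => ?_).mono (t := 10 + (s.nat input 1 + 1) * 100) (by omega) fun _ h => h
  rw [hout i hi, hf₂.nat_eq label, hlab.ne_iff, hf₂.nat_eq endU, hf₂.nat_eq endV, hf₁.nat_eq endU,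
    hf₁.nat_eq endV]

theorem IsInput.halts_roundingProg (h : IsInput n m k s) (hk : k ≤ n) (hml : 2 * m ≤ 2 ^ l)
    (hnl : 0 < m → n ≤ 2 ^ l) :
    Halts roundingProg s ((m + 1) * ((l + 1) * 2570)) (fun s' => ∃ f σ acc a b ρ,
      IsRounding n m (s.nat endU) (s.nat endV) (s.real cap) (s.real frac) f σ acc a b ρ ∧
        ∀ i < m, s'.nat output i = 1 ↔ ∃ t < f + k - n,
          Separates a b (chosenCand m (s.nat endU) (s.nat endV) (s.real cap) a b (ρ t))
            (s.nat endU i) (s.nat endV i)) := by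
  refine ((h.halts_buildCuts hml hnl).seq
    (t' := (m + 1) * ((l + 1) * 610) + ((m + 1) * 150 + (m + 1) * 110))
    fun s₁ hf₁ ⟨f, σ, acc, a, b, hσ, hK, h₁⟩ => ?_).mono (by nlinarith) fun _ h => h
  have hfm : f ≤ m := hK.le
  have hinput₁ := hf₁.nat_eq input
  refine ((h₁.halts_markCheapest (p := f + k - n) (by omega)
    (by rw [hinput₁, h.num_vertices, h.num_parts]) (by omega)
    (by rw [hf₁.nat_eq mark, h.nat_eq_zero mark (by decide)])).mono
    (Nat.mul_le_mul_right _ (Nat.succ_le_succ hfm)) fun _ h => h).seq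
    fun s₂ hf₂ ⟨ρ, hρ, hmark⟩ => ?_
  have ha : s₂.nat loser = a := by rw [hf₂.nat_eq loser, h₁.loser_eq]
  have hb : s₂.nat winner = b := by rw [hf₂.nat_eq winner, h₁.winner_eq]
  have hm : s₂.nat input 1 = m := by rw [hf₂.nat_eq input, hinput₁, h.num_edges]
  refine (halts_outputCuts (n := n) (f := f) (by rw [ha, hb]; exact hK.merge)
    (by rw [hf₂.nat_eq mergers, h₁.mergers_eq]) hmark (fun e he => ?_)
    (by rw [hf₂.nat_eq label, hf₁.nat_eq label, h.nat_eq_zero label (by decide)])).mono ?_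
    fun s₃ hout => ⟨f, σ, acc, a, b, ρ, ⟨hσ, hK, hρ⟩, fun i hi => ?_⟩
  · obtain ⟨t, ht, rfl⟩ := mem_image.1 he
    have := hρ.lt t ((mem_range.1 ht).trans_le (by omega))
    obtain ⟨e, he, hchosen⟩ := exists_chosen
      (candWeight m (s.nat endU) (s.nat endV) (s.real cap) a b) a b (ρ t)
    omega
  · rw [hm]
    exact Nat.add_le_add_right (Nat.mul_le_mul_right _ (Nat.succ_le_succ hfm)) _
  · rw [hout i (hi.trans_eq hm.symm), ha, hb, hf₂.nat_eq endU, hf₁.nat_eq endU, hf₂.nat_eq endV,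
      hf₁.nat_eq endV]
    simp only [mem_image, mem_range, exists_exists_and_eq_and, chosenCand]

end Assembly

section Input

variable {n m k : ℕ} {G : SimpleGraph (Fin n)} {ε : Fin m ≃ G.edgeSet} {u v : Fin m → Fin n}

theorem ends_ne (hε : ∀ i, (ε i : Sym2 (Fin n)) = s(u i, v i)) (i : Fin m) : u i ≠ v i := by
  have hadj : G.Adj (u i) (v i) := by
    rw [← SimpleGraph.mem_edgeSet, ← hε i]
    exact (ε i).2
  exact hadj.ne

theorem card_edges_le (hε : ∀ i, (ε i : Sym2 (Fin n)) = s(u i, v i)) : m ≤ n * n := by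
  have hinj : Function.Injective fun i : Fin m => (u i, v i) := fun i j hij => by
    obtain ⟨hu, hv⟩ := Prod.mk.injEq .. ▸ hij
    exact ε.injective (Subtype.ext (by rw [hε, hε, hu, hv]))
  simpa using Fintype.card_le_of_injective _ hinj

theorem two_le_of_edge (hε : ∀ i, (ε i : Sym2 (Fin n)) = s(u i, v i)) (hm : 0 < m) : 2 ≤ n := by
  have hne := Fin.val_ne_of_ne (ends_ne hε ⟨0, hm⟩)
  omega

theorem isInput_inputState (hε : ∀ i, (ε i : Sym2 (Fin n)) = s(u i, v i)) {c x : Fin m → ℝ}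
    (hc : ∀ i, 0 ≤ c i) : IsInput n m k (inputState k u v c x) where
  num_vertices := rfl
  num_edges := rfl
  num_parts := rfl
  endU_lt _ := toArray_val_lt u
  endV_lt _ := toArray_val_lt v
  ends_ne i hi := by
    change toArray (fun i => (u i : ℕ)) i ≠ toArray (fun i => (v i : ℕ)) i
    rw [toArray_of_lt _ hi, toArray_of_lt _ hi]
    exact Fin.val_ne_of_ne (ends_ne hε _)
  cap_nonneg i _ := toArray_nonneg hc i
  nat_eq_zero a ha := by
    simp only [List.mem_cons, List.not_mem_nil, or_false, not_or] at ha
    simp only [inputState, if_neg ha.1, if_neg ha.2.1, if_neg ha.2.2]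
  real_eq_zero a ha := by
    simp only [List.mem_cons, List.not_mem_nil, or_false, not_or] at ha
    simp only [inputState, if_neg ha.1, if_neg ha.2]

end Input

/-! ### The running time -/

theorem natLog_two_le_two_mul_log (n : ℕ) : (Nat.log 2 n : ℝ) ≤ 2 * Real.log n := by
  have hlogb := Real.natLog_le_logb n 2
  rw [Nat.cast_two, Real.logb, le_div_iff₀ (Real.log_pos one_lt_two)] at hlogb
  have hlog_two : 1 / 2 ≤ Real.log 2 := by linarith [Real.log_two_gt_d9]
  nlinarith [Nat.cast_nonneg (α := ℝ) (Nat.log 2 n)]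

theorem exists_time_bound {n m : ℕ} (hm : m ≤ n * n) (hn : 0 < m → 2 ≤ n) :
    ∃ l, 2 * m ≤ 2 ^ l ∧ (0 < m → n ≤ 2 ^ l) ∧
      (((m + 1) * ((l + 1) * 2570) : ℕ) : ℝ) ≤ 100000 * (m * Real.log n + 1) := by
  rcases Nat.eq_zero_or_pos m with rfl | hm₀
  · exact ⟨0, by simp, by simp, by norm_num⟩
  have hlt : n < 2 ^ (Nat.log 2 n + 1) := Nat.lt_pow_succ_log_self one_lt_two n
  have hL : 1 ≤ Nat.log 2 n := Nat.log_pos one_lt_two (hn hm₀)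
  have hlog := natLog_two_le_two_mul_log n
  set L := Nat.log 2 n
  refine ⟨2 * L + 3, ?_, fun _ => hlt.le.trans (Nat.pow_le_pow_right two_pos (by omega)), ?_⟩
  · calc 2 * m ≤ 2 * (2 ^ (L + 1) * 2 ^ (L + 1)) :=
          Nat.mul_le_mul_left 2 (hm.trans (Nat.mul_le_mul hlt.le hlt.le))
      _ = 2 ^ (2 * L + 3) := by ring
  · have hT : (m + 1) * ((2 * L + 3 + 1) * 2570) ≤ 30840 * (m * L) := by nlinarith
    have hmL : (m : ℝ) * L ≤ m * (2 * Real.log n) := by gcongr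
    have hT' : (((m + 1) * ((2 * L + 3 + 1) * 2570) : ℕ) : ℝ) ≤ 30840 * (m * L) := by
      exact_mod_cast hT
    linarith [Real.log_natCast_nonneg n, mul_nonneg m.cast_nonneg (Real.log_natCast_nonneg n)]

end KCut

theorem mainTheorem3 :
    ∃ (P : RealRAM.Prog) (A : ℝ),
      ∀ (n m k : ℕ) (G : SimpleGraph (Fin n)) [Fintype G.edgeSet]
        (c x : G.edgeSet → ℝ)
        (ε : Fin m ≃ G.edgeSet) (u v : Fin m → Fin n),
        (∀ i, (ε i : Sym2 (Fin n)) = s(u i, v i)) →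
        (∀ e, 0 < c e) →
        KCut.IsFeasible G k x →
        ∃ (s : RealRAM.State) (T : ℕ) (C : Finset G.edgeSet),
          RealRAM.Run P (KCut.inputState k u v (fun i => c (ε i)) (fun i => x (ε i))) s T ∧
          (T : ℝ) ≤ A * ((m : ℝ) * Real.log (n : ℝ) + 1) ∧
          KCut.Outputs ε s C ∧
          KCut.IsKCut G k C ∧
          ∑ e ∈ C, c e ≤ 2 * (1 - 1 / (n : ℝ)) * ∑ e, c e * x e := by
  refine ⟨KCut.roundingProg, 100000, fun n m k G _ c x ε u v hε hc hx => ?_⟩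
  obtain ⟨l, hml, hnl, htime⟩ :=
    KCut.exists_time_bound (KCut.card_edges_le hε) (KCut.two_le_of_edge hε)
  have hinput := KCut.isInput_inputState (k := k) (c := fun i => c (ε i)) (x := fun i => x (ε i))
    hε fun i => (hc (ε i)).le
  obtain ⟨s, T, hrun, hT, f, σ, acc, a, b, ρ, hround, hout⟩ :=
    hinput.halts_roundingProg hx.le hml hnl
  let C := (Finset.univ.filter fun i : Fin m => s.nat KCut.output i = 1).map ε.toEmbedding
  have hC : KCut.Outputs ε s C := fun i => by simp [C]
  have hCsep (i : Fin m) : ε i ∈ C ↔ ∃ t < f + k - n, KCut.Separates a b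
      (KCut.chosenCand m (KCut.toArray fun i => (u i : ℕ)) (KCut.toArray fun i => (v i : ℕ))
        (KCut.toArray fun i => c (ε i)) a b (ρ t)) (u i) (v i) := by
    rw [← KCut.toArray_apply (fun i => (u i : ℕ)) i, ← KCut.toArray_apply (fun i => (v i : ℕ)) i]
    exact (hC i).trans (hout i i.2)
  exact ⟨s, T, C, hrun, (Nat.cast_le.2 hT).trans htime, hC,
    KCut.isKCut_of_isRounding hε hx hround hCsep,
    KCut.sum_cost_le_of_isRounding hε hx hround hCsep fun e => (hc e).le⟩
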